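/- **Total energy balance for smooth solutions.** Let $d\in\{2,3\}$, let $\Omega\subset\mathbb R^d$ be bounded and open with smooth boundary $\Gamma$ and unit outward normal $n$, and let $T>0$, $p\ge 1$. Notation: $(\nabla v)_{ij}=\partial_jv_i$, $(\operatorname{div}A)_i=\sum_j\partial_jA_{ij}$, $(\operatorname{div}G)_{ij}=\sum_k\partial_kG_{ijk}$, $e(v)=\frac12(\nabla v+\nabla v^\top)$, $\operatorname{skw}A=\frac12(A-A^\top)$, $\dot m=\partial_tm+(v\cdot\nabla)m$, $\overset{\circ}{m}=\dot m-\operatorname{skw}(\nabla v)m$; $\operatorname{div}_S$ is the surface divergence on $\Gamma$, $[\,\cdot\,]_{\rm t}$ the tangential part; $\operatorname{Dir}(r)=\{r/|r|\}$ for $r\ne0$ and $\operatorname{Dir}(0)$ is the closed unit ball; for $d=2$ the in-plane part of a vector product of plane vectors is meant, which is zero. *Data.* Constants $\tau,\nu_1,\nu_2,\nu_\flat,\mu_0$. Referential energies $\varphi(F,m)$, $\zeta(F,m,\theta)$ and $\kappa(F)$ of class $C^2$, and a conductivity $\mathcal K(F,\theta)$ of class $C^1$, for $\det F>0$, $m\in\mathbb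 R^d$ and $\theta$ in an open set of temperatures (for instance $(0,\infty)$); functions $h_c(F,\theta)$ and $\gamma(F,m,\theta)>0$. The function $\zeta(\cdot,m,\theta)$ is frame indifferent, $\zeta(QF,m,\theta)=\zeta(F,m,\theta)$ for all $Q\in SO(d)$ (so $\zeta_F'F^\top$ is symmetric). Put $\psi_m'=\varphi_m'+\zeta_m'$ and $$\omega=\frac{\zeta-\theta\zeta_\theta'}{\det F},\qquad \xi=\nu_1|e(v)|^p+\nu_2|\nabla^2v|^p+\tau|\overset{\circ}{m}|^2+h_c|\overset{\circ}{m}|.$$ The loads are the gravity $g$, an external field $h_{\rm ext}$ of class $C^1$ up to the boundary, the traction $k$, and the boundary heat flux $h(\theta)=h(t,x,\theta)$. *System.* On $(0,T)\times\Omega$, with $\mathsf h=h_{\rm ext}+\nabla u$, $j=-\mathcal K\nabla\theta$ and $w=\omega(F,m,\theta)$, $$\begin{aligned} &\partial_t\varrho=-\operatorname{div}(\varrho v),\qquad \partial_tF=(\nabla v)F-(v\cdot\nabla)F,\\ &\partial_t(\varrho v)=\operatorname{div}\big(A-\varrho v\otimes v\big)+\mu_0(\nabla \mathsf h)^\top m-\mu_0\nabla(\mathsf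 h\cdot m)+\varrho g,\qquad A=\mathsf T+\mathsf K+\mathsf S+\mathsf D-\operatorname{div}(\mathcal H+\mathcal S),\\ &\tau\overset{\circ}{m}+h_c\operatorname{Dir}(\overset{\circ}{m})-\frac{m\times\overset{\circ}{m}}{\gamma}\ni\mu_0 \mathsf h-\frac{\psi_m'}{\det F}+\operatorname{div}\Big(\frac{\kappa(F)}{\det F}\nabla m\Big),\\ &\partial_tw=\xi+\frac{\zeta_F'F^\top}{\det F}:e(v)+\frac{\zeta_m'}{\det F}\cdot\dot m-\operatorname{div}(j+wv), \end{aligned}$$ where $$\begin{aligned} &\mathsf T=\Big(\frac{\varphi_F'+\zeta_F'}{\det F}+\frac{|\nabla m|^2\kappa'(F)}{2\det F}\Big)F^\top,\quad \mathsf K_{ij}=-\frac{\kappa(F)}{\det F}\sum_k\partial_im_k\,\partial_jm_k,\quad \mathsf D=\nu_1|e(v)|^{p-2}e(v),\\ &\mathsf S=\operatorname{skw}\Big(\Big(\frac{\psi_m'}{\det F}-\mu_0 \mathsf h\Big)\otimes m\Big),\quad \mathcal H=\nu_2|\nabla^2v|^{p-2}\nabla^2v,\quad \mathcal S_{ijk}=\frac{\kappa(F)}{2\det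 F}\big(m_j\partial_km_i-m_i\partial_km_j\big); \end{aligned}$$ and for every $t$, $\Delta u=\operatorname{div}(\chi_\Omega m)$ weakly on $\mathbb R^d$ with $\nabla u\in L^2(\mathbb R^d)$ and $u(x)\to0$ as $|x|\to\infty$. On $(0,T)\times\Gamma$, $$\begin{aligned} &v\cdot n=0,\qquad \big[An-\operatorname{div}_S\big((\mathcal H+\mathcal S)n\big)\big]_{\rm t}+\nu_\flat|v|^{p-2}v=k,\qquad \nabla^2v:(n\otimes n)=0,\qquad (n\cdot\nabla)m=0,\\ &-j\cdot n=\mathcal K\nabla\theta\cdot n=h(\theta)+\tfrac{\nu_\flat}2|v|^p . \end{aligned}$$ *Smooth solution.* $\varrho,v,F,m,\theta$ and $u|_{\Omega}$ are $C^\infty$ on $(0,T)\times\overline\Omega$, with $\det F>0$ and $\theta$ in the set of temperatures where the data are given; for every $t$, $u(t,\cdot)$ is continuous on $\mathbb R^d$ and smooth up to $\Gamma$ also from outside, $\mathsf D(t,\cdot)\in C^1(\overline\Omega)$ and $\mathcal H(t,\cdot)\in C^2(\overline\Omega)$. *Claim.* For every smooth solution and every $t\in(0,T)$ all the integrals below converge,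 the total energy is differentiable at $t$, and $$\begin{aligned} &\frac{\rm d}{{\rm d}t}\bigg(\int_\Omega\frac\varrho2|v|^2+\frac{\varphi(F,m)}{\det F}+\frac{\kappa(F)|\nabla m|^2}{2\det F}-\mu_0 \mathsf h\cdot m+\omega(F,m,\theta)\,{\rm d}x+\int_{\mathbb R^d}\frac{\mu_0}2|\nabla u|^2\,{\rm d}x\bigg)+\int_\Gamma\frac{\nu_\flat}2|v|^p\,{\rm d}S\\ &\qquad=\int_\Omega\varrho g\cdot v-\mu_0\,\partial_th_{\rm ext}\cdot m\,{\rm d}x+\int_\Gamma k\cdot v+h(\theta)\,{\rm d}S . \end{aligned}$$ -/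

import Mathlib

open MeasureTheory Set Filter Topology
open scoped ContDiff Matrix RealInnerProductSpace

attribute [local instance] Matrix.frobeniusNormedAddCommGroup Matrix.frobeniusNormedSpace

noncomputable section

namespace ThermoMagnet

/-- The physical space `ℝᵈ` with the Euclidean norm. -/
abbrev Vec (d : ℕ) := EuclideanSpace ℝ (Fin d)

/-- Real `d × d` matrices; `‖A‖` is the Frobenius (Euclidean) norm. -/
abbrev Mat (d : ℕ) := Matrix (Fin d) (Fin d) ℝ

/-- Third-order tensors, by components. -/
abbrev Tens (d : ℕ) := Fin d → Fin d → Fin d → ℝ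

/-! ### Tensor algebra -/

/-- The scalar product `A : B` of matrices. -/
def ddot {d : ℕ} (A B : Mat d) : ℝ := ∑ i, ∑ j, A i j * B i j

/-- The Euclidean norm of a third-order tensor. -/
def tnorm {d : ℕ} (G : Tens d) : ℝ := Real.sqrt (∑ i, ∑ j, ∑ k, G i j k ^ 2)

/-- Symmetric part of a matrix. -/
def symPart {d : ℕ} (A : Mat d) : Mat d := (1 / 2 : ℝ) • (A + Aᵀ)

/-- Skew-symmetric part of a matrix. -/
def skwPart {d : ℕ} (A : Mat d) : Mat d := (1 / 2 : ℝ) • (A - Aᵀ)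

/-- The dyad `a ⊗ b`. -/
def dyad {d : ℕ} (a b : Vec d) : Mat d := Matrix.of fun i j => a i * b j

/-- A matrix applied to a vector. -/
def mulV {d : ℕ} (A : Mat d) (a : Vec d) : Vec d := WithLp.toLp 2 fun i => ∑ j, A i j * a j

/-- A vector of `ℝᵈ`, `d ≤ 3`, as a vector of `ℝ³` (missing components are zero). -/
def pad3 {d : ℕ} (a : Vec d) : Fin 3 → ℝ := fun k => if h : k.val < d then a ⟨k.val, h⟩ else 0

/-- The vector product. For `d = 3` it is the usual one. For `d = 2` vectors of the plane are
regarded as vectors of `ℝ³`, and the in-plane part of their vector product is taken. -/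
def cross {d : ℕ} (a b : Vec d) : Vec d :=
  WithLp.toLp 2 fun i => if h : i.val < 3 then crossProduct (pad3 a) (pad3 b) ⟨i.val, h⟩ else 0

/-- The set-valued direction map: the closed unit ball at `0`, and `{r / |r|}` at `r ≠ 0`. -/
def Dir {d : ℕ} (r : Vec d) : Set (Vec d) :=
  {δ | if r = 0 then ‖δ‖ ≤ 1 else δ = ‖r‖⁻¹ • r}

/-! ### Differential operators in the space variable -/

/-- The partial derivative `∂f/∂x_j`. -/
def pd {d : ℕ} (j : Fin d) (f : Vec d → ℝ) (x : Vec d) : ℝ :=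
  fderiv ℝ f x (EuclideanSpace.single j 1)

/-- The gradient `∇a` of a vector field, `(∇a)_{ij} = ∂a_i/∂x_j`. -/
def gradV {d : ℕ} (a : Vec d → Vec d) (x : Vec d) : Mat d :=
  Matrix.of fun i j => pd j (fun y => a y i) x

/-- The second gradient, `(∇²a)_{ijk} = ∂²a_i/∂x_j∂x_k`. -/
def hessV {d : ℕ} (a : Vec d → Vec d) (x : Vec d) : Tens d :=
  fun i j k => pd k (fun y => pd j (fun z => a z i) y) x

/-- Divergence of a vector field. -/
def divV {d : ℕ} (a : Vec d → Vec d) (x : Vec d) : ℝ := ∑ j, pd j (fun y => a y j) x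

/-- Divergence of a matrix field, `(div A)_i = ∑_j ∂A_{ij}/∂x_j`. -/
def divM {d : ℕ} (A : Vec d → Mat d) (x : Vec d) : Vec d :=
  WithLp.toLp 2 fun i => ∑ j, pd j (fun y => A y i j) x

/-- Divergence of a field of third-order tensors, `(div G)_{ij} = ∑_k ∂G_{ijk}/∂x_k`. -/
def divT {d : ℕ} (G : Vec d → Tens d) (x : Vec d) : Mat d :=
  Matrix.of fun i j => ∑ k, pd k (fun y => G y i j k) x

/-! ### The domain, its unit normal and its surface measure -/

/-- `Ω` is a bounded open set with smooth boundary, presented by a smooth defining function `Φ`. -/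
structure IsSmoothDomain {d : ℕ} (Ω : Set (Vec d)) (Φ : Vec d → ℝ) : Prop where
  bounded : Bornology.IsBounded Ω
  smooth : ContDiff ℝ ∞ Φ
  eq_sublevel : Ω = {x | Φ x < 0}
  regular : ∀ x, Φ x = 0 → gradient Φ x ≠ 0

/-- The unit outward normal to `Γ = {Φ = 0} = ∂{Φ < 0}`. -/
def normal {d : ℕ} (Φ : Vec d → ℝ) (x : Vec d) : Vec d := ‖gradient Φ x‖⁻¹ • gradient Φ x

/-- The surface measure on `Γ = ∂Ω`: the `(d-1)`-dimensional Hausdorff measure, normalized so that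
it is the Lebesgue measure on `(d-1)`-dimensional Euclidean spaces. -/
def surf {d : ℕ} (Ω : Set (Vec d)) : Measure (Vec d) := (μHE[d - 1]).restrict (frontier Ω)

/-- The tangential part of a vector `a`, where `n` is the unit normal. -/
def tang {d : ℕ} (n a : Vec d) : Vec d := a - ⟪a, n⟫ • n

/-- The surface divergence `(div_S A)_i = tr(∇_S A_i)` at `x` of a matrix field given on the
hypersurface `Γ`. The derivative along `Γ` is used in tangential directions only, where it does not
depend on values of `A` off `Γ`. -/
def surfDiv {d : ℕ} (Γ : Set (Vec d)) (n : Vec d → Vec d) (A : Vec d → Mat d) (x : Vec d) : Vec d :=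
  WithLp.toLp 2 fun i => ∑ j,
    fderivWithin ℝ (fun y => A y i j) Γ x (tang (n x) (EuclideanSpace.single j 1))

/-- `f` is of class `Cⁿ` on `(0,T) × Ω̄` up to the boundary of `Ω`. -/
def SmoothUpTo {d : ℕ} {X : Type*} [NormedAddCommGroup X] [NormedSpace ℝ X] (n : WithTop ℕ∞)
    (T : ℝ) (Ω : Set (Vec d)) (f : ℝ → Vec d → X) : Prop :=
  ∃ U : Set (ℝ × Vec d), IsOpen U ∧ Ioo 0 T ×ˢ closure Ω ⊆ U ∧
    ContDiffOn ℝ n (fun q : ℝ × Vec d => f q.1 q.2) U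

/-- `f` is of class `Cⁿ` on the set `S`, in the sense of having such an extension near `S`. -/
def SmoothNear {d : ℕ} {X : Type*} [NormedAddCommGroup X] [NormedSpace ℝ X] (n : WithTop ℕ∞)
    (S : Set (Vec d)) (f : Vec d → X) : Prop :=
  ∃ U : Set (Vec d), IsOpen U ∧ S ⊆ U ∧ ContDiffOn ℝ n f U

/-! ### The material -/

/-- `GL⁺(d)`. -/
def GLpos (d : ℕ) : Set (Mat d) := {F | 0 < F.det}

/-- The constitutive functions and constants. -/
structure Material (d : ℕ) where
  /-- referential stored energy `φ(F, m)` -/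
  φ : Mat d → Vec d → ℝ
  /-- thermal part `ζ(F, m, θ)` of the referential free energy -/
  ζ : Mat d → Vec d → ℝ → ℝ
  /-- exchange-energy coefficient `κ(F)` -/
  κ : Mat d → ℝ
  /-- temperatures for which the constitutive functions are given, e.g. `(0, ∞)` -/
  Θ : Set ℝ
  /-- coercive force `h_c(F, θ)` -/
  hc : Mat d → ℝ → ℝ
  /-- gyromagnetic ratio `γ(F, m, θ)` -/
  γ : Mat d → Vec d → ℝ → ℝ
  /-- heat conductivity `𝒦(F, θ)` -/
  cond : Mat d → ℝ → ℝ
  /-- magnetic damping coefficient -/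
  τ : ℝ
  /-- bulk viscosity -/
  ν₁ : ℝ
  /-- bulk hyperviscosity -/
  ν₂ : ℝ
  /-- boundary viscosity `ν_♭` -/
  νb : ℝ
  /-- vacuum permeability -/
  μ₀ : ℝ
  /-- viscosity exponent -/
  p : ℝ

/-- The qualification of the material. The last field is the frame indifference of
`ζ(·, m, θ)`, that is, of the thermal part alone. -/
structure Material.Admissible {d : ℕ} (M : Material d) : Prop where
  one_le_p : 1 ≤ M.p
  isOpen_Θ : IsOpen M.Θ
  φ_smooth : ContDiffOn ℝ 2 (fun q : Mat d × Vec d => M.φ q.1 q.2) (GLpos d ×ˢ univ)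
  ζ_smooth : ContDiffOn ℝ 2 (fun q : Mat d × Vec d × ℝ => M.ζ q.1 q.2.1 q.2.2)
    (GLpos d ×ˢ univ ×ˢ M.Θ)
  κ_smooth : ContDiffOn ℝ 2 M.κ (GLpos d)
  cond_smooth : ContDiffOn ℝ 1 (fun q : Mat d × ℝ => M.cond q.1 q.2) (GLpos d ×ˢ M.Θ)
  γ_pos : ∀ F ∈ GLpos d, ∀ m, ∀ θ ∈ M.Θ, 0 < M.γ F m θ
  ζ_frame : ∀ Q ∈ Matrix.specialOrthogonalGroup (Fin d) ℝ, ∀ F ∈ GLpos d, ∀ m, ∀ θ ∈ M.Θ,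
    M.ζ (Q * F) m θ = M.ζ F m θ

/-- The derivative `f'(F)` of a function of a matrix, as a matrix. -/
def dMat {d : ℕ} (f : Mat d → ℝ) (F : Mat d) : Mat d :=
  Matrix.of fun i j => fderiv ℝ f F (Matrix.single i j 1)

namespace Material

variable {d : ℕ} (M : Material d)

/-- `φ'_F` -/
def φF (F : Mat d) (m : Vec d) : Mat d := dMat (fun G => M.φ G m) F

/-- `ζ'_F` -/
def ζF (F : Mat d) (m : Vec d) (θ : ℝ) : Mat d := dMat (fun G => M.ζ G m θ) F

/-- `ζ'_m` -/
def ζm (F : Mat d) (m : Vec d) (θ : ℝ) : Vec d := gradient (fun a => M.ζ F a θ) m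

/-- `ψ'_m = φ'_m + ζ'_m` -/
def ψm (F : Mat d) (m : Vec d) (θ : ℝ) : Vec d := gradient (fun a => M.φ F a) m + M.ζm F m θ

/-- The heat part `ω = (ζ - θ ζ'_θ) / det F` of the internal energy. -/
def heatPart (F : Mat d) (m : Vec d) (θ : ℝ) : ℝ :=
  (M.ζ F m θ - θ * deriv (fun s => M.ζ F m s) θ) / F.det

/-- The heat production rate `ξ(F, θ; e, G, r)`. -/
def ξ (F : Mat d) (θ : ℝ) (e : Mat d) (G : Tens d) (r : Vec d) : ℝ :=
  M.ν₁ * ‖e‖ ^ M.p + M.ν₂ * tnorm G ^ M.p + M.τ * ‖r‖ ^ 2 + M.hc F θ * ‖r‖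

end Material

/-- The external data: gravity, external magnetic field, traction, and boundary heat flux. -/
structure Loads (d : ℕ) where
  g : ℝ → Vec d → Vec d
  hext : ℝ → Vec d → Vec d
  k : ℝ → Vec d → Vec d
  /-- the heat flux `h(t, x, θ)` through the boundary into the body -/
  h : ℝ → Vec d → ℝ → ℝ

/-! ### The unknowns, and the fields derived from them -/

/-- The unknown fields. Besides the six unknowns `ρ, v, F, m, u, θ`, it holds `uΩ`, which is the
restriction of `u` to `Ω̄` (extended smoothly), and the dissipative stress `D` and the dissipative
hyperstress `H`, which the constitutive relations determine on `Ω̄`. -/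
structure State (d : ℕ) where
  ρ : ℝ → Vec d → ℝ
  v : ℝ → Vec d → Vec d
  F : ℝ → Vec d → Mat d
  m : ℝ → Vec d → Vec d
  u : ℝ → Vec d → ℝ
  θ : ℝ → Vec d → ℝ
  uΩ : ℝ → Vec d → ℝ
  D : ℝ → Vec d → Mat d
  H : ℝ → Vec d → Tens d

namespace State

variable {d : ℕ} (S : State d) (M : Material d) (L : Loads d) (t : ℝ) (x : Vec d)

/-- The time derivative of the magnetization. -/
def dtm : Vec d := deriv (fun s => S.m s x) t

/-- The convective time derivative `ṁ = ∂m/∂t + (v·∇)m`. -/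
def convm : Vec d := S.dtm t x + mulV (gradV (S.m t) x) (S.v t x)

/-- The corotational (Zaremba–Jaumann) time derivative `ṁ - skw(∇v) m`. -/
def corotm : Vec d := S.convm t x - mulV (skwPart (gradV (S.v t) x)) (S.m t x)

/-- The small strain rate `e(v)`. -/
def strainRate : Mat d := symPart (gradV (S.v t) x)

/-- The actual exchange coefficient `κ(F) / det F`. -/
def κact : ℝ := M.κ (S.F t x) / (S.F t x).det

/-- The total magnetic field `h = h_ext + ∇u` in the body. -/
def field : Vec d := L.hext t x + gradient (S.uΩ t) x

/-- The conservative Cauchy stress `T`. -/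
def stressT : Mat d :=
  ((1 / (S.F t x).det) • (M.φF (S.F t x) (S.m t x) + M.ζF (S.F t x) (S.m t x) (S.θ t x)) +
    (‖gradV (S.m t) x‖ ^ 2 / (2 * (S.F t x).det)) • dMat M.κ (S.F t x)) * (S.F t x)ᵀ

/-- The Korteweg stress, `K_{ij} = -(κ(F)/det F) ∑_k ∂_i m_k ∂_j m_k`. -/
def stressK : Mat d := -(S.κact M t x • ((gradV (S.m t) x)ᵀ * gradV (S.m t) x))

/-- The skew-symmetric magnetic stress, `skw((ψ'_m/det F - μ₀ h) ⊗ m)`. -/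
def stressS : Mat d :=
  skwPart (dyad ((1 / (S.F t x).det) • M.ψm (S.F t x) (S.m t x) (S.θ t x)
    - M.μ₀ • S.field L t x) (S.m t x))

/-- The skew-symmetric magnetic hyperstress `(κ(F)/det F) Skw(∇m ⊗ m)`, with
`Skw(∇m ⊗ m)_{ijk} = (m_j ∂_k m_i - m_i ∂_k m_j)/2`. -/
def hyperS : Tens d := fun i j k =>
  S.κact M t x * ((S.m t x j * gradV (S.m t) x i k - S.m t x i * gradV (S.m t) x j k) / 2)

/-- The total hyperstress. -/
def hyper : Tens d := S.H t x + S.hyperS M t x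

/-- The total Cauchy stress `T + K + S + D - div(H + 𝒮)`. -/
def stress : Mat d :=
  S.stressT M t x + S.stressK M t x + S.stressS M L t x + S.D t x
    - divT (fun y => S.hyper M t y) x

/-- The magnetic force `μ₀ (∇h)ᵀ m - μ₀ ∇(h·m)`. -/
def magForce : Vec d :=
  M.μ₀ • mulV (gradV (fun y => S.field L t y) x)ᵀ (S.m t x)
    - M.μ₀ • gradient (fun y => ⟪S.field L t y, S.m t y⟫) x

/-- The heat flux `j = -𝒦(F, θ) ∇θ`. -/
def heatFlux : Vec d := -(M.cond (S.F t x) (S.θ t x) • gradient (S.θ t) x)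

/-- The heat part `w = ω(F, m, θ)` of the internal energy. -/
def w : ℝ := M.heatPart (S.F t x) (S.m t x) (S.θ t x)

/-- The hyperstress applied to the normal, `((H + 𝒮) n)_{ij} = ∑_k (H + 𝒮)_{ijk} n_k`. -/
def hyperNormal (n : Vec d) : Mat d := Matrix.of fun i j => ∑ k, S.hyper M t x i j k * n k

end State

/-! ### Smooth solutions -/

/-- `S` is smooth up to the boundary, with `det F > 0` and admissible temperatures. The potential
is continuous and smooth on both sides of `Γ`; the stresses `D` and `H` are of the class needed
for the momentum equation to hold classically. -/
structure IsSmoothState {d : ℕ} (T : ℝ) (Ω : Set (Vec d)) (M : Material d) (S : State d) :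
    Prop where
  ρ_smooth : SmoothUpTo ∞ T Ω S.ρ
  v_smooth : SmoothUpTo ∞ T Ω S.v
  F_smooth : SmoothUpTo ∞ T Ω S.F
  m_smooth : SmoothUpTo ∞ T Ω S.m
  θ_smooth : SmoothUpTo ∞ T Ω S.θ
  uΩ_smooth : SmoothUpTo ∞ T Ω S.uΩ
  u_eq : ∀ t ∈ Ioo 0 T, ∀ x ∈ closure Ω, S.u t x = S.uΩ t x
  u_cont : ∀ t ∈ Ioo 0 T, Continuous (S.u t)
  u_ext : ∀ t ∈ Ioo 0 T, ∃ b : Vec d → ℝ, SmoothNear ∞ Ωᶜ b ∧ ∀ x ∈ Ωᶜ, S.u t x = b x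
  D_smooth : ∀ t ∈ Ioo 0 T, SmoothNear 1 (closure Ω) (S.D t)
  D_eq : ∀ t ∈ Ioo 0 T, ∀ x ∈ closure Ω,
    S.D t x = (M.ν₁ * ‖S.strainRate t x‖ ^ (M.p - 2)) • S.strainRate t x
  H_smooth : ∀ t ∈ Ioo 0 T, SmoothNear 2 (closure Ω) (S.H t)
  H_eq : ∀ t ∈ Ioo 0 T, ∀ x ∈ closure Ω,
    S.H t x = (M.ν₂ * tnorm (hessV (S.v t) x) ^ (M.p - 2)) • hessV (S.v t) x
  det_pos : ∀ t ∈ Ioo 0 T, ∀ x ∈ closure Ω, S.F t x ∈ GLpos d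
  θ_mem : ∀ t ∈ Ioo 0 T, ∀ x ∈ closure Ω, S.θ t x ∈ M.Θ

/-- The evolution equations on `Ω` at the time `t`. -/
structure BulkEquations {d : ℕ} (Ω : Set (Vec d)) (M : Material d) (L : Loads d) (S : State d)
    (t : ℝ) : Prop where
  /-- `∂ρ/∂t = -div(ρ v)` -/
  mass : ∀ x ∈ Ω, deriv (fun s => S.ρ s x) t = -divV (fun y => S.ρ t y • S.v t y) x
  /-- `∂(ρ v)/∂t = div(T + K + S + D - div(H + 𝒮) - ρ v ⊗ v) + f_mag + ρ g` -/
  momentum : ∀ x ∈ Ω, deriv (fun s => S.ρ s x • S.v s x) t =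
    divM (fun y => S.stress M L t y - S.ρ t y • dyad (S.v t y) (S.v t y)) x
      + S.magForce M L t x + S.ρ t x • L.g t x
  /-- `∂F/∂t = (∇v) F - (v·∇) F`, by components -/
  transport : ∀ x ∈ Ω, ∀ i j, deriv (fun s => S.F s x i j) t =
    (gradV (S.v t) x * S.F t x) i j - ∑ k, S.v t x k * pd k (fun y => S.F t y i j) x
  /-- the Landau–Lifshitz–Gilbert inclusion -/
  flowRule : ∀ x ∈ Ω, ∃ δ ∈ Dir (S.corotm t x),
    M.τ • S.corotm t x + M.hc (S.F t x) (S.θ t x) • δ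
      - (1 / M.γ (S.F t x) (S.m t x) (S.θ t x)) • cross (S.m t x) (S.corotm t x) =
    M.μ₀ • S.field L t x - (1 / (S.F t x).det) • M.ψm (S.F t x) (S.m t x) (S.θ t x)
      + divM (fun y => S.κact M t y • gradV (S.m t) y) x
  /-- the heat equation in the enthalpy formulation -/
  heat : ∀ x ∈ Ω, deriv (fun s => S.w M s x) t =
    M.ξ (S.F t x) (S.θ t x) (S.strainRate t x) (hessV (S.v t) x) (S.corotm t x)
      + ddot (M.ζF (S.F t x) (S.m t x) (S.θ t x) * (S.F t x)ᵀ) (S.strainRate t x) / (S.F t x).det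
      + ⟪M.ζm (S.F t x) (S.m t x) (S.θ t x), S.convm t x⟫ / (S.F t x).det
      - divV (fun y => S.heatFlux M t y + S.w M t y • S.v t y) x

/-- The equation `Δu = div(χ_Ω m)` on `ℝᵈ` with `∇u ∈ L²` and `u(∞) = 0`, at the time `t`. -/
structure PotentialEquation {d : ℕ} (Ω : Set (Vec d)) (S : State d) (t : ℝ) : Prop where
  finite_energy : MemLp (fun x => gradient (S.u t) x) 2 volume
  weak : ∀ η : Vec d → ℝ, ContDiff ℝ ∞ η → HasCompactSupport η →
    ∫ x, ⟪gradient (S.u t) x, gradient η x⟫ = ∫ x in Ω, ⟪S.m t x, gradient η x⟫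
  vanishing : Tendsto (S.u t) (cocompact (Vec d)) (𝓝 0)

/-- The boundary conditions on `Γ = ∂Ω` at the time `t`. -/
structure BoundaryConditions {d : ℕ} (Ω : Set (Vec d)) (Φ : Vec d → ℝ) (M : Material d)
    (L : Loads d) (S : State d) (t : ℝ) : Prop where
  /-- `v · n = 0` -/
  impermeable : ∀ x ∈ frontier Ω, ⟪S.v t x, normal Φ x⟫ = 0
  /-- `[(T + K + S + D - div(H + 𝒮)) n - div_S((H + 𝒮) n)]_T + ν_♭ |v|^{p-2} v = k` -/
  traction : ∀ x ∈ frontier Ω,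
    tang (normal Φ x) (mulV (S.stress M L t x) (normal Φ x)
        - surfDiv (frontier Ω) (normal Φ) (fun y => S.hyperNormal M t y (normal Φ y)) x)
      + (M.νb * ‖S.v t x‖ ^ (M.p - 2)) • S.v t x = L.k t x
  /-- `∇²v : (n ⊗ n) = 0` -/
  hyper : ∀ x ∈ frontier Ω, ∀ i,
    ∑ j, ∑ k, hessV (S.v t) x i j k * normal Φ x j * normal Φ x k = 0
  /-- `(n·∇) m = 0` -/
  magnetic : ∀ x ∈ frontier Ω, mulV (gradV (S.m t) x) (normal Φ x) = 0
  /-- `-j · n = h(θ) + (ν_♭/2) |v|^p` -/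
  heat : ∀ x ∈ frontier Ω, -⟪S.heatFlux M t x, normal Φ x⟫ =
    L.h t x (S.θ t x) + M.νb / 2 * ‖S.v t x‖ ^ M.p

/-- `S` is a smooth solution on the time interval `(0, T)` of the full system on `Ω`, with the
boundary conditions. -/
structure IsSmoothSolution {d : ℕ} (T : ℝ) (Ω : Set (Vec d)) (Φ : Vec d → ℝ) (M : Material d)
    (L : Loads d) (S : State d) : Prop where
  smooth : IsSmoothState T Ω M S
  bulk : ∀ t ∈ Ioo 0 T, BulkEquations Ω M L S t
  potential : ∀ t ∈ Ioo 0 T, PotentialEquation Ω S t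
  boundary : ∀ t ∈ Ioo 0 T, BoundaryConditions Ω Φ M L S t

/-! ### The energy -/

namespace State

variable {d : ℕ} (S : State d) (M : Material d) (L : Loads d)

/-- The density of the kinetic, stored, exchange, Zeeman and heat energies in the body. -/
def energyDensity (t : ℝ) (x : Vec d) : ℝ :=
  S.ρ t x / 2 * ‖S.v t x‖ ^ 2 + M.φ (S.F t x) (S.m t x) / (S.F t x).det
    + M.κ (S.F t x) * ‖gradV (S.m t) x‖ ^ 2 / (2 * (S.F t x).det)
    - M.μ₀ * ⟪S.field L t x, S.m t x⟫ + M.heatPart (S.F t x) (S.m t x) (S.θ t x)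

/-- The total energy, including that of the demagnetizing field. -/
def totalEnergy (Ω : Set (Vec d)) (t : ℝ) : ℝ :=
  (∫ x in Ω, S.energyDensity M L t x) + ∫ x, M.μ₀ / 2 * ‖gradient (S.u t) x‖ ^ 2

end State

end ThermoMagnet

end

/-! The balance comes from testing every equation with its natural partner. Momentum is tested with
`v` and corrected by the mass balance, the flow rule is tested with the corotational rate of `m`,
and the heat equation is integrated as it stands. What remains is the divergence of a flux, whose
normal component is computed from the boundary conditions.

In the interior, `F` is transported by `Ḟ = (∇v)F`, so a referential energy divided by `det F`
changes, convection included, at the rate of its referential material derivative divided by `det F`.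
Stored and thermal stresses, the `κ'` stress and the Korteweg stress are exactly conjugate to these
rates. The Korteweg stress absorbs the commutator of the material derivative with `∇m`. The skew
stress and the divergence of the skew hyperstress combine to `skw(r ⊗ m)`, where `r` is the magnetic
driving force (`State.drive`). Its power turns `r · ṁ` into `r` times the corotational rate, and the
flow rule evaluates the latter because the gyromagnetic term does no work and an element of `Dir a`
has inner product `|a|` with `a`. Mechanical and magnetic dissipation cancel against the heat source
`ξ`. The adiabatic term of the heat equation contains `e(v)` instead of `∇v`, which is harmless
because frame indifference makes `ζ'_F Fᵀ` symmetric. This gives `local_balance`.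

At the boundary, `v · n = 0` removes convection and `(n·∇)m = 0` removes the exchange flux and `𝒮n`.
The remaining hypertraction `(𝓗 + 𝒮)n` is annihilated by `n` in its second slot, so its power
involves only tangential derivatives of `v`. The surface product rule then leaves the traction
condition and the surface divergence of a tangential field, which integrates to zero over a closed
surface. Friction takes `ν_♭|v|^p` of power and half of it returns as boundary heat, hence the
factor one half.

The magnetostatic energy is nonlocal. Testing the potential equation at one time with the potential
at another gives `∫ m(t)·∇u(s) = ∫ m(s)·∇u(t)`. At `s = t` this reduces the whole-space energy to an
integral over `Ω`. Differentiated in `s`, it shows that the part of the local energy rate not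
accounted for by the flux and the loads has integral zero.

Two analytic tools are built here. The divergence theorem on a sublevel set, for the normalized
Hausdorff measure, follows by integrating by parts against a smoothed indicator. Its gradient is a
boundary layer, and layer integrals are compared with the surface integral through charts with
bi-Lipschitz constant arbitrarily near 1, so no area formula is needed. The potential, only
Lipschitz across the boundary and not compactly supported, is admitted as a test function by
truncating its small values and mollifying. -/

noncomputable section

namespace ThermoMagnet

open scoped NNReal ENNReal

/-! ### Bi-Lipschitz charts that straighten a level set -/

section Chart

/-- A map of a pseudo-emetric space transforms the Euclidean Hausdorff measure by at most the
`k`-th power of its Lipschitz constant. -/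
theorem lipschitzOnWith_euclideanHausdorffMeasure_image_le {X Y : Type*} [EMetricSpace X]
    [EMetricSpace Y] [MeasurableSpace X] [BorelSpace X] [MeasurableSpace Y] [BorelSpace Y]
    {K : ℝ≥0} {f : X → Y} {s : Set X} (h : LipschitzOnWith K f s) (k : ℕ) :
    (μHE[k] : Measure Y) (f '' s) ≤ (K : ℝ≥0∞) ^ k * (μHE[k] : Measure X) s := by
  have h1 := h.hausdorffMeasure_image_le (d := k) (by positivity)
  rw [Measure.euclideanHausdorffMeasure_def, Measure.euclideanHausdorffMeasure_def,
    Measure.smul_apply, Measure.smul_apply, ENNReal.smul_def, ENNReal.smul_def, smul_eq_mul,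
    smul_eq_mul, mul_left_comm]
  refine mul_le_mul_right ?_ _
  simpa using h1

/-- Inside the source, the preimage of a set under the chart is its image under the inverse chart,
so the Lipschitz bound of the inverse controls the pushed-forward measure. -/
theorem map_restrict_source_le {X : Type*} [EMetricSpace X] [MeasurableSpace X] [BorelSpace X]
    {K : ℝ≥0} (e : OpenPartialHomeomorph X X) (h : LipschitzOnWith K e.symm e.target) (k : ℕ) :
    ((μHE[k] : Measure X).restrict e.source).map e ≤
      ((K : ℝ≥0∞) ^ k) • (μHE[k] : Measure X).restrict e.target := by
  have hm : AEMeasurable e ((μHE[k] : Measure X).restrict e.source) :=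
    e.continuousOn.aemeasurable e.open_source.measurableSet
  refine Measure.le_iff.2 fun A hA => ?_
  rw [Measure.map_apply_of_aemeasurable hm hA, Measure.smul_apply, Measure.restrict_apply hA,
    Measure.restrict_apply₀ (hm.nullMeasurable hA)]
  have : e ⁻¹' A ∩ e.source = e.symm '' (A ∩ e.target) := by
    rw [inter_comm, inter_comm A, e.symm_image_eq_source_inter_preimage inter_subset_left]
    ext x
    simp only [mem_inter_iff, mem_preimage]
    exact ⟨fun hx => ⟨hx.1, e.map_source hx.1, hx.2⟩, fun hx => ⟨hx.1, hx.2.2⟩⟩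
  rw [this, smul_eq_mul]
  exact lipschitzOnWith_euclideanHausdorffMeasure_image_le (h.mono inter_subset_right) k

/-- A one-sided change of variables without Jacobian. It is used for a chart and for its inverse,
with `k = d` for layers and `k = d - 1` for surfaces. -/
theorem setLIntegral_comp_chart_le {X : Type*} [EMetricSpace X] [MeasurableSpace X] [BorelSpace X]
    {K : ℝ≥0} (e : OpenPartialHomeomorph X X) (h : LipschitzOnWith K e.symm e.target) (k : ℕ)
    {F : X → ℝ≥0∞} (hF : Measurable F) :
    ∫⁻ x in e.source, F (e x) ∂(μHE[k] : Measure X) ≤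
      (K : ℝ≥0∞) ^ k * ∫⁻ z in e.target, F z ∂(μHE[k] : Measure X) := by
  have hm : AEMeasurable e ((μHE[k] : Measure X).restrict e.source) :=
    e.continuousOn.aemeasurable e.open_source.measurableSet
  rw [← lintegral_map' (hF.aemeasurable) hm, ← smul_eq_mul, ← lintegral_smul_measure]
  exact lintegral_mono' (map_restrict_source_le e h k) le_rfl

variable {d : ℕ} {Φ : Vec d → ℝ}

/-- The local straightening map of the level set of `Φ` through `x₀`. -/
def straighten (Φ : Vec d → ℝ) (x₀ x : Vec d) : Vec d :=
  x + (Φ x / ‖gradient Φ x₀‖ - ⟪normal Φ x₀, x - x₀⟫) • normal Φ x₀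

theorem norm_normal {x : Vec d} (h : gradient Φ x ≠ 0) : ‖normal Φ x‖ = 1 := by
  rw [normal, norm_smul, norm_inv, norm_norm, inv_mul_cancel₀ (norm_ne_zero_iff.2 h)]

/-- The correction in `straighten` replaces the normal coordinate by the rescaled value of `Φ`.
Level sets of `Φ` are thereby carried into parallel hyperplanes, and curved layers into flat ones.
-/
theorem inner_normal_straighten {x₀ : Vec d} (h : gradient Φ x₀ ≠ 0) (x : Vec d) :
    ⟪normal Φ x₀, straighten Φ x₀ x - x₀⟫ = Φ x / ‖gradient Φ x₀‖ := by
  have h1 : straighten Φ x₀ x - x₀ =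
      (x - x₀) + (Φ x / ‖gradient Φ x₀‖ - ⟪normal Φ x₀, x - x₀⟫) • normal Φ x₀ := by
    rw [straighten]; abel
  rw [h1, inner_add_right, inner_smul_right, real_inner_self_eq_norm_sq, norm_normal h]
  ring

theorem straighten_self {x₀ : Vec d} (h : Φ x₀ = 0) : straighten Φ x₀ x₀ = x₀ := by
  simp [straighten, h]

/-- The two terms of the correction have the same differential at `x₀`, since the unit normal is the
normalized gradient there. The derivative is thus the identity, which makes charts almost isometric.
-/
theorem hasStrictFDerivAt_straighten (hΦ : ContDiff ℝ 1 Φ) (x₀ : Vec d) :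
    HasStrictFDerivAt (straighten Φ x₀) (ContinuousLinearMap.id ℝ (Vec d)) x₀ := by
  have h1 : HasStrictFDerivAt Φ (fderiv ℝ Φ x₀) x₀ :=
    hΦ.contDiffAt.hasStrictFDerivAt one_ne_zero
  have h2 : HasStrictFDerivAt (fun x : Vec d => ⟪normal Φ x₀, x - x₀⟫)
      (innerSL ℝ (normal Φ x₀)) x₀ :=
    (innerSL ℝ (normal Φ x₀)).hasStrictFDerivAt.comp (f := fun x : Vec d => x - x₀) x₀
      ((hasStrictFDerivAt_id x₀).sub_const x₀)
  have h3 := (hasStrictFDerivAt_id (𝕜 := ℝ) x₀).add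
    (((h1.const_mul ‖gradient Φ x₀‖⁻¹).sub h2).smul_const (normal Φ x₀))
  have h4 : (ContinuousLinearMap.id ℝ (Vec d) +
      (‖gradient Φ x₀‖⁻¹ • fderiv ℝ Φ x₀ - innerSL ℝ (normal Φ x₀)).smulRight (normal Φ x₀)) =
      ContinuousLinearMap.id ℝ (Vec d) := by
    ext1 v
    simp [normal]
  rw [h4] at h3
  refine h3.congr_of_eventuallyEq (Eventually.of_forall fun x => ?_)
  simp [straighten, div_eq_inv_mul]

/-- Near a regular point of the zero set, straightening is a bi-Lipschitz homeomorphism with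
constants as close to `1` as desired. -/
theorem exists_chart (hΦ : ContDiff ℝ 1 Φ) {x₀ : Vec d} (h : gradient Φ x₀ ≠ 0)
    {K : ℝ≥0} (hK : 1 < K) :
    ∃ e : OpenPartialHomeomorph (Vec d) (Vec d), x₀ ∈ e.source ∧ ⇑e = straighten Φ x₀ ∧
      LipschitzOnWith K e e.source ∧ LipschitzOnWith K e.symm e.target ∧
      ∀ x ∈ e.source, ‖gradient Φ x‖ ≤ K * ‖gradient Φ x₀‖ ∧
        ‖gradient Φ x₀‖ ≤ K * ‖gradient Φ x‖ := by
  have hstr : HasStrictFDerivAt (straighten Φ x₀)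
    ((ContinuousLinearEquiv.refl ℝ (Vec d) : Vec d ≃L[ℝ] Vec d) : Vec d →L[ℝ] Vec d) x₀ :=
    hasStrictFDerivAt_straighten hΦ x₀
  have hK0 : (0 : ℝ≥0) < K := zero_lt_one.trans hK
  -- With this distance from the identity the lower constant `1 - δ` equals `K⁻¹`, and `1 + δ = 2 -
  -- K⁻¹ ≤ K`, so one `δ` serves the map and its inverse.
  set δ : ℝ≥0 := 1 - K⁻¹ with hδ
  have hKi : K⁻¹ < 1 := inv_lt_one_of_one_lt₀ hK
  have hδ0 : 0 < δ := tsub_pos_of_lt hKi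
  have hδr : (δ : ℝ) = 1 - (K : ℝ)⁻¹ := by
    rw [hδ, NNReal.coe_sub hKi.le]; simp
  have hKr : (1 : ℝ) < K := by exact_mod_cast hK
  have hKir : (K : ℝ)⁻¹ * K = 1 := inv_mul_cancel₀ (by positivity)
  obtain ⟨s, hs, happ⟩ := hstr.approximates_deriv_on_nhds (c := δ) (Or.inr hδ0)
  have hg : Continuous fun x => ‖gradient Φ x‖ :=
    ((InnerProductSpace.toDual ℝ (Vec d)).symm.continuous.comp
      (hΦ.continuous_fderiv one_ne_zero)).norm
  have hpos : 0 < ‖gradient Φ x₀‖ := norm_pos_iff.2 h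
  set W : Set (Vec d) := {x | ‖gradient Φ x‖ < K * ‖gradient Φ x₀‖ ∧
    ‖gradient Φ x₀‖ < K * ‖gradient Φ x‖} with hW
  have hWo : IsOpen W := (isOpen_lt hg continuous_const).inter
    (isOpen_lt continuous_const (continuous_const.mul hg))
  have hW0 : x₀ ∈ W := ⟨by nlinarith, by nlinarith⟩
  obtain ⟨e, he, heq⟩ : ∃ e : OpenPartialHomeomorph (Vec d) (Vec d),
      x₀ ∈ e.source ∧ ⇑e = straighten Φ x₀ :=
    ⟨hstr.toOpenPartialHomeomorph _, hstr.mem_toOpenPartialHomeomorph_source, rfl⟩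
  have hN : interior s ∩ W ∈ 𝓝 x₀ := inter_mem (interior_mem_nhds.2 hs) (hWo.mem_nhds hW0)
  set V := interior s ∩ W with hV
  have hVo : IsOpen V := isOpen_interior.inter hWo
  have hsrc : (e.restr V).source = e.source ∩ V := by
    rw [e.restr_source, hVo.interior_eq]
  have hsub : (e.restr V).source ⊆ s ∩ W := by
    rw [hsrc]; exact fun x hx => ⟨interior_subset hx.2.1, hx.2.2⟩
  have key : ∀ x ∈ (e.restr V).source, ∀ y ∈ (e.restr V).source,
      ‖straighten Φ x₀ x - straighten Φ x₀ y - (x - y)‖ ≤ δ * ‖x - y‖ := fun x hx y hy =>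
    happ x (hsub hx).1 y (hsub hy).1
  refine ⟨e.restr V, ?_, by simpa using heq, ?_, ?_, ?_⟩
  · rw [hsrc]; exact ⟨he, mem_of_mem_nhds hN⟩
  · refine LipschitzOnWith.of_dist_le_mul fun x hx y hy => ?_
    rw [dist_eq_norm, dist_eq_norm, e.restr_apply, heq]
    have h1 := key x hx y hy
    have h2 := norm_add_le (straighten Φ x₀ x - straighten Φ x₀ y - (x - y)) (x - y)
    rw [sub_add_cancel] at h2
    have h3 : (1 : ℝ) + δ ≤ K := by
      rw [hδr]; nlinarith [inv_pos.2 (zero_lt_one.trans hKr)]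
    nlinarith [norm_nonneg (x - y)]
  · refine LipschitzOnWith.of_dist_le_mul fun x hx y hy => ?_
    have hx' := (e.restr V).map_target hx
    have hy' := (e.restr V).map_target hy
    have h1 := key _ hx' _ hy'
    have hex : straighten Φ x₀ ((e.restr V).symm x) = x := by
      have := (e.restr V).right_inv hx
      rwa [e.restr_apply, heq] at this
    have hey : straighten Φ x₀ ((e.restr V).symm y) = y := by
      have := (e.restr V).right_inv hy
      rwa [e.restr_apply, heq] at this
    rw [hex, hey] at h1
    set a := (e.restr V).symm x - (e.restr V).symm y
    rw [dist_eq_norm, dist_eq_norm]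
    have h2 := norm_sub_le (x - y) (x - y - a)
    rw [sub_sub_cancel] at h2
    have h3 : (K : ℝ)⁻¹ * ‖a‖ ≤ ‖x - y‖ := by rw [hδr] at h1; linarith
    calc ‖a‖ = K * ((K : ℝ)⁻¹ * ‖a‖) := by rw [← mul_assoc, mul_comm (K : ℝ), hKir, one_mul]
      _ ≤ K * ‖x - y‖ := by gcongr
  · exact fun x hx => ⟨(hsub hx).2.1.le, (hsub hx).2.2.le⟩

end Chart

end ThermoMagnet

end

noncomputable section

namespace ThermoMagnet

open scoped NNReal ENNReal

/-! ### Boundary layers concentrate on the level set -/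

section Layer

variable {d : ℕ} {Φ : Vec d → ℝ}

/-- A nonnegative smooth function of integral one, concentrated on `[-ε, 0]`. -/
def layer (ε s : ℝ) : ℝ := ε⁻¹ * deriv Real.smoothTransition (-(s / ε))

theorem continuous_deriv_smoothTransition : Continuous (deriv Real.smoothTransition) :=
  (Real.smoothTransition.contDiff (n := 1)).continuous_deriv le_rfl

theorem deriv_smoothTransition_nonneg (s : ℝ) : 0 ≤ deriv Real.smoothTransition s :=
  Real.smoothTransition.monotone.deriv_nonneg

theorem deriv_smoothTransition_of_neg {s : ℝ} (h : s < 0) : deriv Real.smoothTransition s = 0 := by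
  have : Real.smoothTransition =ᶠ[𝓝 s] fun _ => 0 := by
    filter_upwards [Iio_mem_nhds h] with y hy
    exact Real.smoothTransition.zero_of_nonpos (le_of_lt hy)
  rw [this.deriv_eq, deriv_const]

theorem deriv_smoothTransition_of_one_lt {s : ℝ} (h : 1 < s) :
    deriv Real.smoothTransition s = 0 := by
  have : Real.smoothTransition =ᶠ[𝓝 s] fun _ => 1 := by
    filter_upwards [Ioi_mem_nhds h] with y hy
    exact Real.smoothTransition.one_of_one_le (le_of_lt hy)
  rw [this.deriv_eq, deriv_const]

theorem hasCompactSupport_deriv_smoothTransition :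
    HasCompactSupport (deriv Real.smoothTransition) := by
  refine HasCompactSupport.of_support_subset_isCompact (isCompact_Icc (a := (0 : ℝ)) (b := 1)) ?_
  intro s hs
  by_contra hcon
  rw [mem_Icc, not_and_or, not_le, not_le] at hcon
  exact hs (hcon.elim deriv_smoothTransition_of_neg deriv_smoothTransition_of_one_lt)

theorem integrable_deriv_smoothTransition : Integrable (deriv Real.smoothTransition) :=
  continuous_deriv_smoothTransition.integrable_of_hasCompactSupport
    hasCompactSupport_deriv_smoothTransition

theorem integral_deriv_smoothTransition : ∫ s, deriv Real.smoothTransition s = 1 := by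
  have hd : ∀ s, HasDerivAt Real.smoothTransition (deriv Real.smoothTransition s) s := fun s =>
    ((Real.smoothTransition.contDiff (n := 1)).differentiable one_ne_zero s).hasDerivAt
  have h0 : Tendsto Real.smoothTransition atBot (𝓝 0) := by
    refine tendsto_const_nhds.congr' ?_
    filter_upwards [eventually_le_atBot 0] with s hs
    exact (Real.smoothTransition.zero_of_nonpos hs).symm
  have h1 : Tendsto Real.smoothTransition atTop (𝓝 1) := by
    refine tendsto_const_nhds.congr' ?_
    filter_upwards [eventually_ge_atTop 1] with s hs
    exact (Real.smoothTransition.one_of_one_le hs).symm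
  rw [integral_of_hasDerivAt_of_tendsto hd integrable_deriv_smoothTransition h0 h1, sub_zero]

theorem layer_nonneg {ε : ℝ} (hε : 0 < ε) (s : ℝ) : 0 ≤ layer ε s :=
  mul_nonneg (inv_nonneg.2 hε.le) (deriv_smoothTransition_nonneg _)

theorem continuous_layer (ε : ℝ) : Continuous (layer ε) :=
  continuous_const.mul
    (continuous_deriv_smoothTransition.comp (continuous_id.div_const ε).neg)

theorem layer_eq_zero {ε s : ℝ} (hε : 0 < ε) (h : ε < |s|) : layer ε s = 0 := by
  rw [layer]
  rcases lt_abs.1 h with h | h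
  · rw [deriv_smoothTransition_of_neg, mul_zero]
    have : 0 < s / ε := div_pos (hε.trans h) hε
    linarith
  · rw [deriv_smoothTransition_of_one_lt, mul_zero]
    rw [← neg_div, lt_div_iff₀ hε]
    linarith

/-- The substitution `s = -(ε/c) r` turns the layer into a fixed density of mass one and moves `ε`
into the argument of `G`; dominated convergence does the rest. The factor `1/c` is the Jacobian and
will become `1/|∇Φ|`. -/
theorem tendsto_integral_mul_layer {G : ℝ → ℝ} (hG : Continuous G) {B : ℝ} (hB : ∀ s, |G s| ≤ B)
    {c : ℝ} (hc : 0 < c) :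
    Tendsto (fun ε => ∫ s, G s * layer ε (c * s)) (𝓝[>] 0) (𝓝 (G 0 / c)) := by
  have h1 : Tendsto (fun ε : ℝ => c⁻¹ * ∫ r, G (-(ε / c) * r) * deriv Real.smoothTransition r)
      (𝓝[>] 0) (𝓝 (c⁻¹ * ∫ r, G 0 * deriv Real.smoothTransition r)) := by
    refine Tendsto.const_mul _ ?_
    refine tendsto_integral_filter_of_dominated_convergence
      (fun r => B * deriv Real.smoothTransition r) ?_ ?_
      (integrable_deriv_smoothTransition.const_mul B) ?_
    · exact Eventually.of_forall fun ε => ((hG.comp (continuous_const.mul continuous_id)).mul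
        continuous_deriv_smoothTransition).aestronglyMeasurable
    · refine Eventually.of_forall fun ε => Eventually.of_forall fun r => ?_
      rw [norm_mul, Real.norm_eq_abs, Real.norm_eq_abs,
        abs_of_nonneg (deriv_smoothTransition_nonneg r)]
      exact mul_le_mul_of_nonneg_right (hB _) (deriv_smoothTransition_nonneg r)
    · refine Eventually.of_forall fun r => ?_
      refine Tendsto.mul_const _ ?_
      have : Tendsto (fun ε : ℝ => -(ε / c) * r) (𝓝[>] 0) (𝓝 0) := by
        have : Continuous fun ε : ℝ => -(ε / c) * r := by fun_prop
        have h := (this.tendsto 0).mono_left (nhdsWithin_le_nhds (s := Ioi 0))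
        simpa using h
      exact (hG.tendsto 0).comp this
  rw [integral_const_mul, integral_deriv_smoothTransition, mul_one, ← div_eq_inv_mul] at h1
  refine h1.congr' ?_
  filter_upwards [self_mem_nhdsWithin] with ε hε
  have hε' : (0 : ℝ) < ε := hε
  have h2 := Measure.integral_comp_mul_left (fun s => G s * layer ε (c * s)) (-(ε / c))
  have h3 : ∀ r, G (-(ε / c) * r) * layer ε (c * (-(ε / c) * r)) =
      ε⁻¹ * (G (-(ε / c) * r) * deriv Real.smoothTransition r) := fun r => by
    have : -(c * (-(ε / c) * r) / ε) = r := by field_simp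
    rw [layer, this]; ring
  simp_rw [h3] at h2
  rw [integral_const_mul, inv_neg, abs_neg, abs_of_pos (inv_pos.2 (div_pos hε' hc)),
    smul_eq_mul, inv_div] at h2
  have h5 : c / ε * (c⁻¹ * ∫ r, G (-(ε / c) * r) * deriv Real.smoothTransition r) =
      c / ε * ∫ s, G s * layer ε (c * s) := by
    rw [← h2]
    field_simp
  exact mul_left_cancel₀ (div_pos hc hε').ne' h5

variable {n : Vec d}

/-- The orthogonal splitting of the space along a unit vector preserves the volume. -/
theorem measurePreserving_smul_add (hn : ‖n‖ = 1) (x₀ : Vec d) :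
    MeasurePreserving (fun q : ℝ × (ℝ ∙ n)ᗮ => q.1 • n + (q.2 : Vec d) + x₀)
      ((volume : Measure ℝ).prod volume) volume := by
  have h1 := ((ℝ ∙ n).measurePreserving_measurableEquivProd x₀).symm
  rw [finrank_euclideanSpace_fin, EuclideanSpace.euclideanHausdorffMeasure_eq_volume] at h1
  have h2 := (LinearIsometryEquiv.toSpanUnitSingleton (𝕜 := ℝ) n hn).measurePreserving.prod
    (MeasurePreserving.id (volume : Measure (ℝ ∙ n)ᗮ))
  have h3 : (fun q : ℝ × (ℝ ∙ n)ᗮ => q.1 • n + (q.2 : Vec d) + x₀) =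
      ((ℝ ∙ n).measurableEquivProd x₀).symm ∘
        Prod.map (LinearIsometryEquiv.toSpanUnitSingleton (𝕜 := ℝ) n hn) id := by
    ext1 q
    simp
  rw [h3]
  exact h1.comp h2

theorem finrank_orthogonal_span_unit (hn : ‖n‖ = 1) : Module.finrank ℝ (ℝ ∙ n)ᗮ = d - 1 := by
  have h1 := (ℝ ∙ n).finrank_add_finrank_orthogonal
  rw [finrank_span_singleton (norm_ne_zero_iff.1 (by rw [hn]; exact one_ne_zero)),
    finrank_euclideanSpace_fin] at h1
  omega

/-- The hyperplane is an isometric copy of the orthogonal complement, and on a Euclidean space the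
normalized Hausdorff measure of top dimension is the volume. -/
theorem map_add_eq_restrict_hyperplane (hn : ‖n‖ = 1) (x₀ : Vec d) :
    (volume : Measure (ℝ ∙ n)ᗮ).map (fun y : (ℝ ∙ n)ᗮ => (y : Vec d) + x₀) =
      (μHE[d - 1] : Measure (Vec d)).restrict {z | ⟪n, z - x₀⟫ = 0} := by
  have hiso : Isometry (fun y : (ℝ ∙ n)ᗮ => (y : Vec d) + x₀) :=
    (isometry_add_right x₀).comp isometry_subtype_coe
  rw [← InnerProductSpace.euclideanHausdorffMeasure_eq_volume, finrank_orthogonal_span_unit hn,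
    hiso.map_euclideanHausdorffMeasure]
  congr 1
  ext z
  simp only [mem_range, mem_ofPred_eq]
  constructor
  · rintro ⟨y, rfl⟩
    rw [add_sub_cancel_right]
    exact Submodule.mem_orthogonal_singleton_iff_inner_right.1 y.2
  · intro hz
    exact ⟨⟨z - x₀, Submodule.mem_orthogonal_singleton_iff_inner_right.2 hz⟩, by simp⟩

/-- The flat model: Fubini along the normal reduces to one variable. The integral over the slice at
height `s` is continuous and bounded in `s` because `g` has compact support. -/
theorem tendsto_integral_mul_layer_inner (hn : ‖n‖ = 1) {c : ℝ} (hc : 0 < c) (x₀ : Vec d)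
    {g : Vec d → ℝ} (hg : Continuous g) (hgc : HasCompactSupport g) :
    Tendsto (fun ε => ∫ z, g z * layer ε (c * ⟪n, z - x₀⟫)) (𝓝[>] 0)
      (𝓝 (∫ z in {z | ⟪n, z - x₀⟫ = 0}, g z / c ∂μHE[d - 1])) := by
  obtain ⟨R, hR⟩ := hgc.isCompact.isBounded.subset_closedBall x₀
  obtain ⟨B, hB⟩ := hgc.exists_bound_of_continuous hg
  have hcont : Continuous fun q : ℝ × (ℝ ∙ n)ᗮ => q.1 • n + (q.2 : Vec d) + x₀ := by fun_prop
  have hinner : ∀ (s : ℝ) (y : (ℝ ∙ n)ᗮ), ⟪n, s • n + (y : Vec d) + x₀ - x₀⟫ = s := fun s y => by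
    rw [add_sub_cancel_right, inner_add_right, inner_smul_right, real_inner_self_eq_norm_sq, hn,
      Submodule.mem_orthogonal_singleton_iff_inner_right.1 y.2]
    simp
  have hnorm : ∀ (s : ℝ) (y : (ℝ ∙ n)ᗮ), ‖s • n + (y : Vec d)‖ ^ 2 = s ^ 2 + ‖y‖ ^ 2 := fun s y => by
    rw [norm_add_sq_real, real_inner_smul_left,
      Submodule.mem_orthogonal_singleton_iff_inner_right.1 y.2, norm_smul, hn]
    simp
  have hzero : ∀ (s : ℝ) (y : (ℝ ∙ n)ᗮ), y ∉ Metric.closedBall (0 : (ℝ ∙ n)ᗮ) R →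
      g (s • n + (y : Vec d) + x₀) = 0 := fun s y hy => by
    by_contra hne
    have h1 := hR (subset_tsupport g hne)
    rw [mem_closedBall_iff_norm, add_sub_cancel_right] at h1
    rw [mem_closedBall_zero_iff, not_le] at hy
    have := hnorm s y
    nlinarith [norm_nonneg y, norm_nonneg (s • n + (y : Vec d)), sq_nonneg s]
  set G : ℝ → ℝ := fun s => ∫ y : (ℝ ∙ n)ᗮ, g (s • n + (y : Vec d) + x₀) with hGdef
  have hG' : ∀ s, G s = ∫ y in Metric.closedBall (0 : (ℝ ∙ n)ᗮ) R,
      g (s • n + (y : Vec d) + x₀) := fun s =>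
    (setIntegral_eq_integral_of_forall_compl_eq_zero fun y hy => hzero s y hy).symm
  have hGc : Continuous G := by
    rw [funext hG']
    exact continuous_parametric_integral_of_continuous
      (f := fun (s : ℝ) (y : (ℝ ∙ n)ᗮ) => g (s • n + (y : Vec d) + x₀)) (hg.comp hcont)
      (isCompact_closedBall (0 : (ℝ ∙ n)ᗮ) R)
  have hGB : ∀ s, |G s| ≤ B * volume.real (Metric.closedBall (0 : (ℝ ∙ n)ᗮ) R) := fun s => by
    rw [hG', ← Real.norm_eq_abs]
    exact norm_setIntegral_le_of_norm_le_const
      (isCompact_closedBall (0 : (ℝ ∙ n)ᗮ) R).measure_lt_top fun y _ => hB _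
  have hmp := measurePreserving_smul_add hn x₀
  have hlim := tendsto_integral_mul_layer hGc hGB hc
  have hval : G 0 / c = ∫ z in {z | ⟪n, z - x₀⟫ = 0}, g z / c ∂μHE[d - 1] := by
    rw [← map_add_eq_restrict_hyperplane hn x₀, integral_map (by fun_prop)
      (hg.div_const c).aestronglyMeasurable, integral_div]
    simp [hGdef]
  rw [hval] at hlim
  refine hlim.congr fun ε => ?_
  have hcF : Continuous fun z => g z * layer ε (c * ⟪n, z - x₀⟫) :=
    hg.mul ((continuous_layer ε).comp (by fun_prop))
  have hFi : Integrable (fun z => g z * layer ε (c * ⟪n, z - x₀⟫)) :=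
    hcF.integrable_of_hasCompactSupport hgc.mul_right
  rw [← hmp.map_eq, integral_map hmp.aemeasurable hcF.aestronglyMeasurable, integral_prod]
  · refine integral_congr_ae (Eventually.of_forall fun s => ?_)
    simp only [hinner, hGdef]
    rw [integral_mul_const]
  · exact (hmp.integrable_comp hcF.aestronglyMeasurable).2 hFi

theorem tendsto_lintegral_mul_layer_inner (hn : ‖n‖ = 1) {c : ℝ} (hc : 0 < c) (x₀ : Vec d)
    {g : Vec d → ℝ} (hg : Continuous g) (hgc : HasCompactSupport g) (h0 : ∀ x, 0 ≤ g x) :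
    Tendsto (fun ε => ∫⁻ z, ENNReal.ofReal (g z * layer ε (c * ⟪n, z - x₀⟫))) (𝓝[>] 0)
      (𝓝 (∫⁻ z in {z | ⟪n, z - x₀⟫ = 0}, ENNReal.ofReal (g z / c) ∂μHE[d - 1])) := by
  have h1 := ENNReal.tendsto_ofReal (tendsto_integral_mul_layer_inner hn hc x₀ hg hgc)
  rw [ofReal_integral_eq_lintegral_ofReal _
    (Eventually.of_forall fun z => div_nonneg (h0 z) hc.le)] at h1
  · refine h1.congr' ?_
    filter_upwards [self_mem_nhdsWithin] with ε hε
    have hcF : Continuous fun z => g z * layer ε (c * ⟪n, z - x₀⟫) :=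
      hg.mul ((continuous_layer ε).comp (by fun_prop))
    exact ofReal_integral_eq_lintegral_ofReal
      (hcF.integrable_of_hasCompactSupport hgc.mul_right)
      (Eventually.of_forall fun z => mul_nonneg (h0 z) (layer_nonneg hε _))
  · rw [← map_add_eq_restrict_hyperplane hn x₀]
    have hce : Topology.IsClosedEmbedding (fun y : (ℝ ∙ n)ᗮ => (y : Vec d) + x₀) :=
      Isometry.isClosedEmbedding ((isometry_add_right x₀).comp isometry_subtype_coe)
    rw [hce.measurableEmbedding.integrable_map_iff]
    refine Continuous.integrable_of_hasCompactSupport ?_ ?_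
    · exact (hg.div_const c).comp hce.continuous
    · exact (HasCompactSupport.comp_isClosedEmbedding (f := fun z => g z / c)
        (hgc.comp_left (g := fun r : ℝ => r / c) (zero_div c)) hce)

end Layer

end ThermoMagnet

end

noncomputable section

namespace ThermoMagnet

open scoped NNReal ENNReal

/-! ### Comparison of curved layers with flat ones -/

section Sandwich

variable {d : ℕ} {Φ : Vec d → ℝ}

/-- The integral of `f` over the boundary layer of width `ε`. -/
def layerInt (Φ f : Vec d → ℝ) (ε : ℝ) : ℝ≥0∞ :=
  ∫⁻ x, ENNReal.ofReal (f x * layer ε (Φ x))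

/-- The surface integral of `f / |∇Φ|` over the zero set of `Φ`. -/
def levelInt (Φ f : Vec d → ℝ) : ℝ≥0∞ :=
  ∫⁻ x in {x | Φ x = 0}, ENNReal.ofReal (f x / ‖gradient Φ x‖) ∂(μHE[d - 1] : Measure (Vec d))

/-- Layer integrals are asymptotically within a factor `C` of the surface integral. -/
def LayerSandwich (Φ : Vec d → ℝ) (C : ℝ≥0) (f : Vec d → ℝ) : Prop :=
  ∀ η : ℝ≥0∞, η ≠ 0 → ∀ᶠ ε in 𝓝[>] (0 : ℝ),
    layerInt Φ f ε ≤ C * levelInt Φ f + η ∧ levelInt Φ f ≤ C * layerInt Φ f ε + η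

theorem continuous_norm_gradient (hΦ : ContDiff ℝ 1 Φ) : Continuous fun x => ‖gradient Φ x‖ :=
  ((InnerProductSpace.toDual ℝ (Vec d)).symm.continuous.comp
    (hΦ.continuous_fderiv one_ne_zero)).norm

/-- Both integrals are additive on nonnegative functions, and the error is split in halves. This
permits a partition of unity. -/
theorem LayerSandwich.add (hΦ : ContDiff ℝ 1 Φ) {C : ℝ≥0} {f g : Vec d → ℝ} (hf : Continuous f)
    (hf0 : ∀ x, 0 ≤ f x) (hg0 : ∀ x, 0 ≤ g x)
    (h : LayerSandwich Φ C f) (h' : LayerSandwich Φ C g) :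
    LayerSandwich Φ C (fun x => f x + g x) := by
  intro η hη
  have hη2 : η / 2 ≠ 0 := (ENNReal.half_pos hη).ne'
  have hlev : levelInt Φ (fun x => f x + g x) = levelInt Φ f + levelInt Φ g := by
    rw [levelInt, levelInt, levelInt, ← lintegral_add_left]
    · refine lintegral_congr fun x => ?_
      rw [add_div, ENNReal.ofReal_add (div_nonneg (hf0 x) (norm_nonneg _))
        (div_nonneg (hg0 x) (norm_nonneg _))]
    · exact (hf.measurable.div (continuous_norm_gradient hΦ).measurable).ennreal_ofReal
  filter_upwards [h _ hη2, h' _ hη2, self_mem_nhdsWithin] with ε h1 h2 hε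
  have hlay : layerInt Φ (fun x => f x + g x) ε = layerInt Φ f ε + layerInt Φ g ε := by
    rw [layerInt, layerInt, layerInt, ← lintegral_add_left]
    · refine lintegral_congr fun x => ?_
      rw [add_mul, ENNReal.ofReal_add (mul_nonneg (hf0 x) (layer_nonneg hε _))
        (mul_nonneg (hg0 x) (layer_nonneg hε _))]
    · exact (hf.mul ((continuous_layer ε).comp hΦ.continuous)).measurable.ennreal_ofReal
  rw [hlev, hlay, mul_add, mul_add]
  constructor
  · calc _ ≤ (C * levelInt Φ f + η / 2) + (C * levelInt Φ g + η / 2) := add_le_add h1.1 h2.1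
      _ = _ := by rw [add_add_add_comm, ENNReal.add_halves]
  · calc _ ≤ (C * layerInt Φ f ε + η / 2) + (C * layerInt Φ g ε + η / 2) :=
        add_le_add h1.2 h2.2
      _ = _ := by rw [add_add_add_comm, ENNReal.add_halves]

/-- Transport of a compactly supported function through a chart. -/
theorem exists_pushforward {X : Type*} [TopologicalSpace X] [T2Space X]
    (e : OpenPartialHomeomorph X X) {f : X → ℝ}
    (hf : Continuous f) (hfc : HasCompactSupport f) (hs : tsupport f ⊆ e.source) :
    ∃ g : X → ℝ, Continuous g ∧ HasCompactSupport g ∧ (∀ x ∈ e.source, g (e x) = f x) ∧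
      (∀ z, z ∉ e.target → g z = 0) ∧ ∀ z, ∃ x, g z = f x ∨ g z = 0 := by
  classical
  set g : X → ℝ := e.target.indicator (f ∘ e.symm) with hg
  have hK : IsCompact (e '' tsupport f) := hfc.isCompact.image_of_continuousOn
    (e.continuousOn.mono hs)
  have hz : ∀ z ∉ e '' tsupport f, g z = 0 := fun z hz => by
    by_cases hzt : z ∈ e.target
    · rw [hg, indicator_of_mem hzt, Function.comp_apply]
      by_contra hne
      exact hz ⟨e.symm z, subset_tsupport f hne, e.right_inv hzt⟩
    · rw [hg, indicator_of_notMem hzt]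
  refine ⟨g, continuous_iff_continuousAt.2 fun z => ?_, ?_, fun x hx => ?_, fun z hz' => ?_,
    fun z => ?_⟩
  · by_cases hzt : z ∈ e.target
    · have h1 : ContinuousAt (f ∘ e.symm) z :=
        hf.continuousAt.comp (e.continuousAt_symm hzt)
      refine h1.congr ?_
      filter_upwards [e.open_target.mem_nhds hzt] with y hy
      rw [hg, indicator_of_mem hy]
    · have hz' : z ∈ (e '' tsupport f)ᶜ := fun hzi => by
        obtain ⟨x, hx, rfl⟩ := hzi
        exact hzt (e.map_source (hs hx))
      refine (continuousAt_const (y := (0 : ℝ))).congr ?_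
      filter_upwards [hK.isClosed.isOpen_compl.mem_nhds hz'] with y hy
      exact (hz y hy).symm
  · exact HasCompactSupport.intro hK hz
  · rw [hg, indicator_of_mem (e.map_source hx), Function.comp_apply, e.left_inv hx]
  · rw [hg, indicator_of_notMem hz']
  · refine ⟨e.symm z, ?_⟩
    by_cases hzt : z ∈ e.target
    · left; rw [hg, indicator_of_mem hzt, Function.comp_apply]
    · right; rw [hg, indicator_of_notMem hzt]

/-- The curved layer and surface integrals are each compared with their flat images `J` and `Λ`, for
which the limit is known. The layer costs `K ^ d`; the surface costs `K ^ (d - 1)` and one more `K`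
for freezing `|∇Φ|` at `x₀`. The product is `K ^ (2 * d)`. -/
theorem layerSandwich_of_chart (hΦ : ContDiff ℝ 1 Φ) {x₀ : Vec d} (h0 : Φ x₀ = 0)
    (h : gradient Φ x₀ ≠ 0) {K : ℝ≥0} (hK : 1 < K) :
    ∃ U : Set (Vec d), IsOpen U ∧ x₀ ∈ U ∧ (∀ f : Vec d → ℝ, Continuous f → HasCompactSupport f →
      (∀ x, 0 ≤ f x) → tsupport f ⊆ U → LayerSandwich Φ (K ^ (2 * d)) f ∧ levelInt Φ f < ⊤) := by
  obtain ⟨e, hx₀, heq, hlip, hlips, hgrad⟩ := exists_chart hΦ h hK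
  refine ⟨e.source, e.open_source, hx₀, fun f hf hfc hf0 hfs => ?_⟩
  have hn := norm_normal h
  have hc : 0 < ‖gradient Φ x₀‖ := norm_pos_iff.2 h
  set c := ‖gradient Φ x₀‖ with hcdef
  set n := normal Φ x₀ with hndef
  -- Truncated subtraction is harmless: in dimension zero no gradient is nonzero.
  have hd1 : d - 1 + 1 = d := by
    rcases d with _ | d
    · exact absurd (Subsingleton.elim _ _) h
    · rfl
  obtain ⟨g, hg, hgc, hge, hgt, hgf⟩ := exists_pushforward e hf hfc hfs
  have hg0 : ∀ z, 0 ≤ g z := fun z => by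
    obtain ⟨x, hx | hx⟩ := hgf z
    · rw [hx]; exact hf0 x
    · rw [hx]
  have hfz : ∀ x ∉ e.source, f x = 0 := fun x hx =>
    Function.notMem_support.1 fun hx' => hx (hfs (subset_tsupport f hx'))
  have hin : ∀ x, c * ⟪n, e x - x₀⟫ = Φ x := fun x => by
    rw [heq, inner_normal_straighten h, ← hcdef, mul_div_cancel₀ _ hc.ne']
  set J : ℝ → ℝ≥0∞ := fun ε => ∫⁻ z, ENNReal.ofReal (g z * layer ε (c * ⟪n, z - x₀⟫)) with hJ
  set Λ : ℝ≥0∞ := ∫⁻ z in {z | ⟪n, z - x₀⟫ = 0}, ENNReal.ofReal (g z / c)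
    ∂(μHE[d - 1] : Measure (Vec d)) with hΛ
  have hlim : Tendsto J (𝓝[>] 0) (𝓝 Λ) := tendsto_lintegral_mul_layer_inner hn hc x₀ hg hgc hg0
  have hvol : (volume : Measure (Vec d)) = μHE[d] :=
    (EuclideanSpace.euclideanHausdorffMeasure_eq_volume d).symm
  have hIJ : ∀ ε, layerInt Φ f ε ≤ (K : ℝ≥0∞) ^ d * J ε := fun ε => by
    have hF : Measurable fun z => ENNReal.ofReal (g z * layer ε (c * ⟪n, z - x₀⟫)) :=
      (hg.mul ((continuous_layer ε).comp (by fun_prop))).measurable.ennreal_ofReal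
    have h1 := setLIntegral_comp_chart_le e hlips d hF
    have h2 : layerInt Φ f ε = ∫⁻ x in e.source,
        ENNReal.ofReal (g (e x) * layer ε (c * ⟪n, e x - x₀⟫)) ∂(μHE[d] : Measure (Vec d)) := by
      rw [← hvol, layerInt, ← setLIntegral_eq_of_support_subset (s := e.source)]
      · refine setLIntegral_congr_fun e.open_source.measurableSet fun x hx => ?_
        simp only [hge x hx, hin]
      · intro x hx
        by_contra hx'
        exact hx (by simp [hfz x hx'])
    rw [h2]
    refine h1.trans (mul_le_mul_right ?_ _)
    rw [← hvol]
    exact setLIntegral_le_lintegral _ _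
  have hJI : ∀ ε, J ε ≤ (K : ℝ≥0∞) ^ d * layerInt Φ f ε := fun ε => by
    have hF : Measurable fun x => ENNReal.ofReal (f x * layer ε (Φ x)) :=
      (hf.mul ((continuous_layer ε).comp hΦ.continuous)).measurable.ennreal_ofReal
    have h1 := setLIntegral_comp_chart_le e.symm (by simpa using hlip) d hF
    have h2 : J ε = ∫⁻ z in e.target,
        ENNReal.ofReal (f (e.symm z) * layer ε (Φ (e.symm z))) ∂(μHE[d] : Measure (Vec d)) := by
      rw [← hvol]
      simp only [hJ]
      rw [← setLIntegral_eq_of_support_subset (s := e.target)]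
      · refine setLIntegral_congr_fun e.open_target.measurableSet fun z hz => ?_
        rw [← hge _ (e.map_target hz), ← hin, e.right_inv hz]
      · intro z hz
        by_contra hz'
        exact hz (by simp [hgt z hz'])
    rw [h2]
    refine h1.trans (mul_le_mul_right ?_ _)
    rw [← hvol]
    exact setLIntegral_le_lintegral _ _
  have hVc : IsClosed {z : Vec d | ⟪n, z - x₀⟫ = 0} :=
    isClosed_eq (by fun_prop) continuous_const
  have hΓc : IsClosed {x : Vec d | Φ x = 0} := isClosed_eq hΦ.continuous continuous_const
  have hmemV : ∀ x, e x ∈ {z : Vec d | ⟪n, z - x₀⟫ = 0} ↔ x ∈ {x : Vec d | Φ x = 0} := fun x => by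
    simp only [mem_ofPred_eq]
    rw [← hin x]
    simp [hc.ne']
  set L : ℝ≥0∞ := ∫⁻ x in {x | Φ x = 0}, ENNReal.ofReal (f x / c)
    ∂(μHE[d - 1] : Measure (Vec d)) with hL
  have hFV : Measurable ({z : Vec d | ⟪n, z - x₀⟫ = 0}.indicator
      fun z => ENNReal.ofReal (g z / c)) :=
    (hg.div_const c).measurable.ennreal_ofReal.indicator hVc.measurableSet
  have hFΓ : Measurable ({x : Vec d | Φ x = 0}.indicator fun x => ENNReal.ofReal (f x / c)) :=
    (hf.div_const c).measurable.ennreal_ofReal.indicator hΓc.measurableSet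
  have hLΛ : L ≤ (K : ℝ≥0∞) ^ (d - 1) * Λ := by
    have h1 := setLIntegral_comp_chart_le e hlips (d - 1) hFV
    have h2 : L = ∫⁻ x in e.source, {z : Vec d | ⟪n, z - x₀⟫ = 0}.indicator
        (fun z => ENNReal.ofReal (g z / c)) (e x) ∂(μHE[d - 1] : Measure (Vec d)) := by
      rw [hL, ← lintegral_indicator hΓc.measurableSet,
        ← setLIntegral_eq_of_support_subset (s := e.source)]
      · refine setLIntegral_congr_fun e.open_source.measurableSet fun x hx => ?_
        by_cases hx0 : x ∈ {x : Vec d | Φ x = 0}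
        · simp only [indicator_of_mem hx0, indicator_of_mem ((hmemV x).2 hx0), hge x hx]
        · simp only [indicator_of_notMem hx0, indicator_of_notMem (mt (hmemV x).1 hx0)]
      · intro x hx
        by_contra hx'
        exact hx (by simp [hfz x hx'])
    rw [h2]
    refine h1.trans (mul_le_mul_right ?_ _)
    rw [hΛ, ← lintegral_indicator hVc.measurableSet]
    exact setLIntegral_le_lintegral _ _
  have hΛL : Λ ≤ (K : ℝ≥0∞) ^ (d - 1) * L := by
    have h1 := setLIntegral_comp_chart_le e.symm (by simpa using hlip) (d - 1) hFΓ
    have h2 : Λ = ∫⁻ z in e.target, {x : Vec d | Φ x = 0}.indicator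
        (fun x => ENNReal.ofReal (f x / c)) (e.symm z) ∂(μHE[d - 1] : Measure (Vec d)) := by
      rw [hΛ, ← lintegral_indicator hVc.measurableSet,
        ← setLIntegral_eq_of_support_subset (s := e.target)]
      · refine setLIntegral_congr_fun e.open_target.measurableSet fun z hz => ?_
        have h3 := hmemV (e.symm z)
        have h4 := hge _ (e.map_target hz)
        rw [e.right_inv hz] at h3 h4
        by_cases hx0 : z ∈ {z : Vec d | ⟪n, z - x₀⟫ = 0}
        · simp only [indicator_of_mem hx0, indicator_of_mem (h3.1 hx0), h4]
        · simp only [indicator_of_notMem hx0, indicator_of_notMem (mt h3.2 hx0)]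
      · intro z hz
        by_contra hz'
        exact hz (by simp [hgt z hz'])
    rw [h2]
    refine h1.trans (mul_le_mul_right ?_ _)
    rw [hL, ← lintegral_indicator hΓc.measurableSet]
    exact setLIntegral_le_lintegral _ _
  have hKpos : (0 : ℝ) < K := by exact_mod_cast zero_lt_one.trans hK
  have hAL : levelInt Φ f ≤ K * L := by
    rw [hL, levelInt, ← lintegral_const_mul _ (hf.div_const c).measurable.ennreal_ofReal]
    refine lintegral_mono fun x => ?_
    rw [← ENNReal.ofReal_coe_nnreal, ← ENNReal.ofReal_mul (NNReal.coe_nonneg K)]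
    refine ENNReal.ofReal_le_ofReal ?_
    by_cases hx : x ∈ e.source
    · have h1 := (hgrad x hx).2
      have h2 : 0 < ‖gradient Φ x‖ := by
        by_contra h3
        have : ‖gradient Φ x‖ = 0 := le_antisymm (not_lt.1 h3) (norm_nonneg _)
        rw [this, mul_zero] at h1
        exact absurd hc (not_lt.2 h1)
      rw [mul_div_assoc', div_le_div_iff₀ h2 hc]
      nlinarith [hf0 x]
    · simp [hfz x hx]
  have hLA : L ≤ K * levelInt Φ f := by
    have hm : Measurable fun x => ENNReal.ofReal (f x / ‖gradient Φ x‖) :=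
      (hf.measurable.div (continuous_norm_gradient hΦ).measurable).ennreal_ofReal
    rw [hL, levelInt, ← lintegral_const_mul _ hm]
    refine lintegral_mono fun x => ?_
    rw [← ENNReal.ofReal_coe_nnreal, ← ENNReal.ofReal_mul (NNReal.coe_nonneg K)]
    refine ENNReal.ofReal_le_ofReal ?_
    by_cases hx : x ∈ e.source
    · have h1 := (hgrad x hx).2
      have h1' := (hgrad x hx).1
      have h2 : 0 < ‖gradient Φ x‖ := by
        by_contra h3
        have : ‖gradient Φ x‖ = 0 := le_antisymm (not_lt.1 h3) (norm_nonneg _)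
        rw [this, mul_zero] at h1
        exact absurd hc (not_lt.2 h1)
      rw [mul_div_assoc', div_le_div_iff₀ hc h2]
      nlinarith [hf0 x]
    · simp [hfz x hx]
  have hpow : (K : ℝ≥0∞) * (K : ℝ≥0∞) ^ (d - 1) = (K : ℝ≥0∞) ^ d := by
    rw [← pow_succ', hd1]
  have hpow2 : (K : ℝ≥0∞) ^ d * (K : ℝ≥0∞) ^ d = ((K ^ (2 * d) : ℝ≥0) : ℝ≥0∞) := by
    rw [← pow_add, ← two_mul, ENNReal.coe_pow]
  have hAΛ : levelInt Φ f ≤ (K : ℝ≥0∞) ^ d * Λ := by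
    rw [← hpow, mul_assoc]
    exact hAL.trans (mul_le_mul_right hLΛ _)
  have hΛA : Λ ≤ (K : ℝ≥0∞) ^ d * levelInt Φ f := by
    rw [← hpow, mul_comm (K : ℝ≥0∞), mul_assoc]
    exact hΛL.trans (mul_le_mul_right hLA _)
  have hKd0 : (K : ℝ≥0∞) ^ d ≠ 0 := pow_ne_zero _ (by
    exact_mod_cast (zero_lt_one.trans hK).ne')
  have hKdt : (K : ℝ≥0∞) ^ d ≠ ⊤ := ENNReal.pow_ne_top ENNReal.coe_ne_top
  have hΛtop : Λ ≠ ⊤ := by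
    rw [hΛ, ← map_add_eq_restrict_hyperplane hn x₀]
    have hce : Topology.IsClosedEmbedding (fun y : (ℝ ∙ n)ᗮ => (y : Vec d) + x₀) :=
      Isometry.isClosedEmbedding ((isometry_add_right x₀).comp isometry_subtype_coe)
    rw [hce.measurableEmbedding.lintegral_map]
    have hintg : Integrable (fun y : (ℝ ∙ n)ᗮ => g ((y : Vec d) + x₀) / c) :=
      Continuous.integrable_of_hasCompactSupport ((hg.div_const c).comp hce.continuous)
        (HasCompactSupport.comp_isClosedEmbedding (f := fun z => g z / c)
        (hgc.comp_left (g := fun r : ℝ => r / c) (zero_div c)) hce)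
    exact (hintg.lintegral_lt_top).ne
  refine ⟨fun η hη => ?_, hAΛ.trans_lt (ENNReal.mul_lt_top hKdt.lt_top hΛtop.lt_top)⟩
  -- The error in the flat limit is multiplied by `K ^ d` when it is carried back through the chart.
  set η' := η / (K : ℝ≥0∞) ^ d with hη'
  have hη'0 : η' ≠ 0 := ENNReal.div_ne_zero.2 ⟨hη, hKdt⟩
  have hη'K : (K : ℝ≥0∞) ^ d * η' = η := ENNReal.mul_div_cancel hKd0 hKdt
  have hev1 : ∀ᶠ ε in 𝓝[>] (0 : ℝ), J ε ≤ Λ + η' :=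
    hlim.eventually_le_const (ENNReal.lt_add_right hΛtop hη'0)
  have hev2 : ∀ᶠ ε in 𝓝[>] (0 : ℝ), Λ ≤ J ε + η' := by
    by_cases hΛ0 : Λ = 0
    · exact Eventually.of_forall fun ε => by rw [hΛ0]; exact bot_le
    · filter_upwards [hlim.eventually_const_le (ENNReal.sub_lt_self hΛtop hΛ0 hη'0)] with ε hε
      exact tsub_le_iff_right.1 hε
  filter_upwards [hev1, hev2] with ε h1 h2
  rw [← hpow2]
  constructor
  · calc layerInt Φ f ε ≤ (K : ℝ≥0∞) ^ d * J ε := hIJ ε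
      _ ≤ (K : ℝ≥0∞) ^ d * (Λ + η') := mul_le_mul_right h1 _
      _ ≤ (K : ℝ≥0∞) ^ d * ((K : ℝ≥0∞) ^ d * levelInt Φ f + η') := by gcongr
      _ = _ := by rw [mul_add, hη'K, mul_assoc]
  · calc levelInt Φ f ≤ (K : ℝ≥0∞) ^ d * Λ := hAΛ
      _ ≤ (K : ℝ≥0∞) ^ d * (J ε + η') := mul_le_mul_right h2 _
      _ ≤ (K : ℝ≥0∞) ^ d * ((K : ℝ≥0∞) ^ d * layerInt Φ f ε + η') := by
        gcongr; exact hJI ε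
      _ = _ := by rw [mul_add, hη'K, mul_assoc]

end Sandwich

end ThermoMagnet

end

noncomputable section

namespace ThermoMagnet

open scoped NNReal ENNReal

/-! ### The divergence theorem on a smooth sublevel set -/

section DivergenceTheorem

variable {d : ℕ} {Φ : Vec d → ℝ}

theorem eventually_layerInt_eq_zero (hΦ : Continuous Φ) {f : Vec d → ℝ}
    (hfc : HasCompactSupport f) (hs : tsupport f ⊆ {x | Φ x ≠ 0}) :
    ∀ᶠ ε in 𝓝[>] (0 : ℝ), layerInt Φ f ε = 0 := by
  obtain ⟨b, hb, hbf⟩ : ∃ b > 0, ∀ x ∈ tsupport f, b ≤ |Φ x| := by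
    rcases (tsupport f).eq_empty_or_nonempty with he | hne
    · exact ⟨1, one_pos, by simp [he]⟩
    · obtain ⟨x, hx, hmin⟩ := hfc.isCompact.exists_isMinOn hne hΦ.abs.continuousOn
      exact ⟨|Φ x|, abs_pos.2 (hs hx), fun y hy => hmin hy⟩
  filter_upwards [Ioo_mem_nhdsGT hb] with ε hε
  rw [layerInt, lintegral_eq_zero_of_ae_eq_zero]
  refine Eventually.of_forall fun x => ?_
  by_cases hx : x ∈ tsupport f
  · simp [layer_eq_zero hε.1 (hε.2.trans_le (hbf x hx))]
  · simp [image_eq_zero_of_notMem_tsupport hx]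

theorem levelInt_eq_zero {f : Vec d → ℝ} (hΦ : Continuous Φ)
    (hs : tsupport f ⊆ {x | Φ x ≠ 0}) : levelInt Φ f = 0 := by
  rw [levelInt, setLIntegral_congr_fun (g := fun _ => 0)
    (isClosed_eq hΦ continuous_const).measurableSet, lintegral_zero]
  intro x hx
  have : f x = 0 := image_eq_zero_of_notMem_tsupport fun h => hs h hx
  simp [this]

/-- A partition of unity localizes `f`. Near a zero of `Φ` a chart applies, with `K` so close to 1
that `K ^ (2 * d) ≤ C`. Away from the zero set both integrals vanish for small `ε`. Compact support
leaves finitely many pieces. -/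
theorem layerSandwich_of_nonneg (hΦ : ContDiff ℝ 1 Φ)
    (hreg : ∀ x, Φ x = 0 → gradient Φ x ≠ 0) {C : ℝ≥0} (hC : 1 < C) {f : Vec d → ℝ}
    (hf : Continuous f) (hfc : HasCompactSupport f) (hf0 : ∀ x, 0 ≤ f x) :
    LayerSandwich Φ C f ∧ levelInt Φ f < ⊤ := by
  obtain ⟨K, hK, hKC⟩ : ∃ K : ℝ≥0, 1 < K ∧ K ^ (2 * d) ≤ C := by
    have h1 : Tendsto (fun K : ℝ≥0 => K ^ (2 * d)) (𝓝[>] 1) (𝓝 1) := by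
      have h := (continuous_pow (M := ℝ≥0) (2 * d)).tendsto 1
      rw [one_pow] at h
      exact h.mono_left nhdsWithin_le_nhds
    have h2 := (h1.eventually_le_const hC).and self_mem_nhdsWithin
    obtain ⟨K, h3, h4⟩ := h2.exists
    exact ⟨K, h4, h3⟩
  have hmono : ∀ g, LayerSandwich Φ (K ^ (2 * d)) g → LayerSandwich Φ C g := fun g hg η hη => by
    have hKC' : ((K ^ (2 * d) : ℝ≥0) : ℝ≥0∞) ≤ C := by exact_mod_cast hKC
    filter_upwards [hg η hη] with ε h
    exact ⟨h.1.trans (by gcongr), h.2.trans (by gcongr)⟩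
  have hloc : ∀ x₀ : Vec d, ∃ U : Set (Vec d), IsOpen U ∧ x₀ ∈ U ∧
      ∀ f : Vec d → ℝ, Continuous f → HasCompactSupport f → (∀ x, 0 ≤ f x) → tsupport f ⊆ U →
        LayerSandwich Φ C f ∧ levelInt Φ f < ⊤ := fun x₀ => by
    by_cases h0 : Φ x₀ = 0
    · obtain ⟨U, hU, hx, h⟩ := layerSandwich_of_chart hΦ h0 (hreg x₀ h0) hK
      exact ⟨U, hU, hx, fun f h1 h2 h3 h4 => ⟨hmono f (h f h1 h2 h3 h4).1, (h f h1 h2 h3 h4).2⟩⟩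
    · refine ⟨{x | Φ x ≠ 0}, isOpen_ne_fun hΦ.continuous continuous_const, h0,
        fun f _ h2 _ h4 => ?_⟩
      have hz := levelInt_eq_zero hΦ.continuous h4
      refine ⟨fun η _ => ?_, by rw [hz]; exact ENNReal.zero_lt_top⟩
      filter_upwards [eventually_layerInt_eq_zero hΦ.continuous h2 h4] with ε hε
      rw [hz, hε]
      simp
  choose U hUo hxU hU using hloc
  obtain ⟨ρ, hρ⟩ := PartitionOfUnity.exists_isSubordinate isClosed_univ U hUo
    (fun x _ => mem_iUnion.2 ⟨x, hxU x⟩)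
  have hfin := ρ.locallyFinite.finite_nonempty_inter_compact hfc.isCompact
  set I := hfin.toFinset with hI
  have hsum : f = fun x => ∑ i ∈ I, ρ i x * f x := by
    ext x
    rw [← Finset.sum_mul]
    by_cases hx : f x = 0
    · rw [hx, mul_zero]
    · have h1 := ρ.sum_eq_one (mem_univ x)
      rw [finsum_eq_sum_of_support_subset (s := I)] at h1
      · rw [h1, one_mul]
      · intro i hi
        rw [hI, Finite.coe_toFinset]
        exact ⟨x, hi, subset_tsupport f hx⟩
  have hcont : ∀ i, Continuous fun x => ρ i x * f x := fun i => (ρ i).continuous.mul hf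
  have hpart : ∀ i, LayerSandwich Φ C (fun x => ρ i x * f x) ∧
      levelInt Φ (fun x => ρ i x * f x) < ⊤ := fun i =>
    hU i _ (hcont i) hfc.mul_left (fun x => mul_nonneg (ρ.nonneg i x) (hf0 x))
      ((tsupport_mul_subset_left).trans (hρ i))
  have hall : ∀ s : Finset (Vec d), LayerSandwich Φ C (fun x => ∑ i ∈ s, ρ i x * f x) ∧
      levelInt Φ (fun x => ∑ i ∈ s, ρ i x * f x) < ⊤ := fun s => by
    classical
    induction s using Finset.induction_on with
    | empty => 
      have hz : levelInt Φ (fun _ => 0) = 0 := by simp [levelInt]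
      simp only [Finset.sum_empty]
      refine ⟨fun η _ => Eventually.of_forall fun ε => ?_, by rw [hz]; exact ENNReal.zero_lt_top⟩
      have hz' : layerInt Φ (fun _ => 0) ε = 0 := by simp [layerInt]
      rw [hz, hz']
      simp
    | insert i s hi ih =>
      simp only [Finset.sum_insert hi]
      have h0 : ∀ x, 0 ≤ ∑ i ∈ s, ρ i x * f x := fun x =>
        Finset.sum_nonneg fun i _ => mul_nonneg (ρ.nonneg i x) (hf0 x)
      have h0' : ∀ x, 0 ≤ ρ i x * f x := fun x => mul_nonneg (ρ.nonneg i x) (hf0 x)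
      refine ⟨(hpart i).1.add hΦ (hcont i) h0' h0 ih.1, ?_⟩
      have : levelInt Φ (fun x => ρ i x * f x + ∑ i ∈ s, ρ i x * f x) =
          levelInt Φ (fun x => ρ i x * f x) + levelInt Φ (fun x => ∑ i ∈ s, ρ i x * f x) := by
        rw [levelInt, levelInt, levelInt, ← lintegral_add_left]
        · refine lintegral_congr fun x => ?_
          rw [add_div, ENNReal.ofReal_add (div_nonneg (h0' x) (norm_nonneg _))
            (div_nonneg (h0 x) (norm_nonneg _))]
        · exact ((hcont i).measurable.div
            (continuous_norm_gradient hΦ).measurable).ennreal_ofReal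
      rw [this]
      exact ENNReal.add_lt_top.2 ⟨(hpart i).2, ih.2⟩
  rw [hsum]
  exact hall I

/-- The factor `C > 1` is arbitrary and the surface integral is finite, so letting `C` tend to 1
closes the sandwich. The exact limit is thus obtained from inexact charts. -/
theorem tendsto_layerInt (hΦ : ContDiff ℝ 1 Φ) (hreg : ∀ x, Φ x = 0 → gradient Φ x ≠ 0)
    {f : Vec d → ℝ} (hf : Continuous f) (hfc : HasCompactSupport f) (hf0 : ∀ x, 0 ≤ f x) :
    Tendsto (layerInt Φ f) (𝓝[>] 0) (𝓝 (levelInt Φ f)) := by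
  have hA := (layerSandwich_of_nonneg hΦ hreg (C := 2) one_lt_two hf hfc hf0).2.ne
  set A := levelInt Φ f with hAdef
  have hmulcont : Tendsto (fun C : ℝ≥0 => (C : ℝ≥0∞) * A) (𝓝[>] 1) (𝓝 A) := by
    have h1 : Tendsto (fun C : ℝ≥0 => (C : ℝ≥0∞)) (𝓝[>] 1) (𝓝 1) := by
      have := (ENNReal.continuous_coe.tendsto (1 : ℝ≥0))
      rw [ENNReal.coe_one] at this
      exact this.mono_left nhdsWithin_le_nhds
    have h2 := ENNReal.Tendsto.mul_const h1 (Or.inr hA)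
    rwa [one_mul] at h2
  refine tendsto_order.2 ⟨fun a ha => ?_, fun b hb => ?_⟩
  -- If the layer integral were at most `a`, the sandwich with error `A - a''` would give `A ≤ C * a
  -- + (A - a'') ≤ a' + (A - a'') < A`.
  · obtain ⟨a', haa', ha'A⟩ := exists_between ha
    obtain ⟨a'', haa'', ha''A⟩ := exists_between ha'A
    have hCa : ∀ᶠ C : ℝ≥0 in 𝓝[>] 1, (C : ℝ≥0∞) * a < a' := by
      have h1 : Tendsto (fun C : ℝ≥0 => (C : ℝ≥0∞)) (𝓝[>] 1) (𝓝 1) := by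
        have := (ENNReal.continuous_coe.tendsto (1 : ℝ≥0))
        rw [ENNReal.coe_one] at this
        exact this.mono_left nhdsWithin_le_nhds
      have h2 := ENNReal.Tendsto.mul_const h1 (Or.inr (ne_top_of_lt ha))
      rw [one_mul] at h2
      exact h2.eventually_lt_const haa'
    obtain ⟨C, hC, hC1⟩ := (hCa.and self_mem_nhdsWithin).exists
    have hη : A - a' ≠ 0 := (tsub_pos_of_lt ha'A).ne'
    have hη2 : A - a'' ≠ 0 := (tsub_pos_of_lt ha''A).ne'
    filter_upwards [(layerSandwich_of_nonneg hΦ hreg hC1 hf hfc hf0).1 _ hη2] with ε hε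
    by_contra hcon
    rw [not_lt] at hcon
    have h3 : A ≤ a' + (A - a'') := hε.2.trans (by
      gcongr
      exact (mul_le_mul_right hcon _).trans hC.le)
    have h4 : a' + (A - a'') < a'' + (A - a'') :=
      ENNReal.add_lt_add_right (ne_top_of_le_ne_top hA tsub_le_self) haa''
    rw [add_tsub_cancel_of_le ha''A.le] at h4
    exact absurd h3 (not_le.2 h4)
  · obtain ⟨b₂, hAb₂, hb₂⟩ := exists_between hb
    obtain ⟨b', hAb', hb'⟩ := exists_between hAb₂
    obtain ⟨C, hC, hC1⟩ := ((hmulcont.eventually_lt_const hAb').and self_mem_nhdsWithin).exists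
    have hη : b₂ - b' ≠ 0 := (tsub_pos_of_lt hb').ne'
    filter_upwards [(layerSandwich_of_nonneg hΦ hreg hC1 hf hfc hf0).1 _ hη] with ε hε
    refine hε.1.trans_lt (lt_of_le_of_lt ?_ hb₂)
    calc (C : ℝ≥0∞) * A + (b₂ - b') ≤ b' + (b₂ - b') := by gcongr
      _ = b₂ := add_tsub_cancel_of_le hb'.le

/-- The Euclidean surface measure of a compact regular level set is finite. -/
theorem measure_level_lt_top (hΦ : ContDiff ℝ 1 Φ) (hreg : ∀ x, Φ x = 0 → gradient Φ x ≠ 0)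
    (hc : IsCompact {x | Φ x = 0}) : (μHE[d - 1] : Measure (Vec d)) {x | Φ x = 0} < ⊤ := by
  obtain ⟨χ, hχ1, -, hχc, hχ⟩ := exists_continuous_one_zero_of_isCompact hc
    (isClosed_empty (X := Vec d)) (disjoint_empty _)
  have hN := continuous_norm_gradient hΦ
  -- The weight `|∇Φ|` cancels the denominator in `levelInt`, and the cutoff equals one on the level
  -- set, so the finite quantity is the measure itself. Any factor above 1 would do.
  have h1 := (layerSandwich_of_nonneg hΦ hreg (C := 2) one_lt_two
    (f := fun x => χ x * ‖gradient Φ x‖) (χ.continuous.mul hN) hχc.mul_right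
    (fun x => mul_nonneg (hχ x).1 (norm_nonneg _))).2
  rw [levelInt, setLIntegral_congr_fun (g := fun _ => 1) hc.measurableSet, lintegral_one,
    Measure.restrict_apply_univ] at h1
  · exact h1
  · intro x hx
    have h2 : ‖gradient Φ x‖ ≠ 0 := norm_ne_zero_iff.2 (hreg x hx)
    simp [hχ1 hx, h2]

theorem integrableOn_level (hΦ : ContDiff ℝ 1 Φ) (hreg : ∀ x, Φ x = 0 → gradient Φ x ≠ 0)
    (hc : IsCompact {x | Φ x = 0}) {f : Vec d → ℝ} (hf : ContinuousOn f {x | Φ x = 0}) :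
    IntegrableOn f {x | Φ x = 0} (μHE[d - 1] : Measure (Vec d)) := by
  obtain ⟨B, hB⟩ := hc.exists_bound_of_continuousOn hf
  have : IsFiniteMeasure ((μHE[d - 1] : Measure (Vec d)).restrict {x | Φ x = 0}) :=
    ⟨by rw [Measure.restrict_apply_univ]; exact measure_level_lt_top hΦ hreg hc⟩
  exact Integrable.of_bound (hf.aestronglyMeasurable hc.measurableSet) B
    ((ae_restrict_iff' hc.measurableSet).2 (Eventually.of_forall hB))

/-- Signed functions are split into positive and negative parts, both of which remain continuous
with compact support. -/
theorem tendsto_integral_layer (hΦ : ContDiff ℝ 1 Φ) (hreg : ∀ x, Φ x = 0 → gradient Φ x ≠ 0)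
    (hc : IsCompact {x | Φ x = 0}) {f : Vec d → ℝ} (hf : Continuous f)
    (hfc : HasCompactSupport f) :
    Tendsto (fun ε => ∫ x, f x * layer ε (Φ x)) (𝓝[>] 0)
      (𝓝 (∫ x in {x | Φ x = 0}, f x / ‖gradient Φ x‖ ∂(μHE[d - 1] : Measure (Vec d)))) := by
  have hΓ : ∀ g : Vec d → ℝ, Continuous g →
      IntegrableOn (fun x => g x / ‖gradient Φ x‖) {x | Φ x = 0}
        (μHE[d - 1] : Measure (Vec d)) := fun g hg =>
    integrableOn_level hΦ hreg hc (hg.continuousOn.div (continuous_norm_gradient hΦ).continuousOn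
      fun x hx => norm_ne_zero_iff.2 (hreg x hx))
  have hI : ∀ (g : Vec d → ℝ) (ε : ℝ), Continuous g → HasCompactSupport g →
      Integrable fun x => g x * layer ε (Φ x) := fun g ε hg hgc =>
    (hg.mul ((continuous_layer ε).comp hΦ.continuous)).integrable_of_hasCompactSupport
      hgc.mul_right
  have hpos : ∀ g : Vec d → ℝ, Continuous g → HasCompactSupport g → (∀ x, 0 ≤ g x) →
      Tendsto (fun ε => ∫ x, g x * layer ε (Φ x)) (𝓝[>] 0)
      (𝓝 (∫ x in {x | Φ x = 0}, g x / ‖gradient Φ x‖ ∂(μHE[d - 1] : Measure (Vec d)))) :=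
    fun g hg hgc hg0 => by
    have h1 := tendsto_layerInt hΦ hreg hg hgc hg0
    have hfin := (layerSandwich_of_nonneg hΦ hreg (C := 2) one_lt_two hg hgc hg0).2.ne
    have h2 := (ENNReal.tendsto_toReal hfin).comp h1
    rw [integral_eq_lintegral_of_nonneg_ae
      (Eventually.of_forall fun x => div_nonneg (hg0 x) (norm_nonneg _)) (hΓ g hg).1]
    refine h2.congr' ?_
    filter_upwards [self_mem_nhdsWithin] with ε hε
    rw [integral_eq_lintegral_of_nonneg_ae
      (Eventually.of_forall fun x => mul_nonneg (hg0 x) (layer_nonneg hε _)) (hI g ε hg hgc).1]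
    rfl
  have hfp : Continuous fun x => max (f x) 0 := hf.max continuous_const
  have hfm : Continuous fun x => max (-f x) 0 := hf.neg.max continuous_const
  have hfpc : HasCompactSupport fun x => max (f x) 0 :=
    hfc.comp_left (g := fun r : ℝ => max r 0) (max_self 0)
  have hfmc : HasCompactSupport fun x => max (-f x) 0 :=
    hfc.comp_left (g := fun r : ℝ => max (-r) 0) (by simp)
  have h1 := (hpos _ hfp hfpc fun x => le_max_right _ _).sub
    (hpos _ hfm hfmc fun x => le_max_right _ _)
  have hsplit : ∀ r : ℝ, max r 0 - max (-r) 0 = r := fun r => by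
    rcases le_total r 0 with h | h
    · rw [max_eq_right h, max_eq_left (neg_nonneg.2 h)]; ring
    · rw [max_eq_left h, max_eq_right (neg_nonpos.2 h)]; ring
  rw [← integral_sub (hΓ _ hfp) (hΓ _ hfm)] at h1
  simp only [← sub_div, hsplit] at h1
  refine h1.congr fun ε => ?_
  rw [← integral_sub (hI _ ε hfp hfpc) (hI _ ε hfm hfmc)]
  simp only [← sub_mul, hsplit]

/-- Integrate by parts over the whole space against `χ ε = smoothTransition (-(Φ / ε))`. It
converges pointwise to the indicator of the sublevel set, while its derivative is minus the layer
times `∇Φ`. In the limit the layer gives the surface integral with weight `1/|∇Φ|`, and `∇Φ/|∇Φ|` is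
the normal. -/
theorem integral_fderiv_sublevel_of_hasCompactSupport (hΦ : ContDiff ℝ 1 Φ)
    (hreg : ∀ x, Φ x = 0 → gradient Φ x ≠ 0) (hc : IsCompact {x | Φ x = 0}) {F : Vec d → ℝ}
    (hF : ContDiff ℝ 1 F) (hFc : HasCompactSupport F) (v : Vec d) :
    ∫ x in {x | Φ x < 0}, fderiv ℝ F x v =
      ∫ x in {x | Φ x = 0}, F x * ⟪normal Φ x, v⟫ ∂(μHE[d - 1] : Measure (Vec d)) := by
  have hΦ' : Continuous fun x => fderiv ℝ Φ x v :=
    (hΦ.continuous_fderiv one_ne_zero).clm_apply continuous_const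
  have hF' : Continuous fun x => fderiv ℝ F x v :=
    (hF.continuous_fderiv one_ne_zero).clm_apply continuous_const
  have hF'c : HasCompactSupport fun x => fderiv ℝ F x v :=
    (hFc.fderiv (𝕜 := ℝ)).comp_left (g := fun A : Vec d →L[ℝ] ℝ => A v) (by simp)
  have hΩ : MeasurableSet {x | Φ x < 0} := (isOpen_lt hΦ.continuous continuous_const).measurableSet
  have hlim := tendsto_integral_layer hΦ hreg hc (f := fun x => F x * fderiv ℝ Φ x v)
    (hF.continuous.mul hΦ') hFc.mul_right
  have hrhs : ∫ x in {x | Φ x = 0}, F x * fderiv ℝ Φ x v / ‖gradient Φ x‖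
      ∂(μHE[d - 1] : Measure (Vec d)) =
      ∫ x in {x | Φ x = 0}, F x * ⟪normal Φ x, v⟫ ∂(μHE[d - 1] : Measure (Vec d)) := by
    refine integral_congr_ae (Eventually.of_forall fun x => ?_)
    simp only [normal, real_inner_smul_left, inner_gradient_left]
    ring
  rw [hrhs] at hlim
  set χ : ℝ → Vec d → ℝ := fun ε x => Real.smoothTransition (-(Φ x / ε)) with hχ
  have hχc : ∀ ε, Continuous (χ ε) := fun ε =>
    Real.smoothTransition.continuous.comp (hΦ.continuous.div_const ε).neg
  have hχ' : ∀ ε x, HasFDerivAt (χ ε) (-(layer ε (Φ x) • fderiv ℝ Φ x)) x := fun ε x => by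
    have h1 : HasDerivAt Real.smoothTransition
        (deriv Real.smoothTransition (-(Φ x / ε))) (-(Φ x / ε)) :=
      ((Real.smoothTransition.contDiff (n := 1)).differentiable one_ne_zero _).hasDerivAt
    have h2 : HasFDerivAt (fun y => -(Φ y / ε)) (-(ε⁻¹ • fderiv ℝ Φ x)) x := by
      have h3 := (((hΦ.differentiable one_ne_zero) x).hasFDerivAt.const_mul ε⁻¹).neg
      simp only [div_eq_inv_mul]
      exact h3
    refine (h1.comp_hasFDerivAt x h2).congr_fderiv ?_
    ext w
    simp [layer]
    ring
  have hleft : Tendsto (fun ε => ∫ x, χ ε x * fderiv ℝ F x v) (𝓝[>] 0)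
      (𝓝 (∫ x in {x | Φ x < 0}, fderiv ℝ F x v)) := by
    rw [← integral_indicator hΩ]
    refine tendsto_integral_filter_of_dominated_convergence (fun x => |fderiv ℝ F x v|) ?_ ?_
      (hF'.integrable_of_hasCompactSupport hF'c).abs ?_
    · exact Eventually.of_forall fun ε => ((hχc ε).mul hF').aestronglyMeasurable
    · refine Eventually.of_forall fun ε => Eventually.of_forall fun x => ?_
      rw [norm_mul, Real.norm_eq_abs, Real.norm_eq_abs,
        abs_of_nonneg (Real.smoothTransition.nonneg _)]
      exact mul_le_of_le_one_left (abs_nonneg _) (Real.smoothTransition.le_one _)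
    · refine Eventually.of_forall fun x => tendsto_const_nhds.congr' ?_
      by_cases hx : Φ x < 0
      · filter_upwards [Ioo_mem_nhdsGT (neg_pos.2 hx)] with ε hε
        rw [indicator_of_mem (show x ∈ {x | Φ x < 0} from hx), hχ]
        simp only
        rw [Real.smoothTransition.one_of_one_le, one_mul]
        rw [← neg_div, le_div_iff₀ hε.1]
        linarith [hε.2]
      · filter_upwards [self_mem_nhdsWithin] with ε hε
        rw [indicator_of_notMem (show x ∉ {x | Φ x < 0} from hx), hχ]
        simp only
        rw [Real.smoothTransition.zero_of_nonpos, zero_mul]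
        exact neg_nonpos.2 (div_nonneg (not_lt.1 hx) (le_of_lt hε))
  refine tendsto_nhds_unique hleft (hlim.congr fun ε => ?_)
  have hib := integral_mul_fderiv_eq_neg_fderiv_mul_of_integrable (μ := volume) (f := χ ε)
    (g := F) (v := v) ?_ ?_ ?_ (fun x _ => (hχ' ε x).differentiableAt)
    (fun x _ => (hF.differentiable one_ne_zero) x)
  · rw [hib, ← integral_neg]
    refine integral_congr_ae (Eventually.of_forall fun x => ?_)
    simp only [(hχ' ε x).fderiv]
    simp
    ring
  · simp only [fun x => (hχ' ε x).fderiv]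
    refine Continuous.integrable_of_hasCompactSupport ?_ hFc.mul_left
    have h1 : Continuous fun x => -(layer ε (Φ x) * fderiv ℝ Φ x v) :=
      (((continuous_layer ε).comp hΦ.continuous).mul hΦ').neg
    simp only [neg_apply, smul_apply, smul_eq_mul]
    exact h1.mul hF.continuous
  · exact ((hχc ε).mul hF').integrable_of_hasCompactSupport hF'c.mul_left
  · exact ((hχc ε).mul hF.continuous).integrable_of_hasCompactSupport hFc.mul_left

/-- A `Cⁿ` function near a compact set agrees near it with a compactly supported `Cⁿ` function. -/
theorem exists_contDiff_hasCompactSupport_eventuallyEq {n : ℕ} {S : Set (Vec d)}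
    (hS : IsCompact S) {f : Vec d → ℝ} (hf : ∀ x ∈ S, ContDiffAt ℝ n f x) :
    ∃ F : Vec d → ℝ, ContDiff ℝ n F ∧ HasCompactSupport F ∧ ∀ x ∈ S, F =ᶠ[𝓝 x] f := by
  obtain ⟨R, hR⟩ := hS.isBounded.subset_ball 0
  set U : Set (Vec d) := {x | ∀ᶠ y in 𝓝 x, ContDiffAt ℝ n f y} ∩ Metric.ball 0 R with hU
  have hUo : IsOpen U := isOpen_setOfPred_eventually_nhds.inter Metric.isOpen_ball
  have hSU : S ⊆ U := fun x hx => ⟨(hf x hx).eventually (by simp), hR hx⟩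
  obtain ⟨χ, h0, h1, -⟩ := exists_contMDiffMap_zero_one_nhds_of_isClosed (n := (⊤ : ℕ∞))
    (modelWithCornersSelf ℝ (Vec d)) hUo.isClosed_compl hS.isClosed
    (disjoint_compl_left_iff_subset.2 hSU)
  have hχ : ContDiff ℝ n χ := (contMDiff_iff_contDiff.1 χ.contMDiff).of_le (by exact_mod_cast le_top)
  refine ⟨fun x => χ x * f x, contDiff_iff_contDiffAt.2 fun x => ?_, ?_, fun x hx => ?_⟩
  · by_cases hx : x ∈ U
    · exact hχ.contDiffAt.mul (hx.1.self_of_nhds)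
    · have h2 : ∀ᶠ y in 𝓝 x, χ y = 0 :=
        h0.filter_mono (nhds_le_nhdsSet (show x ∈ Uᶜ from hx))
      refine contDiffAt_const (c := (0 : ℝ)) |>.congr_of_eventuallyEq ?_
      filter_upwards [h2] with y hy
      rw [hy, zero_mul]
  · refine HasCompactSupport.intro (isCompact_closedBall (0 : Vec d) R) fun x hx => ?_
    have h2 : x ∈ Uᶜ := fun h => hx (Metric.ball_subset_closedBall h.2)
    rw [h0.self_of_nhdsSet x h2, zero_mul]
  · filter_upwards [h1.filter_mono (nhds_le_nhdsSet hx)] with y hy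
    rw [hy, one_mul]

namespace IsSmoothDomain

variable {Ω : Set (Vec d)}

theorem contDiff_one (hΩ : IsSmoothDomain Ω Φ) : ContDiff ℝ 1 Φ :=
  hΩ.smooth.of_le (by exact_mod_cast le_top)

theorem isOpen (hΩ : IsSmoothDomain Ω Φ) : IsOpen Ω := by
  rw [hΩ.eq_sublevel]; exact isOpen_lt hΩ.smooth.continuous continuous_const

theorem isCompact_closure (hΩ : IsSmoothDomain Ω Φ) : IsCompact (closure Ω) :=
  hΩ.bounded.isCompact_closure

/-- A zero of `Φ` is approached from inside by moving against its gradient, along which `Φ` has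
negative derivative. Without regularity the zero set could be larger than the boundary. -/
theorem frontier_eq (hΩ : IsSmoothDomain Ω Φ) : frontier Ω = {x | Φ x = 0} := by
  rw [hΩ.isOpen.frontier_eq]
  ext x
  constructor
  · rintro ⟨h1, h2⟩
    rw [hΩ.eq_sublevel] at h1 h2
    have h3 : Φ x ≤ 0 := closure_lt_subset_le hΩ.smooth.continuous continuous_const h1
    exact le_antisymm h3 (not_lt.1 h2)
  · intro hx
    have hx0 : Φ x = 0 := hx
    refine ⟨?_, by rw [hΩ.eq_sublevel]; simp [hx0]⟩
    have hg := hΩ.regular x hx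
    have h1 : HasDerivAt (fun s : ℝ => Φ (x + s • -gradient Φ x)) (-(‖gradient Φ x‖ ^ 2)) 0 := by
      have h2 : HasDerivAt (fun s : ℝ => x + s • -gradient Φ x) (-gradient Φ x) 0 := by
        simpa using ((hasDerivAt_id (0 : ℝ)).smul_const (-gradient Φ x)).const_add x
      have h3 := (hΩ.contDiff_one.differentiable one_ne_zero (x + (0 : ℝ) • -gradient Φ x)).hasFDerivAt
      have h4 := h3.comp_hasDerivAt (0 : ℝ) h2
      refine h4.congr_deriv ?_
      rw [zero_smul, add_zero, ← inner_gradient_left, inner_neg_right, real_inner_self_eq_norm_sq]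
    have hneg : -(‖gradient Φ x‖ ^ 2) < 0 := neg_neg_of_pos (pow_pos (norm_pos_iff.2 hg) 2)
    have h5 : ∀ᶠ s in 𝓝[>] (0 : ℝ), Φ (x + s • -gradient Φ x) < 0 := by
      have h6 := (hasDerivWithinAt_iff_tendsto_slope' (s := Ioi (0 : ℝ)) (by simp)).1
        (h1.hasDerivWithinAt (s := Ioi 0))
      filter_upwards [h6.eventually_lt_const hneg, self_mem_nhdsWithin] with s hs hs0
      rw [slope_def_field] at hs
      simp only [zero_smul, add_zero, hx0, sub_zero] at hs
      by_contra hcon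
      exact absurd hs (not_lt.2 (div_nonneg (not_lt.1 hcon) (le_of_lt hs0)))
    have h7 : Tendsto (fun s : ℝ => x + s • -gradient Φ x) (𝓝[>] 0) (𝓝 x) := by
      have h8 : Continuous fun s : ℝ => x + s • -gradient Φ x := by fun_prop
      have h9 := h8.tendsto 0
      rw [zero_smul, add_zero] at h9
      exact h9.mono_left nhdsWithin_le_nhds
    refine mem_closure_of_tendsto h7 ?_
    filter_upwards [h5] with s hs
    rw [hΩ.eq_sublevel]
    exact hs

theorem isCompact_frontier (hΩ : IsSmoothDomain Ω Φ) : IsCompact (frontier Ω) :=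
  hΩ.isCompact_closure.of_isClosed_subset isClosed_frontier frontier_subset_closure

theorem surf_eq (hΩ : IsSmoothDomain Ω Φ) :
    surf Ω = (μHE[d - 1] : Measure (Vec d)).restrict {x | Φ x = 0} := by
  rw [surf, hΩ.frontier_eq]

theorem integrable_surf (hΩ : IsSmoothDomain Ω Φ) {f : Vec d → ℝ}
    (hf : ContinuousOn f (frontier Ω)) : Integrable f (surf Ω) := by
  have hc := hΩ.isCompact_frontier
  rw [hΩ.frontier_eq] at hf hc
  rw [hΩ.surf_eq]
  exact integrableOn_level hΩ.contDiff_one hΩ.regular hc hf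

/-- The divergence theorem, for one partial derivative. -/
theorem integral_pd (hΩ : IsSmoothDomain Ω Φ) {f : Vec d → ℝ}
    (hf : ∀ x ∈ closure Ω, ContDiffAt ℝ 1 f x) (j : Fin d) :
    ∫ x in Ω, pd j f x = ∫ x, f x * normal Φ x j ∂(surf Ω) := by
  obtain ⟨F, hF, hFc, hFf⟩ := exists_contDiff_hasCompactSupport_eventuallyEq (n := 1)
    hΩ.isCompact_closure hf
  have hc := hΩ.isCompact_frontier
  rw [hΩ.frontier_eq] at hc
  have h1 := integral_fderiv_sublevel_of_hasCompactSupport hΩ.contDiff_one hΩ.regular hc hF hFc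
    (EuclideanSpace.single j 1)
  rw [← hΩ.eq_sublevel] at h1
  have h2 : ∫ x in Ω, pd j f x = ∫ x in Ω, fderiv ℝ F x (EuclideanSpace.single j 1) :=
    setIntegral_congr_fun hΩ.isOpen.measurableSet fun x hx => by
      simp only [pd, (hFf x (subset_closure hx)).fderiv_eq]
  rw [h2, h1, hΩ.surf_eq]
  refine setIntegral_congr_fun hc.measurableSet fun x hx => ?_
  have h3 : F x = f x := (hFf x (by
    rw [← hΩ.frontier_eq] at hx
    exact frontier_subset_closure hx)).eq_of_nhds
  simp [h3, EuclideanSpace.inner_single_right]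

end IsSmoothDomain

end DivergenceTheorem

end ThermoMagnet

end

noncomputable section

namespace ThermoMagnet

/-! ### Calculus of partial derivatives -/

section PartialDerivatives

variable {d : ℕ} {f g : Vec d → ℝ} {x : Vec d}

theorem pd_congr (h : f =ᶠ[𝓝 x] g) (j : Fin d) : pd j f x = pd j g x := by
  rw [pd, pd, h.fderiv_eq]

theorem pd_add (hf : DifferentiableAt ℝ f x) (hg : DifferentiableAt ℝ g x) (j : Fin d) :
    pd j (fun y => f y + g y) x = pd j f x + pd j g x := by
  rw [pd, fderiv_fun_add hf hg]; rfl

theorem pd_sub (hf : DifferentiableAt ℝ f x) (hg : DifferentiableAt ℝ g x) (j : Fin d) :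
    pd j (fun y => f y - g y) x = pd j f x - pd j g x := by
  rw [pd, fderiv_fun_sub hf hg]; rfl

theorem pd_mul (hf : DifferentiableAt ℝ f x) (hg : DifferentiableAt ℝ g x) (j : Fin d) :
    pd j (fun y => f y * g y) x = pd j f x * g x + f x * pd j g x := by
  rw [pd, fderiv_fun_mul hf hg]
  simp [pd]
  ring

theorem pd_const (c : ℝ) (j : Fin d) : pd j (fun _ => c) x = 0 := by
  simp [pd]

theorem pd_sum {ι : Type*} (s : Finset ι) {F : ι → Vec d → ℝ}
    (hF : ∀ i ∈ s, DifferentiableAt ℝ (F i) x) (j : Fin d) :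
    pd j (fun y => ∑ i ∈ s, F i y) x = ∑ i ∈ s, pd j (F i) x := by
  rw [pd, fderiv_fun_sum hF]
  simp [pd]

theorem fderiv_eq_sum_pd (f : Vec d → ℝ) (x v : Vec d) :
    fderiv ℝ f x v = ∑ i, v i * pd i f x := by
  conv_lhs => rw [← (EuclideanSpace.basisFun (Fin d) ℝ).sum_repr v]
  simp [pd]

theorem gradient_apply (f : Vec d → ℝ) (x : Vec d) (j : Fin d) : gradient f x j = pd j f x := by
  rw [pd, ← inner_gradient_left, EuclideanSpace.inner_single_right]
  simp

theorem contDiffAt_pd {n m : WithTop ℕ∞} (hf : ContDiffAt ℝ n f x) (hmn : m + 1 ≤ n)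
    (j : Fin d) : ContDiffAt ℝ m (pd j f) x :=
  (hf.fderiv_right hmn).clm_apply contDiffAt_const

theorem pd_comm (hf : ContDiffAt ℝ 2 f x) (i j : Fin d) :
    pd i (pd j f) x = pd j (pd i f) x := by
  have hs := hf.isSymmSndFDerivAt (by simp)
  have hd : DifferentiableAt ℝ (fderiv ℝ f) x :=
    (hf.fderiv_right (m := 1) (by norm_num)).differentiableAt one_ne_zero
  have key : ∀ i j : Fin d, pd i (pd j f) x =
      fderiv ℝ (fderiv ℝ f) x (EuclideanSpace.single i 1) (EuclideanSpace.single j 1) :=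
    fun i j => by
      rw [pd]
      change fderiv ℝ (fun y => fderiv ℝ f y (EuclideanSpace.single j 1)) x _ = _
      rw [fderiv_clm_apply hd (differentiableAt_const _)]
      simp
  rw [key, key]
  exact hs _ _

end PartialDerivatives

/-! ### The surface divergence theorem on a closed surface -/

section SurfaceDivergence

variable {d : ℕ} {Φ : Vec d → ℝ} {Ω : Set (Vec d)}

theorem contDiffAt_gradient (hΦ : ContDiff ℝ ∞ Φ) (x : Vec d) :
    ContDiffAt ℝ ∞ (gradient Φ) x :=
  (InnerProductSpace.toDual ℝ (Vec d)).symm.contDiff.contDiffAt.comp x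
    (hΦ.contDiffAt.fderiv_right (by simp))

theorem contDiffAt_normal (hΦ : ContDiff ℝ ∞ Φ) {x : Vec d} (h : gradient Φ x ≠ 0) :
    ContDiffAt ℝ ∞ (normal Φ) x := by
  have h1 := contDiffAt_gradient hΦ x
  exact ((h1.norm ℝ h).inv (norm_ne_zero_iff.2 h)).smul h1

namespace IsSmoothDomain

theorem gradient_ne_zero (hΩ : IsSmoothDomain Ω Φ) {x : Vec d} (hx : x ∈ frontier Ω) :
    gradient Φ x ≠ 0 := hΩ.regular x (by rwa [hΩ.frontier_eq] at hx)

theorem contDiffAt_normal_apply (hΩ : IsSmoothDomain Ω Φ) {x : Vec d} (hx : x ∈ frontier Ω)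
    (i : Fin d) : ContDiffAt ℝ ∞ (fun y => normal Φ y i) x :=
  (contDiffAt_piLp_apply 2).comp x (contDiffAt_normal hΩ.smooth (hΩ.gradient_ne_zero hx))

theorem sum_normal_sq (hΩ : IsSmoothDomain Ω Φ) {x : Vec d} (hx : x ∈ frontier Ω) :
    ∑ i, normal Φ x i * normal Φ x i = 1 := by
  have h := norm_normal (hΩ.gradient_ne_zero hx)
  have h2 := EuclideanSpace.real_norm_sq_eq (normal Φ x)
  rw [h] at h2
  simpa [sq] using h2.symm

/-- The extended normal has unit length on a full neighbourhood, since `∇Φ` does not vanish near the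
boundary, so the derivative of `|n|²` is zero in every direction. -/
theorem sum_normal_mul_pd_normal (hΩ : IsSmoothDomain Ω Φ) {x : Vec d} (hx : x ∈ frontier Ω)
    (j : Fin d) : ∑ i, normal Φ x i * pd j (fun y => normal Φ y i) x = 0 := by
  have hd : ∀ i, DifferentiableAt ℝ (fun y => normal Φ y i) x := fun i =>
    (hΩ.contDiffAt_normal_apply hx i).differentiableAt (by simp)
  have h1 : (fun y => ∑ i, normal Φ y i * normal Φ y i) =ᶠ[𝓝 x] fun _ => 1 := by
    have hcont : ContinuousAt (gradient Φ) x := (contDiffAt_gradient hΩ.smooth x).continuousAt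
    filter_upwards [hcont.eventually_ne (hΩ.gradient_ne_zero hx)] with y hy
    have h2 := EuclideanSpace.real_norm_sq_eq (normal Φ y)
    rw [norm_normal hy] at h2
    simpa [sq] using h2.symm
  have h3 := pd_congr h1 j
  rw [pd_const, pd_sum (F := fun i y => normal Φ y i * normal Φ y i) _
    (fun i _ => (hd i).mul (hd i))] at h3
  have h4 : ∑ i, pd j (fun y => normal Φ y i * normal Φ y i) x =
      2 * ∑ i, normal Φ x i * pd j (fun y => normal Φ y i) x := by
    rw [Finset.mul_sum]
    refine Finset.sum_congr rfl fun i _ => ?_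
    rw [pd_mul (hd i) (hd i)]
    ring
  linarith

/-- Derivatives along the boundary, in tangential directions, are the ambient ones. -/
theorem fderivWithin_frontier (hΩ : IsSmoothDomain Ω Φ) {x : Vec d} (hx : x ∈ frontier Ω)
    {f : Vec d → ℝ} (hf : DifferentiableAt ℝ f x) {τ : Vec d} (hτ : ⟪normal Φ x, τ⟫ = 0) :
    fderivWithin ℝ f (frontier Ω) x τ = fderiv ℝ f x τ := by
  have hx0 : Φ x = 0 := by rwa [hΩ.frontier_eq] at hx
  have hg := hΩ.gradient_ne_zero hx
  have hstr : HasStrictFDerivAt (straighten Φ x)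
    ((ContinuousLinearEquiv.refl ℝ (Vec d) : Vec d ≃L[ℝ] Vec d) : Vec d →L[ℝ] Vec d) x :=
    hasStrictFDerivAt_straighten hΩ.contDiff_one x
  set e := hstr.toOpenPartialHomeomorph (straighten Φ x) with he
  have hex : (e : Vec d → Vec d) = straighten Φ x := rfl
  have hxs : x ∈ e.source := hstr.mem_toOpenPartialHomeomorph_source
  have hself : straighten Φ x x = x := straighten_self hx0
  have hinv : HasFDerivAt e.symm (ContinuousLinearMap.id ℝ (Vec d)) x := by
    have h1 := hstr.to_localInverse.hasFDerivAt
    rw [hself] at h1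
    exact h1
  have hcurve0 : HasDerivAt (fun s : ℝ => x + s • τ) τ 0 := by
    simpa using ((hasDerivAt_id (0 : ℝ)).smul_const τ).const_add x
  -- The inverse chart bends the tangent line into a curve that stays in the boundary and leaves `x`
  -- with velocity `τ`. Both derivatives compute the derivative of `f` along this curve. This
  -- bypasses unique differentiability, since a hypersurface does not determine a derivative in the
  -- normal direction.
  set c : ℝ → Vec d := fun s => e.symm (x + s • τ) with hc
  have hc0 : c 0 = x := by
    have := e.left_inv hxs
    rw [hex, hself] at this
    simpa [hc] using this
  have hcd : HasDerivAt c τ 0 := by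
    have hinv' : HasFDerivAt e.symm (ContinuousLinearMap.id ℝ (Vec d)) (x + (0 : ℝ) • τ) := by
      simpa using hinv
    exact hinv'.comp_hasDerivAt (0 : ℝ) hcurve0
  have hxt : x ∈ e.target := by
    have := e.map_source hxs
    rwa [hex, hself] at this
  have hmem : ∀ᶠ s in 𝓝 (0 : ℝ), c s ∈ frontier Ω := by
    have h1 : ∀ᶠ s in 𝓝 (0 : ℝ), x + s • τ ∈ e.target := by
      refine hcurve0.continuousAt.eventually_mem (e.open_target.mem_nhds ?_)
      simpa using hxt
    filter_upwards [h1] with s hs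
    have h2 := e.right_inv hs
    have h3 := inner_normal_straighten hg (c s)
    rw [← hex, h2, add_sub_cancel_left, inner_smul_right, hτ, mul_zero, eq_comm,
      div_eq_zero_iff] at h3
    rw [hΩ.frontier_eq]
    exact h3.resolve_right (norm_ne_zero_iff.2 hg)
  have hw := hf.differentiableWithinAt.hasFDerivWithinAt (s := frontier Ω)
  have e1 : HasDerivAt (fun s => f (c s)) (fderiv ℝ f x τ) 0 := by
    have : HasFDerivAt f (fderiv ℝ f x) (c 0) := by rw [hc0]; exact hf.hasFDerivAt
    exact this.comp_hasDerivAt (0 : ℝ) hcd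
  have e2 : HasDerivAt (fun s => f (c s)) (fderivWithin ℝ f (frontier Ω) x τ) 0 := by
    have h1 : HasFDerivWithinAt f (fderivWithin ℝ f (frontier Ω) x) (frontier Ω) (c 0) := by
      rw [hc0]; exact hw
    have h2 := h1.comp_hasDerivWithinAt (s := c ⁻¹' frontier Ω) (0 : ℝ) hcd.hasDerivWithinAt
      (mapsTo_preimage _ _)
    exact h2.hasDerivAt hmem
  exact e2.unique e1

/-- Tangential second derivatives of a function integrate to zero over the closed surface. -/
theorem integral_surf_normal_pd_comm (hΩ : IsSmoothDomain Ω Φ) {f : Vec d → ℝ}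
    (hf : ∀ x ∈ frontier Ω, ContDiffAt ℝ 2 f x) (i j : Fin d) :
    ∫ x, (normal Φ x i * pd j f x - normal Φ x j * pd i f x) ∂(surf Ω) = 0 := by
  obtain ⟨F, hF, hFc, hFf⟩ := exists_contDiff_hasCompactSupport_eventuallyEq (n := 2)
    hΩ.isCompact_frontier hf
  have hF' : ∀ k, ∀ x ∈ closure Ω, ContDiffAt ℝ 1 (pd k F) x := fun k x _ =>
    contDiffAt_pd hF.contDiffAt (by norm_num) k
  have hn : ∀ k, ContinuousOn (fun x => normal Φ x k) (frontier Ω) := fun k x hx =>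
    (hΩ.contDiffAt_normal_apply hx k).continuousAt.continuousWithinAt
  have hI : ∀ k l, Integrable (fun x => pd k F x * normal Φ x l) (surf Ω) := fun k l =>
    hΩ.integrable_surf (ContinuousOn.mul (fun x hx =>
      (hF' k x (frontier_subset_closure hx)).continuousAt.continuousWithinAt) (hn l))
  have h1 := hΩ.integral_pd (hF' j) i
  have h2 := hΩ.integral_pd (hF' i) j
  -- Both boundary terms are volume integrals of mixed second derivatives of an extension `F`, and
  -- these commute.
  have h3 : ∫ x in Ω, pd i (pd j F) x = ∫ x in Ω, pd j (pd i F) x :=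
    setIntegral_congr_fun hΩ.isOpen.measurableSet fun x _ => pd_comm hF.contDiffAt i j
  rw [h1, h2] at h3
  have h4 : ∫ x, (normal Φ x i * pd j f x - normal Φ x j * pd i f x) ∂(surf Ω) =
      ∫ x, (pd j F x * normal Φ x i - pd i F x * normal Φ x j) ∂(surf Ω) := by
    rw [surf]
    refine setIntegral_congr_fun isClosed_frontier.measurableSet fun x hx => ?_
    simp only [pd_congr (hFf x hx)]
    ring
  rw [h4, integral_sub (hI j i) (hI i j), h3, sub_self]

/-- The surface divergence theorem on a closed surface, for tangential fields. -/
theorem integral_surf_div_eq_zero (hΩ : IsSmoothDomain Ω Φ) {a : Fin d → Vec d → ℝ}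
    (ha : ∀ j, ∀ x ∈ frontier Ω, ContDiffAt ℝ 2 (a j) x)
    (htan : ∀ x ∈ frontier Ω, ∑ j, a j x * normal Φ x j = 0) :
    ∫ x, (∑ j, fderiv ℝ (a j) x (tang (normal Φ x) (EuclideanSpace.single j 1))) ∂(surf Ω) = 0 := by
  have hn : ∀ k, ∀ x ∈ frontier Ω, ContDiffAt ℝ 2 (fun x => normal Φ x k) x := fun k x hx =>
    (hΩ.contDiffAt_normal_apply hx k).of_le (WithTop.coe_le_coe.2 le_top)
  have hna : ∀ i j, ∀ x ∈ frontier Ω, ContDiffAt ℝ 2 (fun x => normal Φ x i * a j x) x :=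
    fun i j x hx => (hn i x hx).mul (ha j x hx)
  have hcn : ∀ k, ContinuousOn (fun x => normal Φ x k) (frontier Ω) := fun k x hx =>
    (hn k x hx).continuousAt.continuousWithinAt
  have hcna : ∀ i j k, ContinuousOn (fun x => pd k (fun x => normal Φ x i * a j x) x)
      (frontier Ω) := fun i j k x hx =>
    (contDiffAt_pd (m := 1) (hna i j x hx) (by norm_num) k).continuousAt.continuousWithinAt
  -- For a tangential field, `div_S a` is the sum over `i, j` of `(n_i ∂_j - n_j ∂_i)(n_i a_j)`. In
  -- the expansion, derivatives of `n` drop out because `|n| = 1` nearby and `a · n = 0`. Each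
  -- summand integrates to zero by the preceding theorem.
  have hkey : ∫ x, (∑ j, fderiv ℝ (a j) x (tang (normal Φ x) (EuclideanSpace.single j 1)))
      ∂(surf Ω) = ∫ x, (∑ i, ∑ j, (normal Φ x i * pd j (fun x => normal Φ x i * a j x) x
        - normal Φ x j * pd i (fun x => normal Φ x i * a j x) x)) ∂(surf Ω) := by
    rw [surf]
    refine setIntegral_congr_fun isClosed_frontier.measurableSet fun x hx => ?_
    have hdn : ∀ i, DifferentiableAt ℝ (fun y => normal Φ y i) x := fun i =>
      (hn i x hx).differentiableAt two_ne_zero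
    have hda : ∀ j, DifferentiableAt ℝ (a j) x := fun j =>
      (ha j x hx).differentiableAt two_ne_zero
    have h1 := hΩ.sum_normal_sq hx
    have h2 := hΩ.sum_normal_mul_pd_normal hx
    have h3 := htan x hx
    have hl : ∀ j, fderiv ℝ (a j) x (tang (normal Φ x) (EuclideanSpace.single j 1)) =
        pd j (a j) x - ∑ i, normal Φ x i * normal Φ x j * pd i (a j) x := fun j => by
      rw [tang, map_sub, map_smul, fderiv_eq_sum_pd (a j) x (normal Φ x),
        EuclideanSpace.inner_single_left, smul_eq_mul, Finset.mul_sum]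
      congr 1
      refine Finset.sum_congr rfl fun i _ => ?_
      simp
      ring
    simp only [hl]
    have hr : ∀ i j, normal Φ x i * pd j (fun x => normal Φ x i * a j x) x
        - normal Φ x j * pd i (fun x => normal Φ x i * a j x) x =
        a j x * (normal Φ x i * pd j (fun y => normal Φ y i) x)
        + normal Φ x i * normal Φ x i * pd j (a j) x
        - pd i (fun y => normal Φ y i) x * (a j x * normal Φ x j)
        - normal Φ x i * normal Φ x j * pd i (a j) x := fun i j => by
      rw [pd_mul (hdn i) (hda j), pd_mul (hdn i) (hda j)]
      ring
    simp only [hr, Finset.sum_sub_distrib, Finset.sum_add_distrib]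
    have e1 : ∑ i, ∑ j, a j x * (normal Φ x i * pd j (fun y => normal Φ y i) x) = 0 := by
      rw [Finset.sum_comm]
      simp only [← Finset.mul_sum, h2, mul_zero, Finset.sum_const_zero]
    have e2 : ∑ i, ∑ j, normal Φ x i * normal Φ x i * pd j (a j) x = ∑ j, pd j (a j) x := by
      simp only [← Finset.mul_sum]
      rw [← Finset.sum_mul, h1, one_mul]
    have e3 : ∑ i, ∑ j, pd i (fun y => normal Φ y i) x * (a j x * normal Φ x j) = 0 := by
      simp only [← Finset.mul_sum, h3, mul_zero, Finset.sum_const_zero]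
    rw [e1, e2, e3, Finset.sum_comm (f := fun j i => normal Φ x i * normal Φ x j * pd i (a j) x)]
    ring
  rw [hkey, integral_finsetSum]
  · refine Finset.sum_eq_zero fun i _ => ?_
    rw [integral_finsetSum]
    · exact Finset.sum_eq_zero fun j _ => hΩ.integral_surf_normal_pd_comm (hna i j) i j
    · exact fun j _ => hΩ.integrable_surf
        (((hcn i).mul (hcna i j j)).sub ((hcn j).mul (hcna i j i)))
  · exact fun i _ => integrable_finsetSum _ fun j _ => hΩ.integrable_surf
        (((hcn i).mul (hcna i j j)).sub ((hcn j).mul (hcna i j i)))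

end IsSmoothDomain

end SurfaceDivergence

end ThermoMagnet

end

noncomputable section

namespace ThermoMagnet

open scoped NNReal ENNReal

/-! ### Lipschitz test functions by mollification -/

section Mollification

variable {d : ℕ}

/-- Mollification preserves approximation by a linear map. -/
theorem norm_fderiv_convolution_sub_le {w : Vec d → ℝ} (hw : Continuous w)
    (φ : ContDiffBump (0 : Vec d)) {x : Vec d} {r : ℝ} {L : Vec d →L[ℝ] ℝ} {δ : ℝ≥0}
    (happ : ApproximatesLinearOn w L (Metric.ball x (2 * r)) δ) (hr : φ.rOut < r) :
    ‖fderiv ℝ (convolution (φ.normed volume) w (ContinuousLinearMap.lsmul ℝ ℝ) volume) x - L‖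
      ≤ δ := by
  set η := convolution (φ.normed volume) w (ContinuousLinearMap.lsmul ℝ ℝ) volume with hη
  have hηs : ContDiff ℝ 1 η :=
    φ.hasCompactSupport_normed.contDiff_convolution_left _ φ.contDiff_normed
      hw.locallyIntegrable
  have hr0 : 0 < r := φ.rOut_pos.trans hr
  have hd : HasFDerivAt (fun y => η y - L y) (fderiv ℝ η x - L) x :=
    ((hηs.differentiable one_ne_zero) x).hasFDerivAt.sub L.hasFDerivAt
  have hintg : ∀ y, Integrable fun t => φ.normed volume t * w (y - t) := fun y =>
    Continuous.integrable_of_hasCompactSupport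
      (φ.continuous_normed.mul (hw.comp (continuous_const.sub continuous_id)))
      φ.hasCompactSupport_normed.mul_right
  have hint1 : Integrable (φ.normed (volume : Measure (Vec d))) := φ.integrable_normed
  refine hd.le_of_lip' δ.2 ?_
  filter_upwards [Metric.ball_mem_nhds x hr0] with y hy
  have h1 : η y - L y - (η x - L x) =
      ∫ t, φ.normed volume t * (w (y - t) - w (x - t) - L (y - x)) := by
    have e1 : ∀ t, φ.normed volume t * (w (y - t) - w (x - t) - L (y - x)) =
        φ.normed volume t * w (y - t) - φ.normed volume t * w (x - t)
          - φ.normed volume t * L (y - x) := fun t => by ring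
    simp_rw [e1]
    have h12 : Integrable fun t => φ.normed volume t * w (y - t) - φ.normed volume t * w (x - t) :=
      (hintg y).sub (hintg x)
    rw [integral_sub h12 (hint1.mul_const _), integral_sub (hintg y) (hintg x),
      integral_mul_const, φ.integral_normed, map_sub]
    simp only [hη, convolution, ContinuousLinearMap.lsmul_apply, smul_eq_mul]
    ring
  rw [h1]
  calc ‖∫ t, φ.normed volume t * (w (y - t) - w (x - t) - L (y - x))‖
      ≤ ∫ t, φ.normed volume t * (δ * ‖y - x‖) := by
        refine norm_integral_le_of_norm_le (hint1.mul_const _) (Eventually.of_forall fun t => ?_)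
        rw [norm_mul, Real.norm_of_nonneg (φ.nonneg_normed t)]
        by_cases ht : t ∈ Metric.ball (0 : Vec d) φ.rOut
        · refine mul_le_mul_of_nonneg_left ?_ (φ.nonneg_normed t)
          have ht' : ‖t‖ < φ.rOut := by simpa using ht
          have hy' : ‖y - x‖ < r := by simpa [dist_eq_norm] using hy
          have h2 := happ (y - t) ?_ (x - t) ?_
          · rwa [sub_sub_sub_cancel_right] at h2
          · rw [Metric.mem_ball, dist_eq_norm]
            calc ‖y - t - x‖ = ‖(y - x) - t‖ := by congr 1; abel
              _ ≤ ‖y - x‖ + ‖t‖ := norm_sub_le _ _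
              _ < 2 * r := by linarith
          · rw [Metric.mem_ball, dist_eq_norm, sub_sub_cancel_left, norm_neg]
            linarith
        · have : φ.normed (volume : Measure (Vec d)) t = 0 := by
            rw [← Function.notMem_support, φ.support_normed_eq]
            exact ht
          rw [this, zero_mul, zero_mul]
    _ = δ * ‖y - x‖ := by rw [integral_mul_const, φ.integral_normed, one_mul]

theorem approximatesLinearOn_zero_of_lipschitzOnWith {w : Vec d → ℝ} {s : Set (Vec d)} {K : ℝ≥0}
    (h : LipschitzOnWith K w s) : ApproximatesLinearOn w (0 : Vec d →L[ℝ] ℝ) s K := by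
  intro x hx y hy
  have := h.dist_le_mul x hx y hy
  rw [dist_eq_norm, dist_eq_norm] at this
  simpa using this

/-- A sequence of bump functions shrinking to the origin. -/
def shrinkingBump (d n : ℕ) : ContDiffBump (0 : Vec d) where
  rIn := 1 / (2 * ((n : ℝ) + 3))
  -- The 3 keeps every radius below `1/2`, half the radius of the unit balls used below.
  rOut := 1 / ((n : ℝ) + 3)
  rIn_pos := by positivity
  rIn_lt_rOut := one_div_lt_one_div_of_lt (by positivity) (by linarith [n.cast_nonneg (α := ℝ)])

/-- A weak identity extends from smooth to Lipschitz test functions of compact support that are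
`C¹` off a null set. -/
theorem weak_identity_lipschitz {Ω : Set (Vec d)} {G m : Vec d → Vec d}
    (hG : MemLp G 2 volume) (hm : IntegrableOn m Ω)
    (hweak : ∀ η : Vec d → ℝ, ContDiff ℝ ∞ η → HasCompactSupport η →
      ∫ x, fderiv ℝ η x (G x) = ∫ x in Ω, fderiv ℝ η x (m x))
    {w : Vec d → ℝ} (hw : Continuous w) (hwc : HasCompactSupport w)
    (hlip : LocallyLipschitz w) (hae : ∀ᵐ x, ContDiffAt ℝ 1 w x) :
    ∫ x, fderiv ℝ w x (G x) = ∫ x in Ω, fderiv ℝ w x (m x) := by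
  obtain ⟨R, hR⟩ := hwc.isCompact.isBounded.subset_closedBall 0
  obtain ⟨K, hK⟩ := LocallyLipschitzOn.exists_lipschitzOnWith_of_compact
    (isCompact_closedBall (0 : Vec d) (R + 2)) hlip.locallyLipschitzOn
  -- The radius `2 * (1/2)` is one, in the form demanded by the mollification bound. A unit ball
  -- centred outside radius `R + 1` misses the support, and one centred inside lies within radius `R
  -- + 2`, where `w` has Lipschitz constant `K`. The mollified gradients thus share a bound and a
  -- compact support.
  have hzero : ∀ x ∉ Metric.closedBall (0 : Vec d) (R + 1),
      ApproximatesLinearOn w (0 : Vec d →L[ℝ] ℝ) (Metric.ball x (2 * (1 / 2))) 0 := fun x hx => by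
    have h0 : ∀ y ∈ Metric.ball x (2 * (1 / 2)), w y = 0 := fun y hy => by
      refine image_eq_zero_of_notMem_tsupport fun hy' => hx ?_
      have h1 := hR hy'
      rw [mem_closedBall_zero_iff] at h1 ⊢
      rw [Metric.mem_ball, dist_eq_norm] at hy
      have := norm_sub_le y (y - x)
      rw [sub_sub_cancel] at this
      linarith
    intro y hy z hz
    simp [h0 y hy, h0 z hz]
  have hball : ∀ x, ApproximatesLinearOn w (0 : Vec d →L[ℝ] ℝ) (Metric.ball x (2 * (1 / 2))) K :=
    fun x => by
    by_cases hx : x ∈ Metric.closedBall (0 : Vec d) (R + 1)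
    · refine approximatesLinearOn_zero_of_lipschitzOnWith (hK.mono fun y hy => ?_)
      rw [mem_closedBall_zero_iff] at hx ⊢
      rw [Metric.mem_ball, dist_eq_norm] at hy
      have := norm_add_le x (y - x)
      rw [add_sub_cancel] at this
      linarith
    · exact (hzero x hx).mono_num bot_le
  set η : ℕ → Vec d → ℝ := fun n => convolution ((shrinkingBump d n).normed volume) w
    (ContinuousLinearMap.lsmul ℝ ℝ) volume with hη
  have hrOut : ∀ n : ℕ, (shrinkingBump d n).rOut < 1 / 2 := fun n =>
    one_div_lt_one_div_of_lt two_pos (by linarith [n.cast_nonneg (α := ℝ)])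
  have hrlim : Tendsto (fun n : ℕ => (shrinkingBump d n).rOut) atTop (𝓝 0) := by
    have : Tendsto (fun n : ℕ => (n : ℝ) + 3) atTop atTop :=
      tendsto_atTop_add_const_right _ _ tendsto_natCast_atTop_atTop
    exact (tendsto_inv_atTop_zero.comp this).congr fun n => (one_div _).symm
  have hηs : ∀ n, ContDiff ℝ ∞ (η n) := fun n =>
    (shrinkingBump d n).hasCompactSupport_normed.contDiff_convolution_left _
      (shrinkingBump d n).contDiff_normed hw.locallyIntegrable
  have hηc : ∀ n, HasCompactSupport (η n) := fun n =>
    (shrinkingBump d n).hasCompactSupport_normed.convolution _ hwc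
  have hbd : ∀ n x, ‖fderiv ℝ (η n) x‖ ≤ K := fun n x => by
    simpa using norm_fderiv_convolution_sub_le hw (shrinkingBump d n) (hball x) (hrOut n)
  have hvan : ∀ n, ∀ x ∉ Metric.closedBall (0 : Vec d) (R + 1), fderiv ℝ (η n) x = 0 :=
    fun n x hx => by
    simpa using norm_fderiv_convolution_sub_le hw (shrinkingBump d n) (hzero x hx) (hrOut n)
  -- At a point of class `C¹` the derivative is strict, so `w` is as close to linear as desired on a
  -- small ball, and mollification preserves this.
  have hpt : ∀ᵐ x, Tendsto (fun n => fderiv ℝ (η n) x) atTop (𝓝 (fderiv ℝ w x)) := by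
    filter_upwards [hae] with x hx
    have hs : HasStrictFDerivAt w (fderiv ℝ w x) x := hx.hasStrictFDerivAt one_ne_zero
    rw [Metric.tendsto_nhds]
    intro δ hδ
    obtain ⟨s, hs, happ⟩ := hs.approximates_deriv_on_nhds (c := (δ / 2).toNNReal)
      (Or.inr (Real.toNNReal_pos.2 (half_pos hδ)))
    obtain ⟨r, hr, hrs⟩ := Metric.mem_nhds_iff.1 hs
    filter_upwards [hrlim.eventually_lt_const (half_pos hr)] with n hn
    rw [dist_eq_norm]
    have h1 := norm_fderiv_convolution_sub_le hw (shrinkingBump d n) (r := r / 2)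
      (L := fderiv ℝ w x) (δ := (δ / 2).toNNReal)
      (by rw [mul_div_cancel₀ _ two_ne_zero]; exact happ.mono_set hrs) hn
    rw [Real.coe_toNNReal _ (half_pos hδ).le] at h1
    exact h1.trans_lt (half_lt_self hδ)
  have hfc : ∀ n, Continuous (fderiv ℝ (η n)) := fun n =>
    (hηs n).continuous_fderiv (by simp)
  have hleft : Tendsto (fun n => ∫ x, fderiv ℝ (η n) x (G x)) atTop
      (𝓝 (∫ x, fderiv ℝ w x (G x))) := by
    refine tendsto_integral_of_dominated_convergence
      ((Metric.closedBall (0 : Vec d) (R + 1)).indicator fun x => K * ‖G x‖) ?_ ?_ ?_ ?_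
    · exact fun n => (ContinuousLinearMap.apply ℝ ℝ).flip.aestronglyMeasurable_comp₂
        (hfc n).aestronglyMeasurable hG.1
    · rw [integrable_indicator_iff measurableSet_closedBall]
      refine Integrable.const_mul (Integrable.norm ?_) _
      have : IsFiniteMeasure ((volume : Measure (Vec d)).restrict
          (Metric.closedBall (0 : Vec d) (R + 1))) :=
        ⟨by rw [Measure.restrict_apply_univ]; exact measure_closedBall_lt_top⟩
      exact (hG.restrict _).integrable one_le_two
    · refine fun n => Eventually.of_forall fun x => ?_
      by_cases hx : x ∈ Metric.closedBall (0 : Vec d) (R + 1)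
      · rw [indicator_of_mem hx]
        exact (ContinuousLinearMap.le_opNorm _ _).trans
          (mul_le_mul_of_nonneg_right (hbd n x) (norm_nonneg _))
      · rw [indicator_of_notMem hx, hvan n x hx]
        simp
    · filter_upwards [hpt] with x hx
      exact ((ContinuousLinearMap.apply ℝ ℝ (G x)).continuous.tendsto _).comp hx
  have hright : Tendsto (fun n => ∫ x in Ω, fderiv ℝ (η n) x (m x)) atTop
      (𝓝 (∫ x in Ω, fderiv ℝ w x (m x))) := by
    refine tendsto_integral_of_dominated_convergence (fun x => K * ‖m x‖) ?_
      (hm.norm.const_mul _) ?_ ?_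
    · exact fun n => (ContinuousLinearMap.apply ℝ ℝ).flip.aestronglyMeasurable_comp₂
        (hfc n).aestronglyMeasurable hm.1
    · exact fun n => Eventually.of_forall fun x => (ContinuousLinearMap.le_opNorm _ _).trans
          (mul_le_mul_of_nonneg_right (hbd n x) (norm_nonneg _))
    · filter_upwards [ae_restrict_of_ae hpt] with x hx
      exact ((ContinuousLinearMap.apply ℝ ℝ (m x)).continuous.tendsto _).comp hx
  refine tendsto_nhds_unique hleft (hright.congr fun n => ?_)
  exact (hweak _ (hηs n) (hηc n)).symm

/-- The derivative of a function vanishes almost everywhere on its zero set. -/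
theorem ae_fderiv_eq_zero_of_zero {f : Vec d → ℝ} (hf : Measurable f) :
    ∀ᵐ x, f x = 0 → DifferentiableAt ℝ f x → fderiv ℝ f x = 0 := by
  rcases d with _ | d
  · exact Eventually.of_forall fun x _ _ => Subsingleton.elim _ _
  set D : Set (Vec (d + 1)) := {x | DifferentiableAt ℝ f x} with hD
  have hDm : MeasurableSet D := measurableSet_of_differentiableAt ℝ f
  set S : Set (Vec (d + 1)) := {x | f x = 0} ∩ D with hS
  have hSm : MeasurableSet S := (hf (measurableSet_singleton 0)).inter hDm
  set e : Vec (d + 1) := EuclideanSpace.single 0 1 with he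
  have he0 : e ≠ 0 := fun h => by simpa [he] using congrArg (fun v => v 0) h
  -- On the zero set `f` coincides with the zero map, and at almost every point of a measurable set
  -- a derivative is determined by the restriction to that set (density points). The lemma used
  -- concerns endomorphisms, so `f` is multiplied by a fixed nonzero vector; this is why dimension
  -- zero is treated apart.
  have happ : ApproximatesLinearOn (fun x => f x • e) (0 : Vec (d + 1) →L[ℝ] Vec (d + 1)) S 0 := by
    intro x hx y hy
    have hx0 : f x = 0 := hx.1
    have hy0 : f y = 0 := hy.1
    simp [hx0, hy0]
  have h1 := happ.norm_fderiv_sub_le volume hSm (fun x => (fderiv ℝ f x).smulRight e)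
    (fun x hx => (DifferentiableAt.hasFDerivAt hx.2).smul_const e |>.hasFDerivWithinAt)
  rw [ae_restrict_iff' hSm] at h1
  filter_upwards [h1] with x hx h0 hd
  have h2 := hx ⟨h0, hd⟩
  rw [sub_zero, nonpos_iff_eq_zero, nnnorm_eq_zero] at h2
  ext v
  have h3 := congrArg (fun A : Vec (d + 1) →L[ℝ] Vec (d + 1) => A v) h2
  simpa [he0] using h3

/-- On the zero set the derivative of `Φ` vanishes almost everywhere, yet it vanishes nowhere there
by regularity; hence the set is null. -/
theorem ae_notMem_level {Φ : Vec d → ℝ} (hΦ : ContDiff ℝ 1 Φ)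
    (hreg : ∀ x, Φ x = 0 → gradient Φ x ≠ 0) : ∀ᵐ x, Φ x ≠ 0 := by
  filter_upwards [ae_fderiv_eq_zero_of_zero hΦ.continuous.measurable] with x hx h0
  have h1 := hx h0 (hΦ.differentiable one_ne_zero x)
  exact hreg x h0 (by rw [gradient, h1, map_zero])

end Mollification

end ThermoMagnet

end

noncomputable section

namespace ThermoMagnet

open scoped NNReal ENNReal

/-! ### The potential as a test function -/

section Potential

variable {d : ℕ}

/-- A smooth function that vanishes near `0` and is the identity away from `0`. -/
def cutZero (r : ℝ) : ℝ := r - r * (⟨1, 2, one_pos, one_lt_two⟩ : ContDiffBump (0 : ℝ)) r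

theorem contDiff_cutZero : ContDiff ℝ 1 cutZero :=
  contDiff_id.sub (contDiff_id.mul (ContDiffBump.contDiff _))

theorem cutZero_eq_zero {r : ℝ} (h : |r| ≤ 1) : cutZero r = 0 := by
  rw [cutZero, ContDiffBump.one_of_mem_closedBall, mul_one, sub_self]
  simpa using h

theorem deriv_cutZero_of_lt {r : ℝ} (h : 2 < |r|) : deriv cutZero r = 1 := by
  have : cutZero =ᶠ[𝓝 r] id := by
    filter_upwards [continuous_abs.continuousAt.eventually_const_lt h] with s hs
    rw [cutZero, ContDiffBump.zero_of_le_dist, mul_zero, sub_zero, id]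
    simpa using hs.le
  rw [this.deriv_eq, deriv_id]

theorem exists_bound_deriv_cutZero : ∃ B, ∀ r, |deriv cutZero r| ≤ B := by
  have hc : Continuous (deriv cutZero) := contDiff_cutZero.continuous_deriv le_rfl
  obtain ⟨B, hB⟩ := (isCompact_Icc (a := (-2 : ℝ)) (b := 2)).exists_bound_of_continuousOn
    hc.continuousOn
  refine ⟨max B 1, fun r => ?_⟩
  by_cases hr : |r| ≤ 2
  · exact (hB r (abs_le.1 hr)).trans (le_max_left _ _)
  · rw [deriv_cutZero_of_lt (not_le.1 hr), abs_one]
    exact le_max_right _ _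

/-- A weak identity extends from smooth compactly supported test functions to potentials of finite
energy that vanish at infinity. -/
theorem weak_identity_potential {Ω : Set (Vec d)} {G m : Vec d → Vec d}
    (hG : MemLp G 2 volume) (hm : IntegrableOn m Ω)
    (hweak : ∀ η : Vec d → ℝ, ContDiff ℝ ∞ η → HasCompactSupport η →
      ∫ x, fderiv ℝ η x (G x) = ∫ x in Ω, fderiv ℝ η x (m x))
    {u : Vec d → ℝ} (hu : Continuous u) (hlip : LocallyLipschitz u)
    (hae : ∀ᵐ x, ContDiffAt ℝ 1 u x) (h0 : Tendsto u (cocompact (Vec d)) (𝓝 0))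
    (hGu : MemLp (gradient u) 2 volume)
    (hmu : IntegrableOn (fun x => ‖gradient u x‖ * ‖m x‖) Ω) :
    ∫ x, fderiv ℝ u x (G x) = ∫ x in Ω, fderiv ℝ u x (m x) := by
  obtain ⟨B, hB⟩ := exists_bound_deriv_cutZero
  set ε : ℕ → ℝ := fun n => 1 / ((n : ℝ) + 1) with hε
  have hε0 : ∀ n, 0 < ε n := fun n => by positivity
  have hεl : Tendsto ε atTop (𝓝 0) := tendsto_one_div_add_atTop_nhds_zero_nat
  -- Truncating the values of `u` below the threshold `ε n` yields compact support since `u`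
  -- vanishes at infinity. Truncating values instead of space keeps the gradient bounded by a
  -- multiple of `|∇u|`, and no decay rate of `u` is needed.
  set w : ℕ → Vec d → ℝ := fun n x => ε n * cutZero ((ε n)⁻¹ * u x) with hwdef
  have hwc : ∀ n, HasCompactSupport (w n) := fun n => by
    have h1 : ∀ᶠ x in cocompact (Vec d), |u x| < ε n := by
      have := h0.eventually (Metric.ball_mem_nhds (0 : ℝ) (hε0 n))
      filter_upwards [this] with x hx
      simpa using hx
    obtain ⟨S, hS, hSu⟩ := mem_cocompact.1 h1
    refine HasCompactSupport.intro hS fun x hx => ?_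
    have h2 : |u x| < ε n := hSu hx
    simp only [hwdef]
    rw [cutZero_eq_zero, mul_zero]
    rw [abs_mul, abs_of_pos (inv_pos.2 (hε0 n)), inv_mul_le_iff₀ (hε0 n), mul_one]
    exact h2.le
  have hφ : ∀ n, ContDiff ℝ 1 fun r : ℝ => ε n * cutZero ((ε n)⁻¹ * r) := fun n =>
    contDiff_const.mul (contDiff_cutZero.comp (contDiff_const.mul contDiff_id))
  have hwcont : ∀ n, Continuous (w n) := fun n => (hφ n).continuous.comp hu
  have hwlip : ∀ n, LocallyLipschitz (w n) := fun n => (hφ n).locallyLipschitz.comp hlip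
  have hwae : ∀ n, ∀ᵐ x, ContDiffAt ℝ 1 (w n) x := fun n => by
    filter_upwards [hae] with x hx
    exact (hφ n).contDiffAt.comp x hx
  have hder : ∀ᵐ x, ∀ n, fderiv ℝ (w n) x = deriv cutZero ((ε n)⁻¹ * u x) • fderiv ℝ u x := by
    filter_upwards [hae] with x hx n
    have h1 := (hx.differentiableAt one_ne_zero).hasFDerivAt.const_mul (ε n)⁻¹
    have h2 := (contDiff_cutZero.differentiable one_ne_zero ((ε n)⁻¹ * u x)).hasDerivAt
    have h3 := (h2.comp_hasFDerivAt x h1).const_mul (ε n)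
    have h4 : HasFDerivAt (w n) _ x := h3
    rw [h4.fderiv]
    ext v
    simp only [smul_apply, smul_eq_mul]
    have h5 := mul_inv_cancel₀ (hε0 n).ne'
    linear_combination (deriv cutZero ((ε n)⁻¹ * u x) * fderiv ℝ u x v) * h5
  -- Where `u ≠ 0` the truncation is eventually inactive, having derivative one beyond twice the
  -- threshold. Where `u = 0` the gradient of `u` vanishes almost everywhere, and with it that of
  -- every `w n`.
  have hlim : ∀ᵐ x, ∀ v, Tendsto (fun n => fderiv ℝ (w n) x v) atTop (𝓝 (fderiv ℝ u x v)) := by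
    filter_upwards [hae, hder, ae_fderiv_eq_zero_of_zero hu.measurable] with x hx hx1 hx2 v
    by_cases hux : u x = 0
    · have h1 : fderiv ℝ u x = 0 := hx2 hux (hx.differentiableAt one_ne_zero)
      simp only [hx1, h1, smul_zero]
      exact tendsto_const_nhds
    · refine tendsto_const_nhds.congr' ?_
      have h2 : 0 < |u x| := abs_pos.2 hux
      filter_upwards [hεl.eventually_lt_const (half_pos h2)] with n hn
      rw [hx1, deriv_cutZero_of_lt, one_smul]
      rw [abs_mul, abs_of_pos (inv_pos.2 (hε0 n)), lt_inv_mul_iff₀ (hε0 n)]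
      linarith
  have hbd : ∀ᵐ x, ∀ n v, ‖fderiv ℝ (w n) x v‖ ≤ B * (‖gradient u x‖ * ‖v‖) := by
    filter_upwards [hder] with x hx n v
    rw [hx, smul_apply, smul_eq_mul, norm_mul, ← inner_gradient_left]
    exact mul_le_mul (hB _) (norm_inner_le_norm _ _) (norm_nonneg _)
      ((abs_nonneg _).trans (hB 0))
  have hwf : ∀ n, Measurable (fderiv ℝ (w n)) := fun n => measurable_fderiv ℝ (w n)
  have hleft : Tendsto (fun n => ∫ x, fderiv ℝ (w n) x (G x)) atTop
      (𝓝 (∫ x, fderiv ℝ u x (G x))) := by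
    refine tendsto_integral_of_dominated_convergence
      (fun x => B * (‖gradient u x‖ * ‖G x‖)) ?_ ?_ ?_ ?_
    · exact fun n => (ContinuousLinearMap.apply ℝ ℝ).flip.aestronglyMeasurable_comp₂
        (hwf n).aestronglyMeasurable hG.1
    · exact (hGu.norm.integrable_mul hG.norm).const_mul _
    · intro n
      filter_upwards [hbd] with x hx
      exact hx n _
    · filter_upwards [hlim] with x hx
      exact hx _
  have hright : Tendsto (fun n => ∫ x in Ω, fderiv ℝ (w n) x (m x)) atTop
      (𝓝 (∫ x in Ω, fderiv ℝ u x (m x))) := by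
    refine tendsto_integral_of_dominated_convergence
      (fun x => B * (‖gradient u x‖ * ‖m x‖)) ?_ (hmu.const_mul _) ?_ ?_
    · exact fun n => (ContinuousLinearMap.apply ℝ ℝ).flip.aestronglyMeasurable_comp₂
        (hwf n).aestronglyMeasurable hm.1
    · intro n
      filter_upwards [ae_restrict_of_ae hbd] with x hx
      exact hx n _
    · filter_upwards [ae_restrict_of_ae hlim] with x hx
      exact hx _
  refine tendsto_nhds_unique hleft (hright.congr fun n => ?_)
  exact (weak_identity_lipschitz hG hm hweak (hwcont n) (hwc n) (hwlip n) (hwae n)).symm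

theorem lipschitzOnWith_of_eventuallyEq_contDiffAt {u a : Vec d → ℝ} {x : Vec d}
    (ha : ContDiffAt ℝ 1 a x) (h : u =ᶠ[𝓝 x] a) : ∃ K : ℝ≥0, ∃ t ∈ 𝓝 x, LipschitzOnWith K u t := by
  obtain ⟨K, t, ht, hK⟩ := ha.exists_lipschitzOnWith
  refine ⟨K, t ∩ {y | u y = a y}, inter_mem ht h, fun y hy z hz => ?_⟩
  rw [show u y = a y from hy.2, show u z = a z from hz.2]
  exact hK hy.1 hz.1

/-- A function that is `C¹` on both sides of a closed interface and continuous across it is locally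
Lipschitz. -/
theorem locallyLipschitz_of_two_sided {Ω : Set (Vec d)} (hΩ : IsOpen Ω) {u a b : Vec d → ℝ}
    (ha : ∀ x ∈ closure Ω, ContDiffAt ℝ 1 a x) (hb : ∀ x ∈ Ωᶜ, ContDiffAt ℝ 1 b x)
    (hua : ∀ x ∈ closure Ω, u x = a x) (hub : ∀ x ∈ Ωᶜ, u x = b x) : LocallyLipschitz u := by
  intro x
  by_cases hx : x ∈ Ω
  · refine lipschitzOnWith_of_eventuallyEq_contDiffAt (ha x (subset_closure hx)) ?_
    filter_upwards [hΩ.mem_nhds hx] with y hy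
    exact hua y (subset_closure hy)
  by_cases hx' : x ∈ closure Ω
  swap
  · refine lipschitzOnWith_of_eventuallyEq_contDiffAt (hb x hx) ?_
    filter_upwards [isClosed_closure.isOpen_compl.mem_nhds hx'] with y hy
    exact hub y fun h => hy (subset_closure h)
  obtain ⟨K₁, t₁, ht₁, hK₁⟩ := (ha x hx').exists_lipschitzOnWith
  obtain ⟨K₂, t₂, ht₂, hK₂⟩ := (hb x hx).exists_lipschitzOnWith
  obtain ⟨r, hr, hrt⟩ := Metric.mem_nhds_iff.1 (inter_mem ht₁ ht₂)
  have hA : ∀ y ∈ Metric.ball x r, ∀ z ∈ Metric.ball x r, y ∈ closure Ω → z ∈ closure Ω →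
      dist (u y) (u z) ≤ max K₁ K₂ * dist y z := fun y hy z hz hyc hzc => by
    rw [hua y hyc, hua z hzc]
    exact (hK₁.dist_le_mul y (hrt hy).1 z (hrt hz).1).trans
      (mul_le_mul_of_nonneg_right (le_max_left _ _) dist_nonneg)
  have hB : ∀ y ∈ Metric.ball x r, ∀ z ∈ Metric.ball x r, y ∉ Ω → z ∉ Ω →
      dist (u y) (u z) ≤ max K₁ K₂ * dist y z := fun y hy z hz hyc hzc => by
    rw [hub y hyc, hub z hzc]
    exact (hK₂.dist_le_mul y (hrt hy).2 z (hrt hz).2).trans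
      (mul_le_mul_of_nonneg_right (le_max_right _ _) dist_nonneg)
  have hAB : ∀ y ∈ Metric.ball x r, ∀ z ∈ Metric.ball x r, y ∈ Ω → z ∉ Ω →
      dist (u y) (u z) ≤ max K₁ K₂ * dist y z := fun y hy z hz hyc hzc => by
    -- A segment joining the two sides meets the interface by connectedness. There both one-sided
    -- bounds are available, and distances add up along the segment, so the constant does not
    -- double.
    obtain ⟨p, hp, hpf⟩ : ∃ p ∈ segment ℝ y z, p ∈ frontier Ω := by
      by_contra! hcon
      have hzc' : z ∉ closure Ω := fun h => hcon z (right_mem_segment ℝ y z) (by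
        rw [hΩ.frontier_eq]; exact ⟨h, hzc⟩)
      obtain ⟨q, -, hq, hq'⟩ := (convex_segment (𝕜 := ℝ) y z).isPreconnected Ω (closure Ω)ᶜ hΩ
        isClosed_closure.isOpen_compl (fun q hq => by
          by_cases hqΩ : q ∈ Ω
          · exact Or.inl hqΩ
          · exact Or.inr fun h => hcon q hq (by rw [hΩ.frontier_eq]; exact ⟨h, hqΩ⟩))
        ⟨y, left_mem_segment ℝ y z, hyc⟩ ⟨z, right_mem_segment ℝ y z, hzc'⟩
      exact hq' (subset_closure hq)
    have hpb : p ∈ Metric.ball x r := (convex_ball x r).segment_subset hy hz hp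
    have hpΩ : p ∉ Ω := by
      rw [hΩ.frontier_eq] at hpf
      exact hpf.2
    calc dist (u y) (u z) ≤ dist (u y) (u p) + dist (u p) (u z) := dist_triangle _ _ _
      _ ≤ max K₁ K₂ * dist y p + max K₁ K₂ * dist p z :=
        add_le_add (hA y hy p hpb (subset_closure hyc) (frontier_subset_closure hpf))
          (hB p hpb z hz hpΩ hzc)
      _ = max K₁ K₂ * dist y z := by
        rw [← mul_add, dist_add_dist_of_mem_segment hp]
  refine ⟨max K₁ K₂, Metric.ball x r, Metric.ball_mem_nhds x hr,
    LipschitzOnWith.of_dist_le_mul fun y hy z hz => ?_⟩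
  rw [NNReal.coe_max]
  by_cases hyc : y ∈ Ω <;> by_cases hzc : z ∈ Ω
  · exact hA y hy z hz (subset_closure hyc) (subset_closure hzc)
  · exact hAB y hy z hz hyc hzc
  · rw [dist_comm, dist_comm y]
    exact hAB z hz y hy hzc hyc
  · exact hB y hy z hz hyc hzc

end Potential

/-! ### Reciprocity and energy of the demagnetizing field -/

section MagnetostaticEnergy

variable {d : ℕ} {T : ℝ} {Ω : Set (Vec d)} {Φ : Vec d → ℝ} {M : Material d} {L : Loads d}
  {S : State d}

/-- Joint regularity at a point from regularity up to the boundary. -/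
theorem SmoothUpTo.contDiffAt {X : Type*} [NormedAddCommGroup X] [NormedSpace ℝ X]
    {n : WithTop ℕ∞} {f : ℝ → Vec d → X} (h : SmoothUpTo n T Ω f) {t : ℝ} (ht : t ∈ Ioo 0 T)
    {x : Vec d} (hx : x ∈ closure Ω) : ContDiffAt ℝ n (fun q : ℝ × Vec d => f q.1 q.2) (t, x) := by
  obtain ⟨U, hU, hsub, hf⟩ := h
  exact hf.contDiffAt (hU.mem_nhds (hsub ⟨ht, hx⟩))

theorem SmoothUpTo.contDiffAt_space {X : Type*} [NormedAddCommGroup X] [NormedSpace ℝ X]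
    {n : WithTop ℕ∞} {f : ℝ → Vec d → X} (h : SmoothUpTo n T Ω f) {t : ℝ} (ht : t ∈ Ioo 0 T)
    {x : Vec d} (hx : x ∈ closure Ω) : ContDiffAt ℝ n (f t) x :=
  (h.contDiffAt ht hx).comp x (contDiffAt_const.prodMk contDiffAt_id)

theorem SmoothNear.contDiffAt {X : Type*} [NormedAddCommGroup X] [NormedSpace ℝ X]
    {n : WithTop ℕ∞} {A : Set (Vec d)} {f : Vec d → X} (h : SmoothNear n A f)
    {x : Vec d} (hx : x ∈ A) : ContDiffAt ℝ n f x := by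
  obtain ⟨U, hU, hsub, hf⟩ := h
  exact hf.contDiffAt (hU.mem_nhds (hsub hx))

theorem gradient_u_eq (hS : IsSmoothState T Ω M S) (hΩ : IsOpen Ω) {t : ℝ} (ht : t ∈ Ioo 0 T)
    {x : Vec d} (hx : x ∈ Ω) : gradient (S.u t) x = gradient (S.uΩ t) x := by
  have h : S.u t =ᶠ[𝓝 x] S.uΩ t := by
    filter_upwards [hΩ.mem_nhds hx] with y hy
    exact hS.u_eq t ht y (subset_closure hy)
  rw [gradient, gradient, h.fderiv_eq]

/-- Testing the potential equation at one time with the potential at another time. -/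
theorem integral_inner_gradient_u (hΩ : IsSmoothDomain Ω Φ)
    (hS : IsSmoothSolution T Ω Φ M L S) {s t : ℝ} (hs : s ∈ Ioo 0 T) (ht : t ∈ Ioo 0 T) :
    ∫ x, ⟪gradient (S.u t) x, gradient (S.u s) x⟫ =
      ∫ x in Ω, ⟪S.m t x, gradient (S.uΩ s) x⟫ := by
  have hsm := hS.smooth
  have hone : (1 : WithTop ℕ∞) ≤ (⊤ : ℕ∞) := WithTop.coe_le_coe.2 le_top
  obtain ⟨b, hb, hub⟩ := hsm.u_ext s hs
  have ha : ∀ x ∈ closure Ω, ContDiffAt ℝ 1 (S.uΩ s) x := fun x hx =>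
    (hsm.uΩ_smooth.contDiffAt_space hs hx).of_le hone
  have hb' : ∀ x ∈ Ωᶜ, ContDiffAt ℝ 1 b x := fun x hx => (hb.contDiffAt hx).of_le hone
  have hlip := locallyLipschitz_of_two_sided hΩ.isOpen ha hb' (hsm.u_eq s hs) hub
  have hae : ∀ᵐ x, ContDiffAt ℝ 1 (S.u s) x := by
    filter_upwards [ae_notMem_level hΩ.contDiff_one hΩ.regular] with x hx
    by_cases hxΩ : x ∈ Ω
    · refine (ha x (subset_closure hxΩ)).congr_of_eventuallyEq ?_
      filter_upwards [hΩ.isOpen.mem_nhds hxΩ] with y hy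
      exact hsm.u_eq s hs y (subset_closure hy)
    · refine (hb' x hxΩ).congr_of_eventuallyEq ?_
      have hxc : x ∉ closure Ω := fun h => hx (by
        have : x ∈ frontier Ω := by rw [hΩ.isOpen.frontier_eq]; exact ⟨h, hxΩ⟩
        rwa [hΩ.frontier_eq] at this)
      filter_upwards [isClosed_closure.isOpen_compl.mem_nhds hxc] with y hy
      exact hub y fun h => hy (subset_closure h)
  have hmc : ContinuousOn (S.m t) (closure Ω) := fun x hx =>
    (hsm.m_smooth.contDiffAt_space ht hx).continuousAt.continuousWithinAt
  have hgc : ContinuousOn (gradient (S.uΩ s)) (closure Ω) := fun x hx =>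
    ((InnerProductSpace.toDual ℝ (Vec d)).symm.continuous.continuousAt.comp
      ((ha x hx).fderiv_right (m := 0) (by simp)).continuousAt).continuousWithinAt
  have hmi : IntegrableOn (S.m t) Ω :=
    (hmc.integrableOn_compact hΩ.isCompact_closure).mono_set subset_closure
  have hmu : IntegrableOn (fun x => ‖gradient (S.u s) x‖ * ‖S.m t x‖) Ω := by
    refine IntegrableOn.congr_fun (f := fun x => ‖gradient (S.uΩ s) x‖ * ‖S.m t x‖)
      (((hgc.norm.mul hmc.norm).integrableOn_compact hΩ.isCompact_closure).mono_set
        subset_closure) (fun x hx => ?_) hΩ.isOpen.measurableSet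
    simp only [gradient_u_eq hsm hΩ.isOpen hs hx]
  have hpt := hS.potential t ht
  have hps := hS.potential s hs
  have h1 := weak_identity_potential (Ω := Ω) (G := fun x => gradient (S.u t) x) (m := S.m t)
    hpt.finite_energy hmi (fun η hη hηc => by
      have := hpt.weak η hη hηc
      simpa only [inner_gradient_right, conj_trivial] using this)
    (hsm.u_cont s hs) hlip hae hps.vanishing hps.finite_energy hmu
  have h2 : ∫ x, ⟪gradient (S.u t) x, gradient (S.u s) x⟫ =
      ∫ x, fderiv ℝ (S.u s) x (gradient (S.u t) x) := by
    refine integral_congr_ae (Eventually.of_forall fun x => ?_)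
    simp only
    rw [inner_gradient_right, conj_trivial]
  rw [h2, h1]
  refine setIntegral_congr_fun hΩ.isOpen.measurableSet fun x hx => ?_
  rw [← gradient_u_eq hsm hΩ.isOpen hs hx, inner_gradient_right, conj_trivial]

/-- Symmetry of the solution operator: both sides equal the whole-space product of the two
gradients, which is symmetric in the two times. -/
theorem integral_m_gradient_u_comm (hΩ : IsSmoothDomain Ω Φ)
    (hS : IsSmoothSolution T Ω Φ M L S) {s t : ℝ} (hs : s ∈ Ioo 0 T) (ht : t ∈ Ioo 0 T) :
    ∫ x in Ω, ⟪S.m t x, gradient (S.uΩ s) x⟫ = ∫ x in Ω, ⟪S.m s x, gradient (S.uΩ t) x⟫ := by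
  rw [← integral_inner_gradient_u hΩ hS hs ht, ← integral_inner_gradient_u hΩ hS ht hs]
  exact integral_congr_ae (Eventually.of_forall fun x => real_inner_comm _ _)

/-- The potential equation tested with its own solution. This moves the field energy of the whole
space into the body, where differentiation in time is elementary. -/
theorem integral_demagnetizing (hΩ : IsSmoothDomain Ω Φ)
    (hS : IsSmoothSolution T Ω Φ M L S) {t : ℝ} (ht : t ∈ Ioo 0 T) :
    ∫ x, M.μ₀ / 2 * ‖gradient (S.u t) x‖ ^ 2 =
      M.μ₀ / 2 * ∫ x in Ω, ⟪S.m t x, gradient (S.uΩ t) x⟫ := by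
  rw [← integral_inner_gradient_u hΩ hS ht ht, integral_const_mul]
  simp only [real_inner_self_eq_norm_sq]

theorem integrable_demagnetizing (hS : IsSmoothSolution T Ω Φ M L S) {t : ℝ} (ht : t ∈ Ioo 0 T) :
    Integrable fun x => M.μ₀ / 2 * ‖gradient (S.u t) x‖ ^ 2 :=
  (hS.potential t ht).finite_energy.integrable_norm_pow two_ne_zero |>.const_mul _

end MagnetostaticEnergy

end ThermoMagnet

end

noncomputable section

namespace ThermoMagnet

/-! ### Calculus in space-time -/

section Joint

variable {d : ℕ}

/-- A time-dependent field as a function on space-time. -/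
abbrev joint {X : Type*} (f : ℝ → Vec d → X) : ℝ × Vec d → X := fun q => f q.1 q.2

variable {f : ℝ → Vec d → ℝ} {t : ℝ} {x : Vec d} {n m : WithTop ℕ∞}

theorem contDiffAt_space_of_joint {X : Type*} [NormedAddCommGroup X] [NormedSpace ℝ X]
    {f : ℝ → Vec d → X} (h : ContDiffAt ℝ n (joint f) (t, x)) : ContDiffAt ℝ n (f t) x :=
  h.comp x (contDiffAt_const.prodMk contDiffAt_id)

theorem contDiffAt_time_of_joint {X : Type*} [NormedAddCommGroup X] [NormedSpace ℝ X]
    {f : ℝ → Vec d → X} (h : ContDiffAt ℝ n (joint f) (t, x)) :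
    ContDiffAt ℝ n (fun s => f s x) t :=
  h.comp t (contDiffAt_id.prodMk contDiffAt_const)

theorem pd_eq_fderiv_joint (h : DifferentiableAt ℝ (joint f) (t, x)) (j : Fin d) :
    pd j (f t) x = fderiv ℝ (joint f) (t, x) (0, EuclideanSpace.single j 1) := by
  have h1 : HasFDerivAt (fun y : Vec d => (t, y))
      (ContinuousLinearMap.inr ℝ ℝ (Vec d)) x := hasFDerivAt_prodMk_right t x
  have h2 := h.hasFDerivAt.comp x h1
  rw [pd]
  have h3 : HasFDerivAt (f t) _ x := h2
  rw [h3.fderiv]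
  simp

theorem deriv_eq_fderiv_joint (h : DifferentiableAt ℝ (joint f) (t, x)) :
    deriv (fun s => f s x) t = fderiv ℝ (joint f) (t, x) (1, 0) := by
  have h1 : HasFDerivAt (fun s : ℝ => (s, x))
      (ContinuousLinearMap.inl ℝ ℝ (Vec d)) t := hasFDerivAt_prodMk_left t x
  have h2 := h.hasFDerivAt.comp t h1
  have h3 : HasFDerivAt (fun s => f s x) _ t := h2
  rw [h3.hasDerivAt.deriv]
  simp

theorem fderiv_joint_apply (h : DifferentiableAt ℝ (joint f) (t, x)) (v : Vec d) :
    fderiv ℝ (joint f) (t, x) (1, v) = deriv (fun s => f s x) t + ∑ j, v j * pd j (f t) x := by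
  have h1 : ((1 : ℝ), v) = (1, 0) + (0, v) := by simp
  rw [h1, map_add, deriv_eq_fderiv_joint h]
  congr 1
  have h2 : HasFDerivAt (fun y : Vec d => (t, y))
      (ContinuousLinearMap.inr ℝ ℝ (Vec d)) x := hasFDerivAt_prodMk_right t x
  have h3 : HasFDerivAt (f t) _ x := h.hasFDerivAt.comp x h2
  rw [← fderiv_eq_sum_pd, h3.fderiv]
  simp

theorem eventually_differentiableAt (h : ContDiffAt ℝ 1 (joint f) (t, x)) :
    ∀ᶠ q in 𝓝 (t, x), DifferentiableAt ℝ (joint f) q :=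
  (h.eventually (by simp)).mono fun _ hq => hq.differentiableAt one_ne_zero

theorem joint_pd_eventuallyEq (h : ContDiffAt ℝ 1 (joint f) (t, x)) (j : Fin d) :
    joint (fun s y => pd j (f s) y) =ᶠ[𝓝 (t, x)]
      fun q => fderiv ℝ (joint f) q (0, EuclideanSpace.single j 1) :=
  (eventually_differentiableAt h).mono fun _ hq => pd_eq_fderiv_joint hq j

theorem joint_deriv_eventuallyEq (h : ContDiffAt ℝ 1 (joint f) (t, x)) :
    joint (fun s y => deriv (fun r => f r y) s) =ᶠ[𝓝 (t, x)]
      fun q => fderiv ℝ (joint f) q (1, 0) :=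
  (eventually_differentiableAt h).mono fun _ hq => deriv_eq_fderiv_joint hq

theorem contDiffAt_joint_pd (h : ContDiffAt ℝ n (joint f) (t, x)) (hmn : m + 1 ≤ n) (j : Fin d) :
    ContDiffAt ℝ m (joint fun s y => pd j (f s) y) (t, x) :=
  ((h.fderiv_right hmn).clm_apply contDiffAt_const).congr_of_eventuallyEq
    (joint_pd_eventuallyEq (h.of_le (le_trans le_add_self hmn)) j)

theorem contDiffAt_joint_deriv (h : ContDiffAt ℝ n (joint f) (t, x)) (hmn : m + 1 ≤ n) :
    ContDiffAt ℝ m (joint fun s y => deriv (fun r => f r y) s) (t, x) :=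
  ((h.fderiv_right hmn).clm_apply contDiffAt_const).congr_of_eventuallyEq
    (joint_deriv_eventuallyEq (h.of_le (le_trans le_add_self hmn)))

/-- Space and time derivatives are directional derivatives of one function on space-time, so this is
the symmetry of its second derivative. -/
theorem pd_deriv_comm (h : ContDiffAt ℝ 2 (joint f) (t, x)) (j : Fin d) :
    pd j (fun y => deriv (fun s => f s y) t) x = deriv (fun s => pd j (f s) x) t := by
  have hs := h.isSymmSndFDerivAt (by simp)
  have h1 : ContDiffAt ℝ 1 (joint f) (t, x) := h.of_le (by norm_num)
  have hd : DifferentiableAt ℝ (fderiv ℝ (joint f)) (t, x) :=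
    (h.fderiv_right (m := 1) (by norm_num)).differentiableAt one_ne_zero
  have e1 : pd j (fun y => deriv (fun s => f s y) t) x =
      fderiv ℝ (joint fun s y => deriv (fun r => f r y) s) (t, x)
        (0, EuclideanSpace.single j 1) :=
    pd_eq_fderiv_joint (f := fun s y => deriv (fun r => f r y) s)
      ((contDiffAt_joint_deriv (m := 1) h (by norm_num)).differentiableAt one_ne_zero) j
  have e2 : deriv (fun s => pd j (f s) x) t =
      fderiv ℝ (joint fun s y => pd j (f s) y) (t, x) (1, 0) :=
    deriv_eq_fderiv_joint (f := fun s y => pd j (f s) y)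
      ((contDiffAt_joint_pd (m := 1) h (by norm_num) j).differentiableAt one_ne_zero)
  rw [e1, e2, (joint_deriv_eventuallyEq h1).fderiv_eq, (joint_pd_eventuallyEq h1 j).fderiv_eq,
    fderiv_clm_apply hd (differentiableAt_const _), fderiv_clm_apply hd (differentiableAt_const _)]
  simp only [fderiv_fun_const, Pi.zero_apply, ContinuousLinearMap.comp_zero, zero_add,
    ContinuousLinearMap.flip_apply]
  exact hs _ _

/-- Differentiation under the integral over a fixed bounded domain. -/
theorem hasDerivAt_setIntegral {T : ℝ} {Ω : Set (Vec d)} (hΩ : MeasurableSet Ω)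
    (hc : IsCompact (closure Ω))
    (h : ∀ t ∈ Ioo 0 T, ∀ x ∈ closure Ω, ContDiffAt ℝ 1 (joint f) (t, x)) (ht : t ∈ Ioo 0 T) :
    HasDerivAt (fun s => ∫ x in Ω, f s x) (∫ x in Ω, deriv (fun s => f s x) t) t := by
  -- Regularity holds on the open time interval only; a compact subinterval around `t` supplies a
  -- uniform bound of the time derivative.
  obtain ⟨a, b, hat, htb, hab⟩ : ∃ a b, a < t ∧ t < b ∧ Icc a b ⊆ Ioo 0 T := by
    refine ⟨t / 2, (t + T) / 2, by linarith [ht.1], by linarith [ht.2], fun s hs => ⟨?_, ?_⟩⟩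
    · linarith [ht.1, hs.1]
    · linarith [ht.2, hs.2]
  have hD : ContinuousOn (joint fun s y => deriv (fun r => f r y) s) (Icc a b ×ˢ closure Ω) :=
    fun q hq => (contDiffAt_joint_deriv (m := 0) (h q.1 (hab hq.1) q.2 hq.2)
      (by simp)).continuousAt.continuousWithinAt
  obtain ⟨B, hB⟩ := (isCompact_Icc.prod hc).exists_bound_of_continuousOn hD
  have hfc : ∀ s ∈ Ioo 0 T, ContinuousOn (f s) (closure Ω) := fun s hs x hx =>
    (contDiffAt_space_of_joint (h s hs x hx)).continuousAt.continuousWithinAt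
  have hDc : ContinuousOn (fun x => deriv (fun r => f r x) t) (closure Ω) := fun x hx =>
    (contDiffAt_space_of_joint (f := fun s y => deriv (fun r => f r y) s)
      (contDiffAt_joint_deriv (m := 0) (h t ht x hx) (by simp))).continuousAt.continuousWithinAt
  have hfin : IsFiniteMeasure ((volume : Measure (Vec d)).restrict Ω) :=
    ⟨by
      rw [Measure.restrict_apply_univ]
      exact (measure_mono subset_closure).trans_lt hc.measure_lt_top⟩
  refine (hasDerivAt_integral_of_dominated_loc_of_deriv_le (μ := volume.restrict Ω)
    (F := fun s x => f s x) (F' := fun s x => deriv (fun r => f r x) s) (s := Icc a b)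
    (bound := fun _ => B) (Icc_mem_nhds hat htb) ?_ ?_ ?_ ?_ (integrable_const B) ?_).2
  · filter_upwards [Ioo_mem_nhds ht.1 ht.2] with s hs
    exact ((hfc s hs).mono subset_closure).aestronglyMeasurable hΩ
  · exact ((hfc t ht).integrableOn_compact hc).mono_set subset_closure
  · exact (hDc.mono subset_closure).aestronglyMeasurable hΩ
  · filter_upwards [ae_restrict_mem hΩ] with x hx s hs
    exact hB (s, x) ⟨hs, subset_closure hx⟩
  · filter_upwards [ae_restrict_mem hΩ] with x hx s hs
    exact ((contDiffAt_time_of_joint (h s (hab hs) x (subset_closure hx))).differentiableAt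
      one_ne_zero).hasDerivAt

theorem integrableOn_of_contDiffAt_joint {Ω : Set (Vec d)}
    (hc : IsCompact (closure Ω))
    (h : ∀ x ∈ closure Ω, ContDiffAt ℝ n (joint f) (t, x)) : IntegrableOn (f t) Ω := by
  have hf : ContinuousOn (f t) (closure Ω) := fun x hx =>
    (contDiffAt_space_of_joint (h x hx)).continuousAt.continuousWithinAt
  exact (hf.integrableOn_compact hc).mono_set subset_closure

end Joint

/-! ### Differentiation with respect to matrices -/

section MatrixAnalysis

variable {d : ℕ} {E : Type*} [NormedAddCommGroup E] [NormedSpace ℝ E]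

theorem contDiffAt_entry {n : WithTop ℕ∞} {A : E → Mat d} {q : E} (h : ContDiffAt ℝ n A q)
    (i j : Fin d) : ContDiffAt ℝ n (fun y => A y i j) q :=
  (LinearMap.toContinuousLinearMap (Matrix.entryLinearMap ℝ ℝ i j)).contDiff.contDiffAt.comp q h

theorem contDiffAt_det {n : WithTop ℕ∞} {A : E → Mat d} {q : E} (h : ContDiffAt ℝ n A q) :
    ContDiffAt ℝ n (fun y => (A y).det) q := by
  simp only [Matrix.det_apply']
  exact ContDiffAt.sum fun σ _ => contDiffAt_const.mul
    (contDiffAt_prod fun i _ => contDiffAt_entry h _ _)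

theorem isOpen_GLpos : IsOpen (GLpos d) :=
  isOpen_lt continuous_const (by fun_prop)

theorem frobenius_norm_sq (A : Mat d) : ‖A‖ ^ 2 = ∑ i, ∑ j, A i j ^ 2 := by
  rw [Matrix.frobenius_norm_def, ← Real.sqrt_eq_rpow, Real.sq_sqrt]
  · simp
  · positivity

theorem hasFDerivAt_det {F : Mat d} :
    HasFDerivAt (Matrix.det : Mat d → ℝ) (fderiv ℝ Matrix.det F) F :=
  ((contDiffAt_det (n := 1) contDiffAt_id).differentiableAt one_ne_zero).hasFDerivAt

/-- Jacobi's formula in the direction needed for `Ḟ = (∇v)F`: factor `det (F + sAF) = det (1 + sA) *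
det F` and read off the coefficient of `s`. No inverse of `F` is involved. -/
theorem fderiv_det_mul (A F : Mat d) :
    fderiv ℝ (Matrix.det : Mat d → ℝ) F (A * F) = F.det * A.trace := by
  have h1 : HasDerivAt (fun s : ℝ => F + s • (A * F)) (A * F) 0 := by
    have h := ((hasDerivAt_id (0 : ℝ)).smul_const (A * F)).const_add F
    rw [one_smul] at h
    exact h
  have h2 : HasFDerivAt (Matrix.det : Mat d → ℝ) (fderiv ℝ Matrix.det F)
      (F + (0 : ℝ) • (A * F)) := by
    simpa using hasFDerivAt_det (F := F)
  have h3 := h2.comp_hasDerivAt (0 : ℝ) h1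
  set P := (1 + (Polynomial.X : Polynomial ℝ) • A.map ⇑Polynomial.C).det.divX.divX with hP
  have h4 : ∀ s : ℝ, (F + s • (A * F)).det = (1 + A.trace * s + P.eval s * s ^ 2) * F.det :=
    fun s => by
      rw [hP, ← Matrix.det_one_add_smul, ← Matrix.det_mul, add_mul, one_mul, Matrix.smul_mul]
  have h5 : HasDerivAt (fun s : ℝ => (1 + A.trace * s + P.eval s * s ^ 2) * F.det)
      (A.trace * F.det) 0 := by
    have h6 := ((((hasDerivAt_id (0 : ℝ)).const_mul A.trace).const_add 1).add
      ((P.hasDerivAt 0).mul ((hasDerivAt_id (0 : ℝ)).pow 2))).mul_const F.det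
    simpa using h6
  have h7 : HasDerivAt (fun s : ℝ => (F + s • (A * F)).det) (A.trace * F.det) 0 := by
    simp only [h4]; exact h5
  have h8 := h7.unique h3
  exact h8.symm.trans (mul_comm _ _)

theorem fderiv_mat_apply (g : Mat d → ℝ) (F A : Mat d) :
    fderiv ℝ g F A = ddot (dMat g F) A := by
  conv_lhs => rw [Matrix.matrix_eq_sum_single A]
  simp only [map_sum, ddot, dMat, Matrix.of_apply]
  refine Finset.sum_congr rfl fun i _ => Finset.sum_congr rfl fun j _ => ?_
  have : Matrix.single i j (A i j) = A i j • Matrix.single i j (1 : ℝ) := by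
    rw [Matrix.smul_single, smul_eq_mul, mul_one]
  rw [this, map_smul, smul_eq_mul, mul_comm]

variable {E₁ E₂ : Type*} [NormedAddCommGroup E₁] [NormedSpace ℝ E₁]
  [NormedAddCommGroup E₂] [NormedSpace ℝ E₂]

theorem fderiv_fst_eq {g : E₁ × E₂ → ℝ} {a : E₁} {b : E₂} (h : DifferentiableAt ℝ g (a, b))
    (v : E₁) : fderiv ℝ (fun a' => g (a', b)) a v = fderiv ℝ g (a, b) (v, 0) := by
  have h0 : HasFDerivAt (fun a' : E₁ => (a', b)) (ContinuousLinearMap.inl ℝ E₁ E₂) a :=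
    hasFDerivAt_prodMk_left a b
  have h1 := h.hasFDerivAt.comp a h0
  have h2 : HasFDerivAt (fun a' => g (a', b)) _ a := h1
  rw [h2.fderiv]
  simp

theorem fderiv_snd_eq {g : E₁ × E₂ → ℝ} {a : E₁} {b : E₂} (h : DifferentiableAt ℝ g (a, b))
    (v : E₂) : fderiv ℝ (fun b' => g (a, b')) b v = fderiv ℝ g (a, b) (0, v) := by
  have h0 : HasFDerivAt (fun b' : E₂ => (a, b')) (ContinuousLinearMap.inr ℝ E₁ E₂) b :=
    hasFDerivAt_prodMk_right a b
  have h1 := h.hasFDerivAt.comp b h0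
  have h2 : HasFDerivAt (fun b' => g (a, b')) _ b := h1
  rw [h2.fderiv]
  simp

/-- Near `q` the partial derivative is the total derivative applied to `(v, 0)`, so it is regular
jointly in both arguments and only one order is lost. -/
theorem contDiffAt_fderiv_fst {n m : WithTop ℕ∞} {g : E₁ × E₂ → ℝ} {q : E₁ × E₂}
    (h : ContDiffAt ℝ n g q) (hmn : m + 1 ≤ n) (v : E₁) :
    ContDiffAt ℝ m (fun p : E₁ × E₂ => fderiv ℝ (fun a' => g (a', p.2)) p.1 v) q := by
  refine ((h.fderiv_right hmn).clm_apply contDiffAt_const).congr_of_eventuallyEq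
    (f := fun p => fderiv ℝ g p (v, 0)) ?_
  have h1 : ContDiffAt ℝ 1 g q := h.of_le (le_trans le_add_self hmn)
  exact (h1.eventually (by simp)).mono fun p hp =>
    fderiv_fst_eq (hp.differentiableAt one_ne_zero) v

theorem contDiffAt_fderiv_snd {n m : WithTop ℕ∞} {g : E₁ × E₂ → ℝ} {q : E₁ × E₂}
    (h : ContDiffAt ℝ n g q) (hmn : m + 1 ≤ n) (v : E₂) :
    ContDiffAt ℝ m (fun p : E₁ × E₂ => fderiv ℝ (fun b' => g (p.1, b')) p.2 v) q := by
  refine ((h.fderiv_right hmn).clm_apply contDiffAt_const).congr_of_eventuallyEq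
    (f := fun p => fderiv ℝ g p (0, v)) ?_
  have h1 : ContDiffAt ℝ 1 g q := h.of_le (le_trans le_add_self hmn)
  exact (h1.eventually (by simp)).mono fun p hp =>
    fderiv_snd_eq (hp.differentiableAt one_ne_zero) v

/-! ### Tensor algebra -/

theorem ddot_add_left (A B C : Mat d) : ddot (A + B) C = ddot A C + ddot B C := by
  simp [ddot, add_mul, Finset.sum_add_distrib]

theorem ddot_sub_left (A B C : Mat d) : ddot (A - B) C = ddot A C - ddot B C := by
  simp [ddot, sub_mul, Finset.sum_sub_distrib]

theorem ddot_neg_left (A C : Mat d) : ddot (-A) C = -ddot A C := by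
  simp [ddot]

theorem ddot_smul_left (c : ℝ) (A C : Mat d) : ddot (c • A) C = c * ddot A C := by
  simp [ddot, Finset.mul_sum, mul_assoc]

theorem ddot_transpose (A B : Mat d) : ddot Aᵀ Bᵀ = ddot A B := by
  simp only [ddot, Matrix.transpose_apply]
  rw [Finset.sum_comm]

theorem ddot_comm (A B : Mat d) : ddot A B = ddot B A := by
  simp only [ddot, mul_comm]

theorem ddot_self (A : Mat d) : ddot A A = ‖A‖ ^ 2 := by
  rw [frobenius_norm_sq]; simp [ddot, sq]

theorem ddot_mul_right (A B F : Mat d) : ddot A (B * F) = ddot (A * Fᵀ) B := by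
  simp only [ddot, Matrix.mul_apply, Finset.mul_sum, Finset.sum_mul, Matrix.transpose_apply]
  refine Finset.sum_congr rfl fun i _ => ?_
  rw [Finset.sum_comm]
  exact Finset.sum_congr rfl fun j _ => Finset.sum_congr rfl fun k _ => by ring

theorem ddot_symPart_of_symm {A : Mat d} (hA : Aᵀ = A) (G : Mat d) :
    ddot A (symPart G) = ddot A G := by
  have h1 : ddot A Gᵀ = ddot A G := by rw [← ddot_transpose, hA, Matrix.transpose_transpose]
  rw [symPart, ddot_comm, ddot_smul_left, ddot_add_left, ddot_comm G, ddot_comm Gᵀ, h1]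
  ring

theorem transpose_symPart (G : Mat d) : (symPart G)ᵀ = symPart G := by
  simp [symPart, add_comm]

/-! ### Frame indifference -/

/-- The rotation by the angle `s` in a coordinate plane, with generator `W`. -/
def planeRot (W : Mat d) (s : ℝ) : Mat d := 1 + Real.sin s • W + (1 - Real.cos s) • (W * W)

theorem hasDerivAt_planeRot (W : Mat d) : HasDerivAt (planeRot W) W 0 := by
  have h1 := ((Real.hasDerivAt_sin 0).smul_const W).const_add (1 : Mat d)
  have h2 := ((Real.hasDerivAt_cos 0).const_sub 1).smul_const (W * W)
  have h3 : HasDerivAt (planeRot W) _ 0 := h1.add h2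
  simpa using h3

/-- Rodrigues' formula: with `W` skew and `W³ = -W`, all products reduce to `W * W`, whose
coefficient vanishes by `sin² + cos² = 1`. -/
theorem planeRot_mul_transpose {W : Mat d} (hT : Wᵀ = -W) (h3 : W * W * W = -W) (s : ℝ) :
    planeRot W s * (planeRot W s)ᵀ = 1 := by
  have h4 : W * (W * W) = -W := by rw [← Matrix.mul_assoc, h3]
  have h5 : W * W * (W * W) = -(W * W) := by rw [← Matrix.mul_assoc, h3, Matrix.neg_mul]
  have hsc := Real.sin_sq_add_cos_sq s
  set a := Real.sin s
  set c := Real.cos s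
  have e : planeRot W s * (planeRot W s)ᵀ =
      1 + (2 * (1 - c) - a * a - (1 - c) * (1 - c)) • (W * W) := by
    simp only [planeRot, Matrix.transpose_add, Matrix.transpose_one, Matrix.transpose_smul,
      Matrix.transpose_mul, hT, Matrix.neg_mul, Matrix.mul_neg, neg_neg, Matrix.add_mul,
      Matrix.mul_add, Matrix.one_mul, Matrix.mul_one, Matrix.smul_mul, Matrix.mul_smul, h3, h4, h5, smul_neg]
    module
  rw [e]
  have : 2 * (1 - c) - a * a - (1 - c) * (1 - c) = 0 := by nlinarith
  rw [this, zero_smul, add_zero]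

/-- A frame-indifferent function has a symmetric Kirchhoff stress. -/
theorem transpose_dMat_mul_of_frame {g : Mat d → ℝ} {F : Mat d} (hg : DifferentiableAt ℝ g F)
    (hframe : ∀ Q ∈ Matrix.specialOrthogonalGroup (Fin d) ℝ, g (Q * F) = g F) :
    (dMat g F * Fᵀ)ᵀ = dMat g F * Fᵀ := by
  ext j i
  rw [Matrix.transpose_apply]
  by_cases hij : i = j
  · rw [hij]
  -- The generator of rotations in the `i, j` plane. Differentiating the invariance along these
  -- rotations gives `W : g'(F)Fᵀ = 0`, the equality of the `i j` and `j i` entries.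
  set W : Mat d := Matrix.single i j 1 - Matrix.single j i 1 with hW
  have hT : Wᵀ = -W := by simp [hW]
  have hWW : W * W = -Matrix.single i i 1 - Matrix.single j j 1 := by
    simp [hW, Matrix.mul_sub, Matrix.sub_mul, hij, Ne.symm hij]
    abel
  have h3 : W * W * W = -W := by
    rw [hWW]
    simp [hW, Matrix.mul_sub, Matrix.sub_mul, hij, Ne.symm hij]
    abel
  have hd := hasDerivAt_planeRot W
  have h0 : planeRot W 0 = 1 := by simp [planeRot]
  -- Orthogonality gives determinant `±1`; it is positive near `s = 0` by continuity. Only small `s`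
  -- matter for the derivative.
  have hmem : ∀ᶠ s in 𝓝 (0 : ℝ), planeRot W s ∈ Matrix.specialOrthogonalGroup (Fin d) ℝ := by
    have hcont : ContinuousAt (fun s => (planeRot W s).det) 0 := by
      have h : Continuous (Matrix.det : Mat d → ℝ) := by fun_prop
      exact h.continuousAt.comp hd.continuousAt
    have hpos : ∀ᶠ s in 𝓝 (0 : ℝ), 0 < (planeRot W s).det :=
      hcont.eventually_const_lt (by simp only [h0, Matrix.det_one]; exact one_pos)
    filter_upwards [hpos] with s hs
    have ho := planeRot_mul_transpose hT h3 s
    refine Matrix.mem_specialOrthogonalGroup_iff.2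
      ⟨(Matrix.mem_orthogonalGroup_iff _ _).2 ho, ?_⟩
    have h6 := congrArg Matrix.det ho
    rw [Matrix.det_mul, Matrix.det_transpose, Matrix.det_one] at h6
    nlinarith
  have hmulF : HasDerivAt (fun s => planeRot W s * F) (W * F) 0 := by
    have hlin : HasFDerivAt (fun A : Mat d => A * F)
        (LinearMap.toContinuousLinearMap (LinearMap.mulRight ℝ F)) (planeRot W 0) :=
      (LinearMap.toContinuousLinearMap (LinearMap.mulRight ℝ F)).hasFDerivAt
    exact hlin.comp_hasDerivAt (0 : ℝ) hd
  have hgF : HasFDerivAt g (fderiv ℝ g F) (planeRot W 0 * F) := by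
    rw [h0, one_mul]; exact hg.hasFDerivAt
  have e1 := hgF.comp_hasDerivAt (0 : ℝ) hmulF
  have e2 : HasDerivAt (g ∘ fun s => planeRot W s * F) 0 0 := by
    refine (hasDerivAt_const (0 : ℝ) (g F)).congr_of_eventuallyEq ?_
    filter_upwards [hmem] with s hs
    exact hframe _ hs
  have e3 := (fderiv_mat_apply g F (W * F)).symm.trans (e1.unique e2)
  rw [ddot_mul_right, ddot_comm, hW, ddot_sub_left] at e3
  have hs : ∀ (k l : Fin d) (A : Mat d), ddot (Matrix.single k l 1) A = A k l := fun k l A => by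
    rw [ddot, Finset.sum_eq_single k, Finset.sum_eq_single l]
    · simp
    · intro b _ hb; simp [Ne.symm hb]
    · simp
    · intro b _ hb; simp [Ne.symm hb]
    · simp
  rw [hs, hs] at e3
  linarith

/-! ### The vector product -/

/-- For `d = 3` a vector product is orthogonal to its factors. For `d = 2` the padded factors have a
product along the third axis, so the in-plane part is zero. This is why the gyromagnetic term does
no work. -/
theorem inner_cross_self {d : ℕ} (hd : d = 2 ∨ d = 3) (a b : Vec d) : ⟪cross a b, b⟫ = 0 := by
  rcases hd with rfl | rfl
  · simp [cross, PiLp.inner_apply, Fin.sum_univ_two, pad3, cross_apply]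
  · have := dot_cross_self (pad3 a) (pad3 b)
    simp [dotProduct, Fin.sum_univ_three, pad3, cross_apply] at this
    simp [cross, PiLp.inner_apply, Fin.sum_univ_three, pad3, cross_apply]
    linarith

end MatrixAnalysis

/-! ### Regularity of the constitutive functions -/

section Constitutive

variable {d : ℕ} {M : Material d} {F : Mat d} {m : Vec d} {θ : ℝ}

namespace Material.Admissible

theorem contDiffAt_φ (hM : M.Admissible) (hF : F ∈ GLpos d) :
    ContDiffAt ℝ 2 (fun q : Mat d × Vec d => M.φ q.1 q.2) (F, m) :=
  hM.φ_smooth.contDiffAt ((isOpen_GLpos.prod isOpen_univ).mem_nhds ⟨hF, mem_univ _⟩)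

theorem contDiffAt_ζ (hM : M.Admissible) (hF : F ∈ GLpos d) (hθ : θ ∈ M.Θ) :
    ContDiffAt ℝ 2 (fun q : Mat d × Vec d × ℝ => M.ζ q.1 q.2.1 q.2.2) (F, m, θ) :=
  hM.ζ_smooth.contDiffAt ((isOpen_GLpos.prod (isOpen_univ.prod hM.isOpen_Θ)).mem_nhds
    ⟨hF, mem_univ _, hθ⟩)

theorem contDiffAt_κ (hM : M.Admissible) (hF : F ∈ GLpos d) : ContDiffAt ℝ 2 M.κ F :=
  hM.κ_smooth.contDiffAt (isOpen_GLpos.mem_nhds hF)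

theorem contDiffAt_cond (hM : M.Admissible) (hF : F ∈ GLpos d) (hθ : θ ∈ M.Θ) :
    ContDiffAt ℝ 1 (fun q : Mat d × ℝ => M.cond q.1 q.2) (F, θ) :=
  hM.cond_smooth.contDiffAt ((isOpen_GLpos.prod hM.isOpen_Θ).mem_nhds ⟨hF, hθ⟩)

theorem contDiffAt_φF (hM : M.Admissible) (hF : F ∈ GLpos d) (i j : Fin d) :
    ContDiffAt ℝ 1 (fun q : Mat d × Vec d => M.φF q.1 q.2 i j) (F, m) :=
  contDiffAt_fderiv_fst (hM.contDiffAt_φ hF) (by norm_num) _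

theorem contDiffAt_ζF (hM : M.Admissible) (hF : F ∈ GLpos d) (hθ : θ ∈ M.Θ) (i j : Fin d) :
    ContDiffAt ℝ 1 (fun q : Mat d × Vec d × ℝ => M.ζF q.1 q.2.1 q.2.2 i j) (F, m, θ) :=
  contDiffAt_fderiv_fst (hM.contDiffAt_ζ hF hθ) (by norm_num) _

theorem contDiffAt_dκ (hM : M.Admissible) (hF : F ∈ GLpos d) (i j : Fin d) :
    ContDiffAt ℝ 1 (fun G => dMat M.κ G i j) F :=
  ((hM.contDiffAt_κ hF).fderiv_right (by norm_num)).clm_apply contDiffAt_const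

theorem contDiffAt_φm (hM : M.Admissible) (hF : F ∈ GLpos d) (i : Fin d) :
    ContDiffAt ℝ 1 (fun q : Mat d × Vec d => gradient (fun a => M.φ q.1 a) q.2 i) (F, m) := by
  simp only [gradient_apply]
  exact contDiffAt_fderiv_snd (hM.contDiffAt_φ hF) (by norm_num) _

theorem contDiffAt_ζm (hM : M.Admissible) (hF : F ∈ GLpos d) (hθ : θ ∈ M.Θ) (i : Fin d) :
    ContDiffAt ℝ 1 (fun q : Mat d × Vec d × ℝ => M.ζm q.1 q.2.1 q.2.2 i) (F, m, θ) := by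
  simp only [ζm, gradient_apply]
  -- The arguments are regrouped so that the middle one becomes the second factor of a pair.
  have h1 : ContDiffAt ℝ 2 (fun q : (Mat d × ℝ) × Vec d => M.ζ q.1.1 q.2 q.1.2) ((F, θ), m) :=
    (hM.contDiffAt_ζ hF hθ).comp ((F, θ), m) (f := fun q : (Mat d × ℝ) × Vec d =>
      (q.1.1, q.2, q.1.2)) (by fun_prop)
  exact (contDiffAt_fderiv_snd h1 (m := 1) (by norm_num) (EuclideanSpace.single i 1)).comp
    (F, m, θ) (f := fun q : Mat d × Vec d × ℝ => ((q.1, q.2.2), q.2.1)) (by fun_prop)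

theorem contDiffAt_ζθ (hM : M.Admissible) (hF : F ∈ GLpos d) (hθ : θ ∈ M.Θ) :
    ContDiffAt ℝ 1 (fun q : Mat d × Vec d × ℝ => deriv (fun s => M.ζ q.1 q.2.1 s) q.2.2)
      (F, m, θ) := by
  have h1 : ContDiffAt ℝ 2 (fun q : (Mat d × Vec d) × ℝ => M.ζ q.1.1 q.1.2 q.2) ((F, m), θ) :=
    (hM.contDiffAt_ζ hF hθ).comp ((F, m), θ) (f := fun q : (Mat d × Vec d) × ℝ =>
      (q.1.1, q.1.2, q.2)) (by fun_prop)
  exact (contDiffAt_fderiv_snd h1 (m := 1) (by norm_num) 1).comp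
    (F, m, θ) (f := fun q : Mat d × Vec d × ℝ => ((q.1, q.2.1), q.2.2)) (by fun_prop)

theorem contDiffAt_heatPart (hM : M.Admissible) (hF : F ∈ GLpos d) (hθ : θ ∈ M.Θ) :
    ContDiffAt ℝ 1 (fun q : Mat d × Vec d × ℝ => M.heatPart q.1 q.2.1 q.2.2) (F, m, θ) := by
  have hdet : ContDiffAt ℝ 1 (fun q : Mat d × Vec d × ℝ => q.1.det) (F, m, θ) :=
    contDiffAt_det contDiffAt_fst
  exact (((hM.contDiffAt_ζ hF hθ).of_le (by norm_num)).sub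
    (ContDiffAt.mul (by fun_prop) (hM.contDiffAt_ζθ hF hθ))).div hdet (ne_of_gt hF)

end Material.Admissible

end Constitutive

namespace IsSmoothState

variable {d : ℕ} {T : ℝ} {Ω : Set (Vec d)} {M : Material d} {L : Loads d} {S : State d}
  {t : ℝ} {x : Vec d}

/-! #### Regularity in space-time -/

theorem contDiffAt_v (hS : IsSmoothState T Ω M S) (ht : t ∈ Ioo 0 T) (hx : x ∈ closure Ω)
    (i : Fin d) : ContDiffAt ℝ ∞ (joint fun s y => S.v s y i) (t, x) :=
  (contDiffAt_piLp_apply 2).comp (t, x) (hS.v_smooth.contDiffAt ht hx)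

theorem contDiffAt_m (hS : IsSmoothState T Ω M S) (ht : t ∈ Ioo 0 T) (hx : x ∈ closure Ω)
    (i : Fin d) : ContDiffAt ℝ ∞ (joint fun s y => S.m s y i) (t, x) :=
  (contDiffAt_piLp_apply 2).comp (t, x) (hS.m_smooth.contDiffAt ht hx)

theorem contDiffAt_F (hS : IsSmoothState T Ω M S) (ht : t ∈ Ioo 0 T) (hx : x ∈ closure Ω)
    (i j : Fin d) : ContDiffAt ℝ ∞ (joint fun s y => S.F s y i j) (t, x) :=
  contDiffAt_entry (hS.F_smooth.contDiffAt ht hx) i j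

theorem contDiffAt_det (hS : IsSmoothState T Ω M S) (ht : t ∈ Ioo 0 T) (hx : x ∈ closure Ω) :
    ContDiffAt ℝ ∞ (joint fun s y => (S.F s y).det) (t, x) :=
  ThermoMagnet.contDiffAt_det (hS.F_smooth.contDiffAt ht hx)

theorem det_ne_zero (hS : IsSmoothState T Ω M S) (ht : t ∈ Ioo 0 T) (hx : x ∈ closure Ω) :
    (S.F t x).det ≠ 0 := ne_of_gt (hS.det_pos t ht x hx)

theorem contDiffAt_gradV_v (hS : IsSmoothState T Ω M S) (ht : t ∈ Ioo 0 T)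
    (hx : x ∈ closure Ω) (i k : Fin d) :
    ContDiffAt ℝ ∞ (joint fun s y => gradV (S.v s) y i k) (t, x) :=
  contDiffAt_joint_pd (hS.contDiffAt_v ht hx i) le_rfl k

theorem contDiffAt_gradV_m (hS : IsSmoothState T Ω M S) (ht : t ∈ Ioo 0 T)
    (hx : x ∈ closure Ω) (i k : Fin d) :
    ContDiffAt ℝ ∞ (joint fun s y => gradV (S.m s) y i k) (t, x) :=
  contDiffAt_joint_pd (hS.contDiffAt_m ht hx i) le_rfl k

theorem contDiffAt_deriv_m (hS : IsSmoothState T Ω M S) (ht : t ∈ Ioo 0 T)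
    (hx : x ∈ closure Ω) (i : Fin d) :
    ContDiffAt ℝ ∞ (joint fun s y => deriv (fun r => S.m r y i) s) (t, x) :=
  contDiffAt_joint_deriv (hS.contDiffAt_m ht hx i) le_rfl

theorem contDiffAt_κ (hS : IsSmoothState T Ω M S) (hM : M.Admissible) (ht : t ∈ Ioo 0 T)
    (hx : x ∈ closure Ω) : ContDiffAt ℝ 2 (joint fun s y => M.κ (S.F s y)) (t, x) :=
  ContDiffAt.comp (t, x) (hM.contDiffAt_κ (hS.det_pos t ht x hx))
    ((hS.F_smooth.contDiffAt ht hx).of_le (WithTop.coe_le_coe.2 le_top))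

theorem contDiffAt_κact (hS : IsSmoothState T Ω M S) (hM : M.Admissible) (ht : t ∈ Ioo 0 T)
    (hx : x ∈ closure Ω) : ContDiffAt ℝ 2 (joint fun s y => S.κact M s y) (t, x) :=
  (hS.contDiffAt_κ hM ht hx).div ((hS.contDiffAt_det ht hx).of_le (WithTop.coe_le_coe.2 le_top))
    (hS.det_ne_zero ht hx)

theorem contDiffAt_Fm (hS : IsSmoothState T Ω M S) (ht : t ∈ Ioo 0 T) (hx : x ∈ closure Ω) :
    ContDiffAt ℝ ∞ (fun q : ℝ × Vec d => (S.F q.1 q.2, S.m q.1 q.2)) (t, x) :=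
  (hS.F_smooth.contDiffAt ht hx).prodMk (hS.m_smooth.contDiffAt ht hx)

theorem contDiffAt_Fmθ (hS : IsSmoothState T Ω M S) (ht : t ∈ Ioo 0 T) (hx : x ∈ closure Ω) :
    ContDiffAt ℝ ∞ (fun q : ℝ × Vec d => (S.F q.1 q.2, S.m q.1 q.2, S.θ q.1 q.2)) (t, x) :=
  (hS.F_smooth.contDiffAt ht hx).prodMk
    ((hS.m_smooth.contDiffAt ht hx).prodMk (hS.θ_smooth.contDiffAt ht hx))

theorem contDiffAt_φ (hS : IsSmoothState T Ω M S) (hM : M.Admissible) (ht : t ∈ Ioo 0 T)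
    (hx : x ∈ closure Ω) : ContDiffAt ℝ 2 (joint fun s y => M.φ (S.F s y) (S.m s y)) (t, x) :=
  ContDiffAt.comp (t, x) (hM.contDiffAt_φ (hS.det_pos t ht x hx))
    ((hS.contDiffAt_Fm ht hx).of_le (WithTop.coe_le_coe.2 le_top))

theorem contDiffAt_φF (hS : IsSmoothState T Ω M S) (hM : M.Admissible) (ht : t ∈ Ioo 0 T)
    (hx : x ∈ closure Ω) (i j : Fin d) :
    ContDiffAt ℝ 1 (joint fun s y => M.φF (S.F s y) (S.m s y) i j) (t, x) :=
  ContDiffAt.comp (t, x) (hM.contDiffAt_φF (hS.det_pos t ht x hx) i j)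
    ((hS.contDiffAt_Fm ht hx).of_le (WithTop.coe_le_coe.2 le_top))

theorem contDiffAt_ζF (hS : IsSmoothState T Ω M S) (hM : M.Admissible) (ht : t ∈ Ioo 0 T)
    (hx : x ∈ closure Ω) (i j : Fin d) :
    ContDiffAt ℝ 1 (joint fun s y => M.ζF (S.F s y) (S.m s y) (S.θ s y) i j) (t, x) :=
  ContDiffAt.comp (t, x)
    (hM.contDiffAt_ζF (hS.det_pos t ht x hx) (hS.θ_mem t ht x hx) i j)
    ((hS.contDiffAt_Fmθ ht hx).of_le (WithTop.coe_le_coe.2 le_top))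

theorem contDiffAt_dκ (hS : IsSmoothState T Ω M S) (hM : M.Admissible) (ht : t ∈ Ioo 0 T)
    (hx : x ∈ closure Ω) (i j : Fin d) :
    ContDiffAt ℝ 1 (joint fun s y => dMat M.κ (S.F s y) i j) (t, x) :=
  ContDiffAt.comp (t, x) (hM.contDiffAt_dκ (hS.det_pos t ht x hx) i j)
    ((hS.F_smooth.contDiffAt ht hx).of_le (WithTop.coe_le_coe.2 le_top))

theorem contDiffAt_ψm (hS : IsSmoothState T Ω M S) (hM : M.Admissible) (ht : t ∈ Ioo 0 T)
    (hx : x ∈ closure Ω) (i : Fin d) :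
    ContDiffAt ℝ 1 (joint fun s y => M.ψm (S.F s y) (S.m s y) (S.θ s y) i) (t, x) :=
  (ContDiffAt.comp (t, x) (hM.contDiffAt_φm (hS.det_pos t ht x hx) i)
    ((hS.contDiffAt_Fm ht hx).of_le (WithTop.coe_le_coe.2 le_top))).add
  (ContDiffAt.comp (t, x)
    (hM.contDiffAt_ζm (hS.det_pos t ht x hx) (hS.θ_mem t ht x hx) i)
    ((hS.contDiffAt_Fmθ ht hx).of_le (WithTop.coe_le_coe.2 le_top)))

theorem contDiffAt_w (hS : IsSmoothState T Ω M S) (hM : M.Admissible) (ht : t ∈ Ioo 0 T)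
    (hx : x ∈ closure Ω) : ContDiffAt ℝ 1 (joint fun s y => S.w M s y) (t, x) :=
  ContDiffAt.comp (t, x) (hM.contDiffAt_heatPart (hS.det_pos t ht x hx) (hS.θ_mem t ht x hx))
    ((hS.contDiffAt_Fmθ ht hx).of_le (WithTop.coe_le_coe.2 le_top))

theorem contDiffAt_hext (hL : SmoothUpTo 1 T Ω L.hext) (ht : t ∈ Ioo 0 T) (hx : x ∈ closure Ω)
    (i : Fin d) : ContDiffAt ℝ 1 (joint fun s y => L.hext s y i) (t, x) :=
  (contDiffAt_piLp_apply 2).comp (t, x) (hL.contDiffAt ht hx)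

theorem contDiffAt_gradient_uΩ (hS : IsSmoothState T Ω M S) (ht : t ∈ Ioo 0 T)
    (hx : x ∈ closure Ω) (i : Fin d) :
    ContDiffAt ℝ ∞ (joint fun s y => gradient (S.uΩ s) y i) (t, x) := by
  simp only [gradient_apply]
  exact contDiffAt_joint_pd (hS.uΩ_smooth.contDiffAt ht hx) le_rfl i

theorem contDiffAt_field (hS : IsSmoothState T Ω M S) (hL : SmoothUpTo 1 T Ω L.hext)
    (ht : t ∈ Ioo 0 T) (hx : x ∈ closure Ω) (i : Fin d) :
    ContDiffAt ℝ 1 (joint fun s y => S.field L s y i) (t, x) :=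
  (contDiffAt_hext hL ht hx i).add
    ((hS.contDiffAt_gradient_uΩ ht hx i).of_le (WithTop.coe_le_coe.2 le_top))

theorem contDiffAt_heatFlux (hS : IsSmoothState T Ω M S) (hM : M.Admissible) (ht : t ∈ Ioo 0 T)
    (hx : x ∈ closure Ω) (i : Fin d) :
    ContDiffAt ℝ 1 (joint fun s y => S.heatFlux M s y i) (t, x) := by
  have h1 : ContDiffAt ℝ 1 (joint fun s y => M.cond (S.F s y) (S.θ s y)) (t, x) :=
    ContDiffAt.comp (t, x) (hM.contDiffAt_cond (hS.det_pos t ht x hx) (hS.θ_mem t ht x hx))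
      (((hS.F_smooth.contDiffAt ht hx).prodMk (hS.θ_smooth.contDiffAt ht hx)).of_le
        (WithTop.coe_le_coe.2 le_top))
  have h2 : ContDiffAt ℝ 1 (joint fun s y => gradient (S.θ s) y i) (t, x) := by
    simp only [gradient_apply]
    exact contDiffAt_joint_pd (n := ∞) (hS.θ_smooth.contDiffAt ht hx)
      (WithTop.coe_le_coe.2 le_top) i
  exact (h1.mul h2).neg

theorem contDiffAt_exchange (hS : IsSmoothState T Ω M S) (hM : M.Admissible) (ht : t ∈ Ioo 0 T)
    (hx : x ∈ closure Ω) :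
    ContDiffAt ℝ 1 (joint fun s y =>
      M.κ (S.F s y) * ‖gradV (S.m s) y‖ ^ 2 / (2 * (S.F s y).det)) (t, x) := by
  simp only [frobenius_norm_sq]
  refine ContDiffAt.div (ContDiffAt.mul ((hS.contDiffAt_κ hM ht hx).of_le (by norm_num)) ?_)
    (contDiffAt_const.mul ((hS.contDiffAt_det ht hx).of_le (WithTop.coe_le_coe.2 le_top)))
    (mul_ne_zero two_ne_zero (hS.det_ne_zero ht hx))
  exact ContDiffAt.sum fun i _ => ContDiffAt.sum fun j _ =>
    ((hS.contDiffAt_gradV_m ht hx i j).of_le (WithTop.coe_le_coe.2 le_top)).pow 2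

theorem contDiffAt_stored (hS : IsSmoothState T Ω M S) (hM : M.Admissible) (ht : t ∈ Ioo 0 T)
    (hx : x ∈ closure Ω) :
    ContDiffAt ℝ 1 (joint fun s y => M.φ (S.F s y) (S.m s y) / (S.F s y).det) (t, x) :=
  ((hS.contDiffAt_φ hM ht hx).of_le (by norm_num)).div
    ((hS.contDiffAt_det ht hx).of_le (WithTop.coe_le_coe.2 le_top)) (hS.det_ne_zero ht hx)

theorem contDiffAt_kinetic (hS : IsSmoothState T Ω M S) (ht : t ∈ Ioo 0 T)
    (hx : x ∈ closure Ω) :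
    ContDiffAt ℝ 1 (joint fun s y => S.ρ s y / 2 * ‖S.v s y‖ ^ 2) (t, x) := by
  simp only [EuclideanSpace.real_norm_sq_eq]
  exact (((hS.ρ_smooth.contDiffAt ht hx).of_le (WithTop.coe_le_coe.2 le_top)).div_const 2).mul
    (ContDiffAt.sum fun i _ =>
      ((hS.contDiffAt_v ht hx i).of_le (WithTop.coe_le_coe.2 le_top)).pow 2)

theorem contDiffAt_zeeman (hS : IsSmoothState T Ω M S) (hL : SmoothUpTo 1 T Ω L.hext)
    (ht : t ∈ Ioo 0 T) (hx : x ∈ closure Ω) :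
    ContDiffAt ℝ 1 (joint fun s y => ⟪S.field L s y, S.m s y⟫) (t, x) := by
  simp only [PiLp.inner_apply, RCLike.inner_apply, conj_trivial]
  exact ContDiffAt.sum fun i _ =>
    ((hS.contDiffAt_m ht hx i).of_le (WithTop.coe_le_coe.2 le_top)).mul
      (hS.contDiffAt_field hL ht hx i)

theorem contDiffAt_energyDensity (hS : IsSmoothState T Ω M S) (hM : M.Admissible)
    (hL : SmoothUpTo 1 T Ω L.hext) (ht : t ∈ Ioo 0 T) (hx : x ∈ closure Ω) :
    ContDiffAt ℝ 1 (joint fun s y => S.energyDensity M L s y) (t, x) :=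
  ((((hS.contDiffAt_kinetic ht hx).add (hS.contDiffAt_stored hM ht hx)).add
    (hS.contDiffAt_exchange hM ht hx)).sub
      (contDiffAt_const.mul (hS.contDiffAt_zeeman hL ht hx))).add (hS.contDiffAt_w hM ht hx)

/-! #### Regularity in space -/

theorem contDiffAt_D (hS : IsSmoothState T Ω M S) (ht : t ∈ Ioo 0 T) (hx : x ∈ closure Ω)
    (i j : Fin d) : ContDiffAt ℝ 1 (fun y => S.D t y i j) x :=
  contDiffAt_entry ((hS.D_smooth t ht).contDiffAt hx) i j

theorem contDiffAt_H (hS : IsSmoothState T Ω M S) (ht : t ∈ Ioo 0 T) (hx : x ∈ closure Ω)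
    (i j k : Fin d) : ContDiffAt ℝ 2 (fun y => S.H t y i j k) x := by
  have h := (hS.H_smooth t ht).contDiffAt hx
  exact contDiffAt_pi.1 (contDiffAt_pi.1 (contDiffAt_pi.1 h i) j) k

theorem contDiffAt_hyperS (hS : IsSmoothState T Ω M S) (hM : M.Admissible) (ht : t ∈ Ioo 0 T)
    (hx : x ∈ closure Ω) (i j k : Fin d) : ContDiffAt ℝ 2 (fun y => S.hyperS M t y i j k) x := by
  have hm : ∀ i, ContDiffAt ℝ 2 (fun y => S.m t y i) x := fun i =>
    (contDiffAt_space_of_joint (f := fun s y => S.m s y i) (hS.contDiffAt_m ht hx i)).of_le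
      (WithTop.coe_le_coe.2 le_top)
  have hg : ∀ i k, ContDiffAt ℝ 2 (fun y => gradV (S.m t) y i k) x := fun i k =>
    (contDiffAt_space_of_joint (f := fun s y => gradV (S.m s) y i k)
      (hS.contDiffAt_gradV_m ht hx i k)).of_le (WithTop.coe_le_coe.2 le_top)
  exact (contDiffAt_space_of_joint (f := fun s y => S.κact M s y)
    (hS.contDiffAt_κact hM ht hx)).mul
      ((((hm j).mul (hg i k)).sub ((hm i).mul (hg j k))).div_const 2)

theorem contDiffAt_hyper (hS : IsSmoothState T Ω M S) (hM : M.Admissible) (ht : t ∈ Ioo 0 T)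
    (hx : x ∈ closure Ω) (i j k : Fin d) : ContDiffAt ℝ 2 (fun y => S.hyper M t y i j k) x :=
  (hS.contDiffAt_H ht hx i j k).add (hS.contDiffAt_hyperS hM ht hx i j k)

theorem contDiffAt_divT_hyper (hS : IsSmoothState T Ω M S) (hM : M.Admissible)
    (ht : t ∈ Ioo 0 T) (hx : x ∈ closure Ω) (i j : Fin d) :
    ContDiffAt ℝ 1 (fun y => divT (fun z => S.hyper M t z) y i j) x := by
  have h : ContDiffAt ℝ 1 (fun y => ∑ k, pd k (fun z => S.hyper M t z i j k) y) x :=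
    ContDiffAt.sum fun k _ => contDiffAt_pd (m := 1) (hS.contDiffAt_hyper hM ht hx i j k)
      (by norm_num) k
  exact h

theorem contDiffAt_stress (hS : IsSmoothState T Ω M S) (hM : M.Admissible)
    (hL : SmoothUpTo 1 T Ω L.hext) (ht : t ∈ Ioo 0 T) (hx : x ∈ closure Ω) (i j : Fin d) :
    ContDiffAt ℝ 1 (fun y => S.stress M L t y i j) x := by
  have hF : ∀ i j, ContDiffAt ℝ 1 (fun y => S.F t y i j) x := fun i j =>
    (contDiffAt_space_of_joint (f := fun s y => S.F s y i j) (hS.contDiffAt_F ht hx i j)).of_le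
      (WithTop.coe_le_coe.2 le_top)
  have hm : ∀ i, ContDiffAt ℝ 1 (fun y => S.m t y i) x := fun i =>
    (contDiffAt_space_of_joint (f := fun s y => S.m s y i) (hS.contDiffAt_m ht hx i)).of_le
      (WithTop.coe_le_coe.2 le_top)
  have hg : ∀ i k, ContDiffAt ℝ 1 (fun y => gradV (S.m t) y i k) x := fun i k =>
    (contDiffAt_space_of_joint (f := fun s y => gradV (S.m s) y i k)
      (hS.contDiffAt_gradV_m ht hx i k)).of_le (WithTop.coe_le_coe.2 le_top)
  have hJ : ContDiffAt ℝ 1 (fun y => (S.F t y).det) x :=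
    (contDiffAt_space_of_joint (f := fun s y => (S.F s y).det) (hS.contDiffAt_det ht hx)).of_le
      (WithTop.coe_le_coe.2 le_top)
  have hJ0 := hS.det_ne_zero ht hx
  have hκa : ContDiffAt ℝ 1 (fun y => S.κact M t y) x :=
    (contDiffAt_space_of_joint (f := fun s y => S.κact M s y)
      (hS.contDiffAt_κact hM ht hx)).of_le (by norm_num)
  have hT : ContDiffAt ℝ 1 (fun y => S.stressT M t y i j) x := by
    simp only [State.stressT, Matrix.mul_apply, Matrix.add_apply, Matrix.smul_apply, smul_eq_mul,
      Matrix.transpose_apply, frobenius_norm_sq]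
    refine ContDiffAt.sum fun k _ => ContDiffAt.mul (ContDiffAt.add (ContDiffAt.mul
      (contDiffAt_const.div hJ hJ0) (ContDiffAt.add ?_ ?_)) (ContDiffAt.mul
      (ContDiffAt.div (ContDiffAt.sum fun i _ => ContDiffAt.sum fun j _ => (hg i j).pow 2)
        (contDiffAt_const.mul hJ) (mul_ne_zero two_ne_zero hJ0)) ?_)) (hF j k)
    · exact contDiffAt_space_of_joint (f := fun s y => M.φF (S.F s y) (S.m s y) i k)
        (hS.contDiffAt_φF hM ht hx i k)
    · exact contDiffAt_space_of_joint (f := fun s y => M.ζF (S.F s y) (S.m s y) (S.θ s y) i k)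
        (hS.contDiffAt_ζF hM ht hx i k)
    · exact contDiffAt_space_of_joint (f := fun s y => dMat M.κ (S.F s y) i k)
        (hS.contDiffAt_dκ hM ht hx i k)
  have hK : ContDiffAt ℝ 1 (fun y => S.stressK M t y i j) x := by
    simp only [State.stressK, Matrix.neg_apply, Matrix.smul_apply, Matrix.mul_apply, smul_eq_mul,
      Matrix.transpose_apply]
    exact (hκa.mul (ContDiffAt.sum fun k _ => (hg k i).mul (hg k j))).neg
  have hb : ∀ i, ContDiffAt ℝ 1 (fun y => ((1 / (S.F t y).det) •
      M.ψm (S.F t y) (S.m t y) (S.θ t y) - M.μ₀ • S.field L t y) i) x := fun i =>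
    ((contDiffAt_const.div hJ hJ0).mul
      (contDiffAt_space_of_joint (f := fun s y => M.ψm (S.F s y) (S.m s y) (S.θ s y) i)
        (hS.contDiffAt_ψm hM ht hx i))).sub (contDiffAt_const.mul
      (contDiffAt_space_of_joint (f := fun s y => S.field L s y i)
        (hS.contDiffAt_field hL ht hx i)))
  have hSk : ContDiffAt ℝ 1 (fun y => S.stressS M L t y i j) x :=
    contDiffAt_const.mul (((hb i).mul (hm j)).sub ((hb j).mul (hm i)))
  exact (((hT.add hK).add hSk).add (hS.contDiffAt_D ht hx i j)).sub
    (hS.contDiffAt_divT_hyper hM ht hx i j)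

end IsSmoothState

/-! ### The material derivative -/

/-- The derivative of a scalar field along the motion. -/
def State.matD {d : ℕ} (S : State d) (f : ℝ → Vec d → ℝ) (t : ℝ) (x : Vec d) : ℝ :=
  fderiv ℝ (joint f) (t, x) (1, S.v t x)

section MatD

variable {d : ℕ} {T : ℝ} {Ω : Set (Vec d)} {M : Material d} {L : Loads d} {S : State d}
  {t : ℝ} {x : Vec d} {f g : ℝ → Vec d → ℝ}

theorem matD_mul (hf : DifferentiableAt ℝ (joint f) (t, x))
    (hg : DifferentiableAt ℝ (joint g) (t, x)) :
    S.matD (fun s y => f s y * g s y) t x = S.matD f t x * g t x + f t x * S.matD g t x := by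
  have h : HasFDerivAt (joint fun s y => f s y * g s y) _ (t, x) :=
    hf.hasFDerivAt.mul hg.hasFDerivAt
  rw [State.matD, h.fderiv]
  simp [State.matD, joint]
  ring

theorem matD_add (hf : DifferentiableAt ℝ (joint f) (t, x))
    (hg : DifferentiableAt ℝ (joint g) (t, x)) :
    S.matD (fun s y => f s y + g s y) t x = S.matD f t x + S.matD g t x := by
  have h : HasFDerivAt (joint fun s y => f s y + g s y) _ (t, x) :=
    hf.hasFDerivAt.add hg.hasFDerivAt
  rw [State.matD, h.fderiv]
  rfl

theorem matD_div (hf : DifferentiableAt ℝ (joint f) (t, x))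
    (hg : DifferentiableAt ℝ (joint g) (t, x)) (h0 : g t x ≠ 0) :
    S.matD (fun s y => f s y / g s y) t x =
      (S.matD f t x * g t x - f t x * S.matD g t x) / g t x ^ 2 := by
  have hdiv : DifferentiableAt ℝ (joint fun s y => f s y / g s y) (t, x) := by
    simp only [div_eq_mul_inv]
    exact hf.mul (hg.fun_inv h0)
  have h := matD_mul (S := S) (f := fun s y => f s y / g s y) (g := g) hdiv hg
  have h1 : S.matD (fun s y => f s y / g s y * g s y) t x = S.matD f t x := by
    have : (joint fun s y => f s y / g s y * g s y) =ᶠ[𝓝 (t, x)] joint f := by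
      filter_upwards [hg.continuousAt.eventually_ne (y := 0) h0] with q hq
      exact div_mul_cancel₀ _ hq
    rw [State.matD, this.fderiv_eq, State.matD]
  rw [h1] at h
  rw [h]
  field_simp
  ring

theorem matD_const_mul (hf : DifferentiableAt ℝ (joint f) (t, x)) (c : ℝ) :
    S.matD (fun s y => c * f s y) t x = c * S.matD f t x := by
  have h : HasFDerivAt (joint fun s y => c * f s y) _ (t, x) := hf.hasFDerivAt.const_mul c
  rw [State.matD, h.fderiv]
  simp [State.matD]

theorem matD_sum {ι : Type*} (s : Finset ι) {F : ι → ℝ → Vec d → ℝ}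
    (hF : ∀ i ∈ s, DifferentiableAt ℝ (joint (F i)) (t, x)) :
    S.matD (fun r y => ∑ i ∈ s, F i r y) t x = ∑ i ∈ s, S.matD (F i) t x := by
  have h : HasFDerivAt (joint fun r y => ∑ i ∈ s, F i r y) _ (t, x) :=
    HasFDerivAt.fun_sum fun i hi => (hF i hi).hasFDerivAt
  rw [State.matD, h.fderiv]
  simp [State.matD]

theorem matD_eq (hf : DifferentiableAt ℝ (joint f) (t, x)) :
    S.matD f t x = deriv (fun s => f s x) t + ∑ k, S.v t x k * pd k (f t) x :=
  fderiv_joint_apply hf _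

theorem deriv_apply {a : ℝ → Vec d} (ha : DifferentiableAt ℝ a t) (i : Fin d) :
    deriv a t i = deriv (fun s => a s i) t :=
  ((EuclideanSpace.proj (𝕜 := ℝ) i).hasFDerivAt.comp_hasDerivAt t ha.hasDerivAt).deriv.symm

theorem fderiv_entry {E : Type*} [NormedAddCommGroup E] [NormedSpace ℝ E] {A : E → Mat d} {q : E}
    (hA : DifferentiableAt ℝ A q) (v : E) (i j : Fin d) :
    fderiv ℝ A q v i j = fderiv ℝ (fun y => A y i j) q v := by
  have h : HasFDerivAt (fun y => A y i j) _ q :=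
    (LinearMap.toContinuousLinearMap (Matrix.entryLinearMap ℝ ℝ i j)).hasFDerivAt.comp q
      hA.hasFDerivAt
  rw [h.fderiv]
  rfl

theorem fderiv_coord {E : Type*} [NormedAddCommGroup E] [NormedSpace ℝ E] {a : E → Vec d} {q : E}
    (ha : DifferentiableAt ℝ a q) (v : E) (i : Fin d) :
    fderiv ℝ a q v i = fderiv ℝ (fun y => a y i) q v := by
  have h : HasFDerivAt (fun y => a y i) _ q :=
    (EuclideanSpace.proj (𝕜 := ℝ) i).hasFDerivAt.comp q ha.hasFDerivAt
  rw [h.fderiv]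
  rfl

namespace IsSmoothState

theorem differentiableAt_v (hS : IsSmoothState T Ω M S) (ht : t ∈ Ioo 0 T) (hx : x ∈ closure Ω)
    (i : Fin d) : DifferentiableAt ℝ (fun y => S.v t y i) x :=
  (contDiffAt_space_of_joint (f := fun s y => S.v s y i)
    (hS.contDiffAt_v ht hx i)).differentiableAt (by simp)

theorem differentiableAt_m (hS : IsSmoothState T Ω M S) (ht : t ∈ Ioo 0 T) (hx : x ∈ closure Ω)
    (i : Fin d) : DifferentiableAt ℝ (fun y => S.m t y i) x :=
  (contDiffAt_space_of_joint (f := fun s y => S.m s y i)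
    (hS.contDiffAt_m ht hx i)).differentiableAt (by simp)

/-- Reynolds' transport identity. -/
theorem deriv_add_div (hS : IsSmoothState T Ω M S) (ht : t ∈ Ioo 0 T) (hx : x ∈ closure Ω)
    (hf : DifferentiableAt ℝ (joint f) (t, x)) :
    deriv (fun s => f s x) t + ∑ k, pd k (fun y => f t y * S.v t y k) x =
      S.matD f t x + f t x * (gradV (S.v t) x).trace := by
  have hfx : DifferentiableAt ℝ (f t) x := by
    have := hf.comp x (f := fun y : Vec d => (t, y)) (by fun_prop)
    exact this
  rw [matD_eq hf, Matrix.trace, Finset.mul_sum, add_assoc, ← Finset.sum_add_distrib]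
  congr 1
  refine Finset.sum_congr rfl fun k _ => ?_
  rw [pd_mul hfx (hS.differentiableAt_v ht hx k)]
  simp only [Matrix.diag, gradV, Matrix.of_apply]
  ring

theorem fderiv_joint_m (hS : IsSmoothState T Ω M S) (ht : t ∈ Ioo 0 T) (hx : x ∈ closure Ω) :
    fderiv ℝ (joint S.m) (t, x) (1, S.v t x) = S.convm t x := by
  ext i
  have h1 : DifferentiableAt ℝ (joint S.m) (t, x) :=
    (hS.m_smooth.contDiffAt ht hx).differentiableAt (by simp)
  have h2 : DifferentiableAt ℝ (fun s => S.m s x) t :=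
    (contDiffAt_time_of_joint (hS.m_smooth.contDiffAt ht hx)).differentiableAt (by simp)
  rw [fderiv_coord h1]
  have h3 := fderiv_joint_apply (f := fun s y => S.m s y i) (v := S.v t x)
    ((hS.contDiffAt_m ht hx i).differentiableAt (by simp))
  refine h3.trans ?_
  rw [State.convm, PiLp.add_apply, State.dtm, deriv_apply h2]
  congr 1
  exact Finset.sum_congr rfl fun j _ => mul_comm _ _

theorem convm_apply (hS : IsSmoothState T Ω M S) (ht : t ∈ Ioo 0 T) (hx : x ∈ closure Ω)
    (i : Fin d) :
    S.convm t x i = deriv (fun s => S.m s x i) t + ∑ l, gradV (S.m t) x i l * S.v t x l := by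
  have h2 : DifferentiableAt ℝ (fun s => S.m s x) t :=
    (contDiffAt_time_of_joint (hS.m_smooth.contDiffAt ht hx)).differentiableAt (by simp)
  rw [State.convm, PiLp.add_apply, State.dtm, deriv_apply h2]
  rfl

/-- The transport equation in material form, `Ḟ = (∇v)F`. It makes the rate of any function of `F` a
power against `∇v`. -/
theorem fderiv_joint_F (hS : IsSmoothState T Ω M S) (hB : BulkEquations Ω M L S t)
    (ht : t ∈ Ioo 0 T) (hx : x ∈ Ω) :
    fderiv ℝ (joint S.F) (t, x) (1, S.v t x) = gradV (S.v t) x * S.F t x := by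
  have hx' := subset_closure hx
  ext i j
  have h1 : DifferentiableAt ℝ (joint S.F) (t, x) :=
    (hS.F_smooth.contDiffAt ht hx').differentiableAt (by simp)
  rw [fderiv_entry h1]
  have h3 := fderiv_joint_apply (f := fun s y => S.F s y i j) (v := S.v t x)
    ((hS.contDiffAt_F ht hx' i j).differentiableAt (by simp))
  refine h3.trans ?_
  rw [hB.transport x hx i j]
  ring

/-- The chain rule for a function of the deformation gradient. -/
theorem matD_comp_F (hS : IsSmoothState T Ω M S) (hB : BulkEquations Ω M L S t)
    (ht : t ∈ Ioo 0 T) (hx : x ∈ Ω) {a : Mat d → ℝ} (ha : DifferentiableAt ℝ a (S.F t x)) :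
    S.matD (fun s y => a (S.F s y)) t x =
      fderiv ℝ a (S.F t x) (gradV (S.v t) x * S.F t x) := by
  have h1 : DifferentiableAt ℝ (joint S.F) (t, x) :=
    (hS.F_smooth.contDiffAt ht (subset_closure hx)).differentiableAt (by simp)
  have h2 : HasFDerivAt (joint fun s y => a (S.F s y))
      ((fderiv ℝ a (S.F t x)).comp (fderiv ℝ (joint S.F) (t, x))) (t, x) :=
    HasFDerivAt.comp (t, x) (f := joint S.F) (g := a) ha.hasFDerivAt h1.hasFDerivAt
  rw [State.matD, h2.fderiv, ContinuousLinearMap.comp_apply, hS.fderiv_joint_F hB ht hx]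

theorem matD_det (hS : IsSmoothState T Ω M S) (hB : BulkEquations Ω M L S t)
    (ht : t ∈ Ioo 0 T) (hx : x ∈ Ω) :
    S.matD (fun s y => (S.F s y).det) t x = (S.F t x).det * (gradV (S.v t) x).trace :=
  (hS.matD_comp_F hB ht hx (a := Matrix.det) hasFDerivAt_det.differentiableAt).trans
    (fderiv_det_mul _ _)

theorem matD_κ (hS : IsSmoothState T Ω M S) (hM : M.Admissible) (hB : BulkEquations Ω M L S t)
    (ht : t ∈ Ioo 0 T) (hx : x ∈ Ω) :
    S.matD (fun s y => M.κ (S.F s y)) t x =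
      ddot (dMat M.κ (S.F t x) * (S.F t x)ᵀ) (gradV (S.v t) x) := by
  have h := hS.matD_comp_F hB ht hx (a := M.κ)
    ((hM.contDiffAt_κ (hS.det_pos t ht x (subset_closure hx))).differentiableAt two_ne_zero)
  rw [h, ← ddot_mul_right]
  exact fderiv_mat_apply _ _ _

theorem matD_φ (hS : IsSmoothState T Ω M S) (hM : M.Admissible) (hB : BulkEquations Ω M L S t)
    (ht : t ∈ Ioo 0 T) (hx : x ∈ Ω) :
    S.matD (fun s y => M.φ (S.F s y) (S.m s y)) t x =
      ddot (M.φF (S.F t x) (S.m t x) * (S.F t x)ᵀ) (gradV (S.v t) x) +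
        ⟪gradient (fun a => M.φ (S.F t x) a) (S.m t x), S.convm t x⟫ := by
  have hx' := subset_closure hx
  have hg : DifferentiableAt ℝ (fun q : Mat d × Vec d => M.φ q.1 q.2) (S.F t x, S.m t x) :=
    (hM.contDiffAt_φ (hS.det_pos t ht x hx')).differentiableAt two_ne_zero
  have h1 : HasFDerivAt (joint S.F) (fderiv ℝ (joint S.F) (t, x)) (t, x) :=
    ((hS.F_smooth.contDiffAt ht hx').differentiableAt (by simp)).hasFDerivAt
  have h2 : HasFDerivAt (joint S.m) (fderiv ℝ (joint S.m) (t, x)) (t, x) :=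
    ((hS.m_smooth.contDiffAt ht hx').differentiableAt (by simp)).hasFDerivAt
  have h3 : HasFDerivAt (joint fun s y => M.φ (S.F s y) (S.m s y)) _ (t, x) :=
    HasFDerivAt.comp (t, x) (f := fun q => (joint S.F q, joint S.m q))
      (g := fun q : Mat d × Vec d => M.φ q.1 q.2) hg.hasFDerivAt (h1.prodMk h2)
  rw [← ddot_mul_right, inner_gradient_left]
  refine (congrArg (fun A => A ((1 : ℝ), S.v t x)) h3.fderiv).trans ?_
  change fderiv ℝ (fun q : Mat d × Vec d => M.φ q.1 q.2) (S.F t x, S.m t x)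
    (fderiv ℝ (joint S.F) (t, x) (1, S.v t x), fderiv ℝ (joint S.m) (t, x) (1, S.v t x)) = _
  rw [hS.fderiv_joint_F hB ht hx, hS.fderiv_joint_m ht hx']
  have e1 := (fderiv_fst_eq hg (gradV (S.v t) x * S.F t x)).symm
  have e2 := (fderiv_snd_eq hg (S.convm t x)).symm
  have e3 := fderiv_mat_apply (fun G => M.φ G (S.m t x)) (S.F t x) (gradV (S.v t) x * S.F t x)
  have e4 : ((gradV (S.v t) x * S.F t x, S.convm t x) : Mat d × Vec d) =
      (gradV (S.v t) x * S.F t x, 0) + (0, S.convm t x) := by simp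
  rw [e4, map_add]
  exact congrArg₂ (· + ·) (e1.trans e3) e2

/-- The commutator of the material derivative and the spatial gradient of the magnetization. -/
theorem matD_gradV_m (hS : IsSmoothState T Ω M S) (ht : t ∈ Ioo 0 T) (hx : x ∈ Ω)
    (hΩ : IsOpen Ω) (i k : Fin d) :
    S.matD (fun s y => gradV (S.m s) y i k) t x = pd k (fun y => S.convm t y i) x -
      ∑ l, gradV (S.m t) x i l * gradV (S.v t) x l k := by
  have hx' := subset_closure hx
  have hm := hS.contDiffAt_m ht hx' i
  have hms : ContDiffAt ℝ 2 (fun y => S.m t y i) x :=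
    (contDiffAt_space_of_joint (f := fun s y => S.m s y i) hm).of_le (WithTop.coe_le_coe.2 le_top)
  have hg : ∀ l, DifferentiableAt ℝ (fun y => gradV (S.m t) y i l) x := fun l =>
    (contDiffAt_space_of_joint (f := fun s y => gradV (S.m s) y i l)
      (hS.contDiffAt_gradV_m ht hx' i l)).differentiableAt (by simp)
  have e1 : (fun y => S.convm t y i) =ᶠ[𝓝 x] fun y =>
      deriv (fun s => S.m s y i) t + ∑ l, gradV (S.m t) y i l * S.v t y l := by
    filter_upwards [hΩ.mem_nhds hx] with y hy
    exact hS.convm_apply ht (subset_closure hy) i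
  have hd : DifferentiableAt ℝ (fun y => deriv (fun s => S.m s y i) t) x :=
    (contDiffAt_space_of_joint (f := fun s y => deriv (fun r => S.m r y i) s)
      (hS.contDiffAt_deriv_m ht hx' i)).differentiableAt (by simp)
  have hv := fun l => hS.differentiableAt_v ht hx' l
  have hsum : DifferentiableAt ℝ (fun y => ∑ l, gradV (S.m t) y i l * S.v t y l) x :=
    DifferentiableAt.fun_sum fun l _ => (hg l).mul (hv l)
  rw [matD_eq ((hS.contDiffAt_gradV_m ht hx' i k).differentiableAt (by simp)),
    pd_congr e1, pd_add hd hsum,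
    pd_sum (F := fun l y => gradV (S.m t) y i l * S.v t y l) _ fun l _ => (hg l).mul (hv l)]
  rw [pd_deriv_comm (f := fun s y => S.m s y i) (hm.of_le (WithTop.coe_le_coe.2 le_top)),
    add_sub_assoc, ← Finset.sum_sub_distrib]
  congr 1
  refine Finset.sum_congr rfl fun l _ => ?_
  rw [pd_mul (hg l) (hv l)]
  have e2 : pd k (fun y => gradV (S.m t) y i l) x = pd l (fun y => gradV (S.m t) y i k) x :=
    pd_comm hms k l
  have e3 : gradV (S.v t) x l k = pd k (fun y => S.v t y l) x := rfl
  rw [e2, e3]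
  ring

end IsSmoothState

end MatD

/-! ### The dissipation -/

/-- For `1 ≤ p < 2` the exponent `p - 2` is negative, but at `a = 0` the factor `a ^ 2` annihilates
whatever value is assigned to the power, and the right side is zero because `p ≠ 0`. -/
theorem rpow_sub_two_mul_sq {p a : ℝ} (hp : 1 ≤ p) (ha : 0 ≤ a) : a ^ (p - 2) * a ^ 2 = a ^ p := by
  rcases ha.eq_or_lt with rfl | h
  · rw [Real.zero_rpow (show p ≠ 0 by linarith)]; simp
  · rw [← Real.rpow_natCast, ← Real.rpow_add h]; norm_num

/-- Taking the skew part is self-adjoint for the matrix product, so it can be moved onto `G`. The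
power of a skew stress is thereby the work on the spin part of the rate of `m`. -/
theorem ddot_skwPart_dyad {d : ℕ} (b m : Vec d) (G : Mat d) :
    ddot (skwPart (dyad b m)) G = ⟪b, mulV (skwPart G) m⟫ := by
  have h1 : ∀ A : Mat d, ddot (skwPart A) G = ddot A (skwPart G) := fun A => by
    have h2 : ddot Aᵀ G = ddot A Gᵀ := by rw [← ddot_transpose, Matrix.transpose_transpose]
    rw [skwPart, ddot_smul_left, ddot_sub_left, h2, ddot_comm A (skwPart G), skwPart,
      ddot_smul_left, ddot_sub_left, ddot_comm G, ddot_comm Gᵀ]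
  rw [h1]
  simp only [ddot, dyad, mulV, PiLp.inner_apply, RCLike.inner_apply, conj_trivial, Matrix.of_apply,
    Finset.sum_mul]
  exact Finset.sum_congr rfl fun i _ => Finset.sum_congr rfl fun j _ => by ring

/-- At `r = 0` every element of the ball gives zero. Dry friction therefore dissipates a definite
amount although `Dir` is multivalued. -/
theorem inner_mem_Dir {d : ℕ} {r δ : Vec d} (h : δ ∈ Dir r) : ⟪δ, r⟫ = ‖r‖ := by
  have h' : if r = 0 then ‖δ‖ ≤ 1 else δ = ‖r‖⁻¹ • r := h
  split_ifs at h' with h0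
  · simp [h0]
  · rw [h', real_inner_smul_left, real_inner_self_eq_norm_sq]
    have : ‖r‖ ≠ 0 := norm_ne_zero_iff.2 h0
    field_simp

section Dissipation

variable {d : ℕ} {T : ℝ} {Ω : Set (Vec d)} {M : Material d} {L : Loads d} {S : State d}
  {t : ℝ} {x : Vec d}

theorem IsSmoothState.ddot_D (hS : IsSmoothState T Ω M S) (hM : M.Admissible)
    (ht : t ∈ Ioo 0 T) (hx : x ∈ closure Ω) :
    ddot (S.D t x) (gradV (S.v t) x) = M.ν₁ * ‖S.strainRate t x‖ ^ M.p := by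
  rw [hS.D_eq t ht x hx, ddot_smul_left, State.strainRate,
    ← ddot_symPart_of_symm (transpose_symPart _), ddot_self, mul_assoc,
    rpow_sub_two_mul_sq hM.one_le_p (norm_nonneg _)]

theorem IsSmoothState.sum_H_mul_hessV (hS : IsSmoothState T Ω M S) (hM : M.Admissible)
    (ht : t ∈ Ioo 0 T) (hx : x ∈ closure Ω) :
    ∑ i, ∑ j, ∑ k, S.H t x i j k * hessV (S.v t) x i j k =
      M.ν₂ * tnorm (hessV (S.v t) x) ^ M.p := by
  have h0 : (0 : ℝ) ≤ ∑ i, ∑ j, ∑ k, hessV (S.v t) x i j k ^ 2 := by positivity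
  rw [← rpow_sub_two_mul_sq hM.one_le_p (show 0 ≤ tnorm (hessV (S.v t) x) from
      Real.sqrt_nonneg _),
    ← mul_assoc, show tnorm (hessV (S.v t) x) ^ 2 = _ from Real.sq_sqrt h0,
    hS.H_eq t ht x hx]
  simp only [Pi.smul_apply, smul_eq_mul, Finset.mul_sum]
  exact Finset.sum_congr rfl fun i _ => Finset.sum_congr rfl fun j _ =>
    Finset.sum_congr rfl fun k _ => by ring

/-- The magnetic driving force, conjugate to the corotational derivative. -/
def State.drive (S : State d) (M : Material d) (L : Loads d) (t : ℝ) (x : Vec d) : Vec d :=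
  (1 / (S.F t x).det) • M.ψm (S.F t x) (S.m t x) (S.θ t x) - M.μ₀ • S.field L t x
    - divM (fun y => S.κact M t y • gradV (S.m t) y) x

/-- The driving force is minus the right-hand side of the flow rule. Tested with the corotational
rate, the gyromagnetic term drops out and the two dissipative terms remain. -/
theorem BulkEquations.inner_drive_corotm (hB : BulkEquations Ω M L S t) (hd : d = 2 ∨ d = 3)
    (hx : x ∈ Ω) :
    ⟪S.drive M L t x, S.corotm t x⟫ =
      -(M.τ * ‖S.corotm t x‖ ^ 2 + M.hc (S.F t x) (S.θ t x) * ‖S.corotm t x‖) := by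
  obtain ⟨δ, hδ, h⟩ := hB.flowRule x hx
  have h1 := congrArg (fun a => ⟪a, S.corotm t x⟫) h
  simp only [inner_add_left, inner_sub_left, real_inner_smul_left, inner_mem_Dir hδ,
    inner_cross_self hd, real_inner_self_eq_norm_sq] at h1
  simp only [State.drive, inner_sub_left, real_inner_smul_left]
  linarith

/-- The first-order products `∂_k m_i ∂_k m_j` are symmetric in `i, j` and cancel, so only the
divergence of `κ∇m/det F` survives. -/
theorem IsSmoothState.divT_hyperS (hS : IsSmoothState T Ω M S) (hM : M.Admissible)
    (ht : t ∈ Ioo 0 T) (hx : x ∈ closure Ω) :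
    divT (fun y => S.hyperS M t y) x =
      skwPart (dyad (divM (fun y => S.κact M t y • gradV (S.m t) y) x) (S.m t x)) := by
  ext i j
  have hm := fun i => hS.differentiableAt_m ht hx i
  have hκ : DifferentiableAt ℝ (fun y => S.κact M t y) x :=
    (contDiffAt_space_of_joint (f := fun s y => S.κact M s y)
      (hS.contDiffAt_κact hM ht hx)).differentiableAt two_ne_zero
  have hg : ∀ i k, DifferentiableAt ℝ (fun y => gradV (S.m t) y i k) x := fun i k =>
    (contDiffAt_space_of_joint (f := fun s y => gradV (S.m s) y i k)
      (hS.contDiffAt_gradV_m ht hx i k)).differentiableAt (by simp)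
  have hc : ∀ i k, DifferentiableAt ℝ (fun y => S.κact M t y * gradV (S.m t) y i k) x :=
    fun i k => hκ.mul (hg i k)
  have e : ∀ k, pd k (fun y => S.hyperS M t y i j k) x = 1 / 2 *
      (pd k (fun y => S.κact M t y * gradV (S.m t) y i k) x * S.m t x j -
        pd k (fun y => S.κact M t y * gradV (S.m t) y j k) x * S.m t x i) := fun k => by
    have e1 : (fun y => S.hyperS M t y i j k) = fun y => 1 / 2 *
        (S.κact M t y * gradV (S.m t) y i k * S.m t y j -
          S.κact M t y * gradV (S.m t) y j k * S.m t y i) := by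
      funext y; simp only [State.hyperS]; ring
    have e2 : ∀ i, pd k (fun y => S.m t y i) x = gradV (S.m t) x i k := fun _ => rfl
    rw [e1, pd_mul (differentiableAt_const _) (((hc i k).fun_mul (hm j)).fun_sub ((hc j k).fun_mul (hm i))),
      pd_const, pd_sub ((hc i k).fun_mul (hm j)) ((hc j k).fun_mul (hm i)), pd_mul (hc i k) (hm j),
      pd_mul (hc j k) (hm i), e2, e2]
    ring
  simp only [divT, Matrix.of_apply, e, skwPart, dyad, divM, Matrix.smul_apply, Matrix.sub_apply,
    Matrix.transpose_apply, smul_eq_mul, Finset.sum_mul, ← Finset.mul_sum,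
    Finset.sum_sub_distrib]

theorem IsSmoothState.divT_hyper (hS : IsSmoothState T Ω M S) (hM : M.Admissible)
    (ht : t ∈ Ioo 0 T) (hx : x ∈ closure Ω) :
    divT (fun y => S.hyper M t y) x =
      divT (fun y => S.H t y) x + divT (fun y => S.hyperS M t y) x := by
  ext i j
  simp only [divT, Matrix.of_apply, Matrix.add_apply, ← Finset.sum_add_distrib]
  exact Finset.sum_congr rfl fun k _ =>
    pd_add ((hS.contDiffAt_H ht hx i j k).differentiableAt two_ne_zero)
      ((hS.contDiffAt_hyperS hM ht hx i j k).differentiableAt two_ne_zero) k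

theorem ddot_stressT (S : State d) (M : Material d) (t : ℝ) (x : Vec d) (G : Mat d) :
    ddot (S.stressT M t x) G =
      ddot (M.φF (S.F t x) (S.m t x) * (S.F t x)ᵀ) G / (S.F t x).det +
      ddot (M.ζF (S.F t x) (S.m t x) (S.θ t x) * (S.F t x)ᵀ) G / (S.F t x).det +
      ‖gradV (S.m t) x‖ ^ 2 / (2 * (S.F t x).det) *
        ddot (dMat M.κ (S.F t x) * (S.F t x)ᵀ) G := by
  simp only [State.stressT, Matrix.add_mul, Matrix.smul_mul, ddot_add_left, ddot_smul_left]
  ring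

theorem ddot_stressK (S : State d) (M : Material d) (t : ℝ) (x : Vec d) (G : Mat d) :
    ddot (S.stressK M t x) G = -(S.κact M t x * ∑ i, ∑ k, gradV (S.m t) x i k *
      ∑ l, gradV (S.m t) x i l * G l k) := by
  rw [State.stressK, ddot_neg_left, ddot_smul_left]
  congr 2
  simp only [ddot, Matrix.mul_apply, Matrix.transpose_apply, Finset.sum_mul, Finset.mul_sum]
  calc _ = ∑ a, ∑ i, ∑ b, gradV (S.m t) x i a * gradV (S.m t) x i b * G a b :=
        Finset.sum_congr rfl fun a _ => Finset.sum_comm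
    _ = ∑ i, ∑ a, ∑ b, gradV (S.m t) x i a * gradV (S.m t) x i b * G a b := Finset.sum_comm
    _ = _ := Finset.sum_congr rfl fun i _ => by
        rw [Finset.sum_comm]
        exact Finset.sum_congr rfl fun k _ => Finset.sum_congr rfl fun l _ => by ring

/-- Frame indifference makes the thermal Kirchhoff stress symmetric, so the adiabatic power in the
heat equation matches the thermal part of the mechanical power. -/
theorem Material.Admissible.ddot_ζF_strainRate (hM : M.Admissible) (hS : IsSmoothState T Ω M S)
    (ht : t ∈ Ioo 0 T) (hx : x ∈ closure Ω) :
    ddot (M.ζF (S.F t x) (S.m t x) (S.θ t x) * (S.F t x)ᵀ) (S.strainRate t x) =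
      ddot (M.ζF (S.F t x) (S.m t x) (S.θ t x) * (S.F t x)ᵀ) (gradV (S.v t) x) := by
  have hF := hS.det_pos t ht x hx
  have hθ := hS.θ_mem t ht x hx
  have hg : DifferentiableAt ℝ (fun G => M.ζ G (S.m t x) (S.θ t x)) (S.F t x) :=
    (ContDiffAt.comp (S.F t x) (hM.contDiffAt_ζ (m := S.m t x) hF hθ)
      (f := fun G : Mat d => (G, S.m t x, S.θ t x))
      (contDiffAt_id.prodMk contDiffAt_const)).differentiableAt two_ne_zero
  exact ddot_symPart_of_symm (transpose_dMat_mul_of_frame hg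
    fun Q hQ => hM.ζ_frame Q hQ _ hF _ _ hθ) _

/-- The power of the stress. -/
theorem IsSmoothState.ddot_stress (hS : IsSmoothState T Ω M S) (hM : M.Admissible)
    (ht : t ∈ Ioo 0 T) (hx : x ∈ closure Ω) :
    ddot (S.stress M L t x) (gradV (S.v t) x) =
      ddot (S.stressT M t x) (gradV (S.v t) x) + ddot (S.stressK M t x) (gradV (S.v t) x) +
      ⟪S.drive M L t x, mulV (skwPart (gradV (S.v t) x)) (S.m t x)⟫ +
      M.ν₁ * ‖S.strainRate t x‖ ^ M.p -
      ddot (divT (fun y => S.H t y) x) (gradV (S.v t) x) := by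
  -- Rewriting the skew stress through the driving force produces precisely the divergence of the
  -- skew hyperstress, which is then cancelled by the term subtracted in the total stress.
  have h1 : S.stressS M L t x = skwPart (dyad (S.drive M L t x) (S.m t x)) +
      divT (fun y => S.hyperS M t y) x := by
    rw [hS.divT_hyperS hM ht hx]
    ext i j
    simp only [State.stressS, State.drive, skwPart, dyad, Matrix.add_apply, Matrix.smul_apply,
      Matrix.sub_apply, Matrix.transpose_apply, Matrix.of_apply, PiLp.sub_apply, smul_eq_mul]
    ring
  rw [State.stress, hS.divT_hyper hM ht hx, h1]
  simp only [ddot_sub_left, ddot_add_left, ddot_skwPart_dyad, hS.ddot_D hM ht hx]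
  ring

end Dissipation

/-! ### The local energy balance -/

section Balance

variable {d : ℕ} {T : ℝ} {Ω : Set (Vec d)} {M : Material d} {L : Loads d} {S : State d}
  {t : ℝ} {x : Vec d}

namespace IsSmoothState

theorem differentiableAt_ρ (hS : IsSmoothState T Ω M S) (ht : t ∈ Ioo 0 T)
    (hx : x ∈ closure Ω) : DifferentiableAt ℝ (joint S.ρ) (t, x) :=
  (hS.ρ_smooth.contDiffAt ht hx).differentiableAt (by simp)

theorem differentiableAt_joint_v (hS : IsSmoothState T Ω M S) (ht : t ∈ Ioo 0 T)
    (hx : x ∈ closure Ω) (i : Fin d) :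
    DifferentiableAt ℝ (joint fun s y => S.v s y i) (t, x) :=
  (hS.contDiffAt_v ht hx i).differentiableAt (by simp)

theorem differentiableAt_stress (hS : IsSmoothState T Ω M S) (hM : M.Admissible)
    (hL : SmoothUpTo 1 T Ω L.hext) (ht : t ∈ Ioo 0 T) (hx : x ∈ closure Ω) (i j : Fin d) :
    DifferentiableAt ℝ (fun y => S.stress M L t y i j) x :=
  (hS.contDiffAt_stress hM hL ht hx i j).differentiableAt one_ne_zero

theorem matD_ρ (hS : IsSmoothState T Ω M S) (hB : BulkEquations Ω M L S t)
    (ht : t ∈ Ioo 0 T) (hx : x ∈ Ω) :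
    S.matD S.ρ t x + S.ρ t x * (gradV (S.v t) x).trace = 0 := by
  have hx' := subset_closure hx
  rw [← hS.deriv_add_div ht hx' (hS.differentiableAt_ρ ht hx')]
  have h1 := hB.mass x hx
  have h2 : divV (fun y => S.ρ t y • S.v t y) x = ∑ k, pd k (fun y => S.ρ t y * S.v t y k) x := rfl
  rw [h2] at h1
  linarith

/-- By the product rule the terms with `∇h` cancel and `-μ₀(∇m)ᵀh` is left, whose power is the
convective part of `-μ₀ h · ṁ`. -/
theorem magForce_apply (hS : IsSmoothState T Ω M S) (hL : SmoothUpTo 1 T Ω L.hext)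
    (ht : t ∈ Ioo 0 T) (hx : x ∈ closure Ω) (i : Fin d) :
    S.magForce M L t x i = -(M.μ₀ * ∑ j, S.field L t x j * gradV (S.m t) x j i) := by
  have hm := fun j => hS.differentiableAt_m ht hx j
  have hf : ∀ j, DifferentiableAt ℝ (fun y => S.field L t y j) x := fun j =>
    (contDiffAt_space_of_joint (f := fun s y => S.field L s y j)
      (hS.contDiffAt_field hL ht hx j)).differentiableAt one_ne_zero
  have e1 : (fun y => ⟪S.field L t y, S.m t y⟫) = fun y => ∑ j, S.field L t y j * S.m t y j := by
    funext y
    simp only [PiLp.inner_apply, RCLike.inner_apply, conj_trivial]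
    exact Finset.sum_congr rfl fun j _ => mul_comm _ _
  have e2 : pd i (fun y => ⟪S.field L t y, S.m t y⟫) x =
      ∑ j, (pd i (fun y => S.field L t y j) x * S.m t x j +
        S.field L t x j * gradV (S.m t) x j i) := by
    rw [e1, pd_sum (F := fun j y => S.field L t y j * S.m t y j) _ fun j _ =>
      (hf j).fun_mul (hm j)]
    exact Finset.sum_congr rfl fun j _ => pd_mul (hf j) (hm j) i
  have e3 : S.magForce M L t x i = M.μ₀ * (∑ j, pd i (fun y => S.field L t y j) x * S.m t x j) -
      M.μ₀ * pd i (fun y => ⟪S.field L t y, S.m t y⟫) x := by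
    rw [← gradient_apply]; rfl
  rw [e3, e2, Finset.sum_add_distrib]
  ring

/-- Subtracting `v_i` times the mass balance from the conservative form leaves the convective form
of the momentum equation. -/
theorem momentum_apply (hS : IsSmoothState T Ω M S) (hM : M.Admissible)
    (hL : SmoothUpTo 1 T Ω L.hext) (hB : BulkEquations Ω M L S t)
    (ht : t ∈ Ioo 0 T) (hx : x ∈ Ω) (i : Fin d) :
    S.ρ t x * S.matD (fun s y => S.v s y i) t x =
      ∑ k, pd k (fun y => S.stress M L t y i k) x + S.magForce M L t x i +
        S.ρ t x * L.g t x i := by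
  have hx' := subset_closure hx
  have hρ := hS.differentiableAt_ρ ht hx'
  have hv := hS.differentiableAt_joint_v ht hx' i
  have hρv : DifferentiableAt ℝ (joint fun s y => S.ρ s y * S.v s y i) (t, x) := hρ.fun_mul hv
  have h1 := hS.deriv_add_div ht hx' hρv
  rw [matD_mul hρ hv] at h1
  have h2 : DifferentiableAt ℝ (fun s => S.ρ s x • S.v s x) t :=
    ((contDiffAt_time_of_joint (hS.ρ_smooth.contDiffAt ht hx')).differentiableAt (by simp)).fun_smul
      ((contDiffAt_time_of_joint (hS.v_smooth.contDiffAt ht hx')).differentiableAt (by simp))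
  have h3 := congrArg (fun a : Vec d => a i) (hB.momentum x hx)
  simp only [PiLp.add_apply] at h3
  rw [deriv_apply h2] at h3
  have hρx : DifferentiableAt ℝ (S.ρ t) x :=
    (contDiffAt_space_of_joint (hS.ρ_smooth.contDiffAt ht hx')).differentiableAt (by simp)
  have h4 : divM (fun y => S.stress M L t y - S.ρ t y • dyad (S.v t y) (S.v t y)) x i =
      ∑ k, pd k (fun y => S.stress M L t y i k) x -
        ∑ k, pd k (fun y => S.ρ t y * S.v t y i * S.v t y k) x := by
    rw [← Finset.sum_sub_distrib, divM]
    change ∑ k, pd k (fun y => (S.stress M L t y - S.ρ t y • dyad (S.v t y) (S.v t y)) i k) x = _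
    refine Finset.sum_congr rfl fun k _ => ?_
    have e : (fun y => (S.stress M L t y - S.ρ t y • dyad (S.v t y) (S.v t y)) i k) =
        fun y => S.stress M L t y i k - S.ρ t y * S.v t y i * S.v t y k := by
      funext y
      simp only [Matrix.sub_apply, Matrix.smul_apply, dyad, Matrix.of_apply, smul_eq_mul]
      ring
    rw [e]
    exact pd_sub (hS.differentiableAt_stress hM hL ht hx' i k)
      ((hρx.fun_mul (hS.differentiableAt_v ht hx' i)).fun_mul (hS.differentiableAt_v ht hx' k)) k
  rw [h4] at h3
  have h5 : deriv (fun s => (S.ρ s x • S.v s x) i) t =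
      deriv (fun s => S.ρ s x * S.v s x i) t := rfl
  have h6 : (S.ρ t x • L.g t x) i = S.ρ t x * L.g t x i := rfl
  rw [h5, h6] at h3
  have h7 := congrArg (· * S.v t x i) (hS.matD_ρ hB ht hx)
  simp only [zero_mul] at h7
  linarith

/-- The convective momentum equation is multiplied by `v`; the mass balance cancels the change of
density against the volume term. -/
theorem matD_kinetic (hS : IsSmoothState T Ω M S) (hM : M.Admissible)
    (hL : SmoothUpTo 1 T Ω L.hext) (hB : BulkEquations Ω M L S t)
    (ht : t ∈ Ioo 0 T) (hx : x ∈ Ω) :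
    S.matD (fun s y => S.ρ s y / 2 * ‖S.v s y‖ ^ 2) t x +
        S.ρ t x / 2 * ‖S.v t x‖ ^ 2 * (gradV (S.v t) x).trace =
      ∑ i, S.v t x i * ∑ k, pd k (fun y => S.stress M L t y i k) x -
        M.μ₀ * ∑ j, S.field L t x j * ∑ i, gradV (S.m t) x j i * S.v t x i +
        S.ρ t x * ⟪L.g t x, S.v t x⟫ := by
  have hx' := subset_closure hx
  have hρ := hS.differentiableAt_ρ ht hx'
  have hv := hS.differentiableAt_joint_v ht hx'
  have hv2 : ∀ i, DifferentiableAt ℝ (joint fun s y => S.v s y i * S.v s y i) (t, x) :=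
    fun i => (hv i).fun_mul (hv i)
  have hvs : DifferentiableAt ℝ (joint fun s y => ∑ i, S.v s y i * S.v s y i) (t, x) :=
    DifferentiableAt.fun_sum fun i _ => hv2 i
  have e1 : (fun s y => S.ρ s y / 2 * ‖S.v s y‖ ^ 2) =
      fun s y => 1 / 2 * (S.ρ s y * ∑ i, S.v s y i * S.v s y i) := by
    funext s y
    rw [EuclideanSpace.real_norm_sq_eq]
    simp only [sq]
    ring
  have hm : ∑ i, S.v t x i * S.magForce M L t x i =
      -(M.μ₀ * ∑ j, S.field L t x j * ∑ i, gradV (S.m t) x j i * S.v t x i) := by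
    simp only [hS.magForce_apply hL ht hx', Finset.mul_sum, ← Finset.sum_neg_distrib]
    rw [Finset.sum_comm]
    exact Finset.sum_congr rfl fun j _ => Finset.sum_congr rfl fun i _ => by ring
  have hg : S.ρ t x * ⟪L.g t x, S.v t x⟫ = ∑ i, S.v t x i * (S.ρ t x * L.g t x i) := by
    simp only [PiLp.inner_apply, RCLike.inner_apply, conj_trivial, Finset.mul_sum]
    exact Finset.sum_congr rfl fun i _ => by ring
  have hN : ‖S.v t x‖ ^ 2 = ∑ i, S.v t x i * S.v t x i := by
    rw [EuclideanSpace.real_norm_sq_eq]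
    simp only [sq]
  have hsum : ∑ i, S.v t x i * (S.ρ t x * S.matD (fun s y => S.v s y i) t x) =
      S.ρ t x * ∑ i, S.v t x i * S.matD (fun s y => S.v s y i) t x := by
    rw [Finset.mul_sum]
    exact Finset.sum_congr rfl fun i _ => by ring
  have h2 : S.matD (fun s y => ∑ i, S.v s y i * S.v s y i) t x =
      2 * ∑ i, S.v t x i * S.matD (fun s y => S.v s y i) t x := by
    rw [matD_sum (F := fun i s y => S.v s y i * S.v s y i) _ fun i _ => hv2 i, Finset.mul_sum]
    exact Finset.sum_congr rfl fun i _ => by rw [matD_mul (hv i) (hv i)]; ring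
  have h3 := hS.matD_ρ hB ht hx
  have h4 : ∑ i, S.v t x i * (S.ρ t x * S.matD (fun s y => S.v s y i) t x) =
      ∑ i, S.v t x i * ∑ k, pd k (fun y => S.stress M L t y i k) x +
      ∑ i, S.v t x i * S.magForce M L t x i + ∑ i, S.v t x i * (S.ρ t x * L.g t x i) := by
    rw [← Finset.sum_add_distrib, ← Finset.sum_add_distrib]
    exact Finset.sum_congr rfl fun i _ => by rw [hS.momentum_apply hM hL hB ht hx i]; ring
  rw [hsum, hm, ← hg] at h4
  rw [e1, matD_const_mul (f := fun s y => S.ρ s y * ∑ i, S.v s y i * S.v s y i)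
    (hρ.fun_mul hvs), matD_mul hρ hvs, h2, hN]
  have h5 := congrArg (· * (1 / 2 * ∑ i, S.v t x i * S.v t x i)) h3
  simp only [zero_mul] at h5
  linarith

/-- A quantity per referential volume has no dilation term of its own: the rate of `det F` is `det
F` times `div v`, cancelling the compression term in Reynolds' identity. -/
theorem matD_div_det (hS : IsSmoothState T Ω M S) (hB : BulkEquations Ω M L S t)
    (ht : t ∈ Ioo 0 T) (hx : x ∈ Ω) {f : ℝ → Vec d → ℝ}
    (hf : DifferentiableAt ℝ (joint f) (t, x)) :
    S.matD (fun s y => f s y / (S.F s y).det) t x +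
      f t x / (S.F t x).det * (gradV (S.v t) x).trace = S.matD f t x / (S.F t x).det := by
  have hx' := subset_closure hx
  have h0 := hS.det_ne_zero ht hx'
  rw [matD_div (g := fun s y => (S.F s y).det) hf
    ((hS.contDiffAt_det ht hx').differentiableAt (by simp)) h0, hS.matD_det hB ht hx]
  field_simp
  ring

/-- Three sources: `κ'` gives its share of the stress `T`, `∇ṁ` gives the exchange power, and the
commutator of `∇` with the material derivative gives the Korteweg power. The factor `1/det F` is
absorbed by `matD_div_det`. -/
theorem matD_exchange (hS : IsSmoothState T Ω M S) (hM : M.Admissible) (hΩ : IsOpen Ω)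
    (hB : BulkEquations Ω M L S t) (ht : t ∈ Ioo 0 T) (hx : x ∈ Ω) :
    S.matD (fun s y => M.κ (S.F s y) * ‖gradV (S.m s) y‖ ^ 2 / (2 * (S.F s y).det)) t x +
        M.κ (S.F t x) * ‖gradV (S.m t) x‖ ^ 2 / (2 * (S.F t x).det) * (gradV (S.v t) x).trace =
      ‖gradV (S.m t) x‖ ^ 2 / (2 * (S.F t x).det) *
        ddot (dMat M.κ (S.F t x) * (S.F t x)ᵀ) (gradV (S.v t) x) +
      S.κact M t x * ∑ i, ∑ k, gradV (S.m t) x i k * pd k (fun y => S.convm t y i) x +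
      ddot (S.stressK M t x) (gradV (S.v t) x) := by
  have hx' := subset_closure hx
  have hg : ∀ i k, DifferentiableAt ℝ (joint fun s y => gradV (S.m s) y i k) (t, x) := fun i k =>
    (hS.contDiffAt_gradV_m ht hx' i k).differentiableAt (by simp)
  have hg2 : ∀ i k, DifferentiableAt ℝ (joint fun s y =>
      gradV (S.m s) y i k * gradV (S.m s) y i k) (t, x) := fun i k => (hg i k).fun_mul (hg i k)
  have hg3 : ∀ i, DifferentiableAt ℝ (joint fun s y =>
      ∑ k, gradV (S.m s) y i k * gradV (S.m s) y i k) (t, x) := fun i =>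
    DifferentiableAt.fun_sum fun k _ => hg2 i k
  have hN : DifferentiableAt ℝ (joint fun s y =>
      ∑ i, ∑ k, gradV (S.m s) y i k * gradV (S.m s) y i k) (t, x) :=
    DifferentiableAt.fun_sum fun i _ => hg3 i
  have hκ : DifferentiableAt ℝ (joint fun s y => M.κ (S.F s y)) (t, x) :=
    (hS.contDiffAt_κ hM ht hx').differentiableAt two_ne_zero
  have e1 : (fun s y => M.κ (S.F s y) * ‖gradV (S.m s) y‖ ^ 2 / (2 * (S.F s y).det)) =
      fun s y => 1 / 2 * (M.κ (S.F s y) *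
        ∑ i, ∑ k, gradV (S.m s) y i k * gradV (S.m s) y i k) / (S.F s y).det := by
    funext s y
    rw [frobenius_norm_sq, ← div_div]
    simp only [sq]
    ring
  have hκN : DifferentiableAt ℝ (joint fun s y => M.κ (S.F s y) *
      ∑ i, ∑ k, gradV (S.m s) y i k * gradV (S.m s) y i k) (t, x) := hκ.fun_mul hN
  have hκN' : DifferentiableAt ℝ (joint fun s y => 1 / 2 * (M.κ (S.F s y) *
      ∑ i, ∑ k, gradV (S.m s) y i k * gradV (S.m s) y i k)) (t, x) := hκN.const_mul _
  have h1 := hS.matD_div_det hB ht hx hκN'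
  rw [matD_const_mul hκN, matD_mul hκ hN, hS.matD_κ hM hB ht hx] at h1
  have h2 : S.matD (fun s y => ∑ i, ∑ k, gradV (S.m s) y i k * gradV (S.m s) y i k) t x =
      2 * (∑ i, ∑ k, gradV (S.m t) x i k * pd k (fun y => S.convm t y i) x -
        ∑ i, ∑ k, gradV (S.m t) x i k * ∑ l, gradV (S.m t) x i l * gradV (S.v t) x l k) := by
    rw [matD_sum (F := fun i s y => ∑ k, gradV (S.m s) y i k * gradV (S.m s) y i k) _
      fun i _ => hg3 i, ← Finset.sum_sub_distrib, Finset.mul_sum]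
    refine Finset.sum_congr rfl fun i _ => ?_
    rw [matD_sum (F := fun k s y => gradV (S.m s) y i k * gradV (S.m s) y i k) _
      fun k _ => hg2 i k, ← Finset.sum_sub_distrib, Finset.mul_sum]
    refine Finset.sum_congr rfl fun k _ => ?_
    rw [matD_mul (hg i k) (hg i k), hS.matD_gradV_m ht hx hΩ]
    ring
  rw [h2] at h1
  have e2 := congrFun (congrFun e1 t) x
  have hNx : ‖gradV (S.m t) x‖ ^ 2 =
      ∑ i, ∑ k, gradV (S.m t) x i k * gradV (S.m t) x i k := by
    rw [frobenius_norm_sq]; simp only [sq]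
  rw [e1]
  rw [e2, h1, ddot_stressK, hNx, State.κact]
  have h0 := hS.det_ne_zero ht hx'
  field_simp
  ring

end IsSmoothState

end Balance

namespace State

variable {d : ℕ} (S : State d) (M : Material d) (L : Loads d)

/-- The density of the kinetic, stored, exchange and heat energies. -/
def bodyEnergy (t : ℝ) (x : Vec d) : ℝ :=
  S.ρ t x / 2 * ‖S.v t x‖ ^ 2 + M.φ (S.F t x) (S.m t x) / (S.F t x).det
    + M.κ (S.F t x) * ‖gradV (S.m t) x‖ ^ 2 / (2 * (S.F t x).det) + S.w M t x

/-- The flux of power and heat, diminished by the convected energy. -/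
def powerFlux (t : ℝ) (k : Fin d) (x : Vec d) : ℝ :=
  ∑ i, S.stress M L t x i k * S.v t x i + ∑ i, ∑ j, S.H t x i j k * gradV (S.v t) x i j
    + ∑ i, S.κact M t x * gradV (S.m t) x i k * S.convm t x i - S.heatFlux M t x k
    - S.bodyEnergy M t x * S.v t x k

end State

/-! ### The power flux and its divergence -/

section Balance

variable {d : ℕ} {T : ℝ} {Ω : Set (Vec d)} {M : Material d} {L : Loads d} {S : State d}
  {t : ℝ} {x : Vec d}

namespace IsSmoothState

theorem contDiffAt_bodyEnergy (hS : IsSmoothState T Ω M S) (hM : M.Admissible)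
    (ht : t ∈ Ioo 0 T) (hx : x ∈ closure Ω) :
    ContDiffAt ℝ 1 (joint fun s y => S.bodyEnergy M s y) (t, x) :=
  (((hS.contDiffAt_kinetic ht hx).add (hS.contDiffAt_stored hM ht hx)).add
    (hS.contDiffAt_exchange hM ht hx)).add (hS.contDiffAt_w hM ht hx)

theorem contDiffAt_convm (hS : IsSmoothState T Ω M S) (ht : t ∈ Ioo 0 T) (hx : x ∈ closure Ω)
    (i : Fin d) : ContDiffAt ℝ 1 (fun y => S.convm t y i) x := by
  have hm : ContDiffAt ℝ 1 (joint S.m) (t, x) :=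
    (hS.m_smooth.contDiffAt ht hx).of_le (WithTop.coe_le_coe.2 le_top)
  have hev : ∀ᶠ q in 𝓝 (t, x), ContDiffAt ℝ 1 (joint S.m) q := hm.eventually (by simp)
  have hc : ContinuousAt (fun y : Vec d => (t, y)) x := by fun_prop
  have h1 : ContDiffAt ℝ 1 (fun y => deriv (fun r => S.m r y i) t +
      ∑ l, gradV (S.m t) y i l * S.v t y l) x := by
    refine ContDiffAt.add ?_ (ContDiffAt.sum fun l _ => ContDiffAt.mul ?_ ?_)
    · exact (contDiffAt_space_of_joint (f := fun s y => deriv (fun r => S.m r y i) s)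
        (hS.contDiffAt_deriv_m ht hx i)).of_le (WithTop.coe_le_coe.2 le_top)
    · exact (contDiffAt_space_of_joint (f := fun s y => gradV (S.m s) y i l)
        (hS.contDiffAt_gradV_m ht hx i l)).of_le (WithTop.coe_le_coe.2 le_top)
    · exact (contDiffAt_space_of_joint (f := fun s y => S.v s y l)
        (hS.contDiffAt_v ht hx l)).of_le (WithTop.coe_le_coe.2 le_top)
  refine h1.congr_of_eventuallyEq ?_
  filter_upwards [hc.eventually hev] with y hy
  rw [State.convm, PiLp.add_apply, State.dtm,
    deriv_apply ((contDiffAt_time_of_joint hy).differentiableAt one_ne_zero)]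
  rfl

theorem contDiffAt_powerFlux (hS : IsSmoothState T Ω M S) (hM : M.Admissible)
    (hL : SmoothUpTo 1 T Ω L.hext) (ht : t ∈ Ioo 0 T) (hx : x ∈ closure Ω) (k : Fin d) :
    ContDiffAt ℝ 1 (S.powerFlux M L t k) x := by
  have hv : ∀ i, ContDiffAt ℝ 1 (fun y => S.v t y i) x := fun i =>
    (contDiffAt_space_of_joint (f := fun s y => S.v s y i) (hS.contDiffAt_v ht hx i)).of_le
      (WithTop.coe_le_coe.2 le_top)
  have hgv : ∀ i j, ContDiffAt ℝ 1 (fun y => gradV (S.v t) y i j) x := fun i j =>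
    (contDiffAt_space_of_joint (f := fun s y => gradV (S.v s) y i j)
      (hS.contDiffAt_gradV_v ht hx i j)).of_le (WithTop.coe_le_coe.2 le_top)
  have hgm : ∀ i j, ContDiffAt ℝ 1 (fun y => gradV (S.m t) y i j) x := fun i j =>
    (contDiffAt_space_of_joint (f := fun s y => gradV (S.m s) y i j)
      (hS.contDiffAt_gradV_m ht hx i j)).of_le (WithTop.coe_le_coe.2 le_top)
  have hκ : ContDiffAt ℝ 1 (fun y => S.κact M t y) x :=
    (contDiffAt_space_of_joint (f := fun s y => S.κact M s y)
      (hS.contDiffAt_κact hM ht hx)).of_le (by norm_num)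
  refine ContDiffAt.sub (ContDiffAt.sub (ContDiffAt.add (ContDiffAt.add ?_ ?_) ?_) ?_) ?_
  · exact ContDiffAt.sum fun i _ => (hS.contDiffAt_stress hM hL ht hx i k).mul (hv i)
  · exact ContDiffAt.sum fun i _ => ContDiffAt.sum fun j _ =>
      ((hS.contDiffAt_H ht hx i j k).of_le (by norm_num)).mul (hgv i j)
  · exact ContDiffAt.sum fun i _ => (hκ.mul (hgm i k)).mul (hS.contDiffAt_convm ht hx i)
  · exact contDiffAt_space_of_joint (f := fun s y => S.heatFlux M s y k)
      (hS.contDiffAt_heatFlux hM ht hx k)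
  · exact (contDiffAt_space_of_joint (f := fun s y => S.bodyEnergy M s y)
      (hS.contDiffAt_bodyEnergy hM ht hx)).mul (hv k)

theorem sum_pd_stress_power (hS : IsSmoothState T Ω M S) (hM : M.Admissible)
    (hL : SmoothUpTo 1 T Ω L.hext) (ht : t ∈ Ioo 0 T) (hx : x ∈ closure Ω) :
    ∑ k, pd k (fun y => ∑ i, S.stress M L t y i k * S.v t y i) x =
      ∑ i, S.v t x i * ∑ k, pd k (fun y => S.stress M L t y i k) x +
        ddot (S.stress M L t x) (gradV (S.v t) x) := by
  have hA := fun i k => hS.differentiableAt_stress (L := L) hM hL ht hx i k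
  have hv := fun i => hS.differentiableAt_v ht hx i
  have e : ∀ k, pd k (fun y => ∑ i, S.stress M L t y i k * S.v t y i) x =
      ∑ i, (pd k (fun y => S.stress M L t y i k) x * S.v t x i +
        S.stress M L t x i k * gradV (S.v t) x i k) := fun k => by
    rw [pd_sum (F := fun i y => S.stress M L t y i k * S.v t y i) _ fun i _ =>
      (hA i k).fun_mul (hv i)]
    exact Finset.sum_congr rfl fun i _ => pd_mul (hA i k) (hv i) k
  simp only [e]
  rw [Finset.sum_comm]
  simp only [Finset.sum_add_distrib, Finset.mul_sum, ddot]
  congr 1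
  exact Finset.sum_congr rfl fun i _ => Finset.sum_congr rfl fun k _ => mul_comm _ _

/-- Its first term cancels the power of `-div 𝓗` inside the total stress, leaving the hyperviscous
dissipation. The skew hyperstress has no flux term of this kind, since its divergence has already
been absorbed by the skew stress. -/
theorem sum_pd_hyper_power (hS : IsSmoothState T Ω M S) (ht : t ∈ Ioo 0 T)
    (hx : x ∈ closure Ω) :
    ∑ k, pd k (fun y => ∑ i, ∑ j, S.H t y i j k * gradV (S.v t) y i j) x =
      ddot (divT (fun y => S.H t y) x) (gradV (S.v t) x) +
        ∑ i, ∑ j, ∑ k, S.H t x i j k * hessV (S.v t) x i j k := by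
  have hH : ∀ i j k, DifferentiableAt ℝ (fun y => S.H t y i j k) x := fun i j k =>
    (hS.contDiffAt_H ht hx i j k).differentiableAt two_ne_zero
  have hg : ∀ i j, DifferentiableAt ℝ (fun y => gradV (S.v t) y i j) x := fun i j =>
    (contDiffAt_space_of_joint (f := fun s y => gradV (S.v s) y i j)
      (hS.contDiffAt_gradV_v ht hx i j)).differentiableAt (by simp)
  have e : ∀ k, pd k (fun y => ∑ i, ∑ j, S.H t y i j k * gradV (S.v t) y i j) x =
      ∑ i, ∑ j, (pd k (fun y => S.H t y i j k) x * gradV (S.v t) x i j +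
        S.H t x i j k * hessV (S.v t) x i j k) := fun k => by
    rw [pd_sum (F := fun i y => ∑ j, S.H t y i j k * gradV (S.v t) y i j) _ fun i _ =>
      DifferentiableAt.fun_sum fun j _ => (hH i j k).fun_mul (hg i j)]
    refine Finset.sum_congr rfl fun i _ => ?_
    rw [pd_sum (F := fun j y => S.H t y i j k * gradV (S.v t) y i j) _ fun j _ =>
      (hH i j k).fun_mul (hg i j)]
    exact Finset.sum_congr rfl fun j _ => pd_mul (hH i j k) (hg i j) k
  simp only [e]
  rw [Finset.sum_comm]
  simp only [ddot, divT, Matrix.of_apply, ← Finset.sum_add_distrib, Finset.sum_mul]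
  exact Finset.sum_congr rfl fun i _ => Finset.sum_comm

theorem sum_pd_exchange_power (hS : IsSmoothState T Ω M S) (hM : M.Admissible)
    (ht : t ∈ Ioo 0 T) (hx : x ∈ closure Ω) :
    ∑ k, pd k (fun y => ∑ i, S.κact M t y * gradV (S.m t) y i k * S.convm t y i) x =
      ⟪divM (fun y => S.κact M t y • gradV (S.m t) y) x, S.convm t x⟫ +
        S.κact M t x * ∑ i, ∑ k, gradV (S.m t) x i k * pd k (fun y => S.convm t y i) x := by
  have hκ : DifferentiableAt ℝ (fun y => S.κact M t y) x :=
    (contDiffAt_space_of_joint (f := fun s y => S.κact M s y)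
      (hS.contDiffAt_κact hM ht hx)).differentiableAt two_ne_zero
  have hc : ∀ i k, DifferentiableAt ℝ (fun y => S.κact M t y * gradV (S.m t) y i k) x :=
    fun i k => hκ.fun_mul ((contDiffAt_space_of_joint (f := fun s y => gradV (S.m s) y i k)
      (hS.contDiffAt_gradV_m ht hx i k)).differentiableAt (by simp))
  have hm : ∀ i, DifferentiableAt ℝ (fun y => S.convm t y i) x := fun i =>
    (hS.contDiffAt_convm ht hx i).differentiableAt one_ne_zero
  have e : ∀ k, pd k (fun y => ∑ i, S.κact M t y * gradV (S.m t) y i k * S.convm t y i) x =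
      ∑ i, (pd k (fun y => S.κact M t y * gradV (S.m t) y i k) x * S.convm t x i +
        S.κact M t x * gradV (S.m t) x i k * pd k (fun y => S.convm t y i) x) := fun k => by
    rw [pd_sum (F := fun i y => S.κact M t y * gradV (S.m t) y i k * S.convm t y i) _ fun i _ =>
      (hc i k).fun_mul (hm i)]
    exact Finset.sum_congr rfl fun i _ => pd_mul (hc i k) (hm i) k
  have e2 : ⟪divM (fun y => S.κact M t y • gradV (S.m t) y) x, S.convm t x⟫ =
      ∑ i, ∑ k, pd k (fun y => S.κact M t y * gradV (S.m t) y i k) x * S.convm t x i := by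
    simp only [PiLp.inner_apply, RCLike.inner_apply, conj_trivial, ← Finset.sum_mul]
    exact Finset.sum_congr rfl fun i _ => mul_comm _ _
  simp only [e]
  rw [Finset.sum_comm, e2]
  simp only [← Finset.sum_add_distrib, Finset.mul_sum, mul_assoc]

/-- Reynolds' identity applied to each of the four energies. The heat energy obeys its own balance,
in which `e(v)` has been replaced by `∇v` through frame indifference. -/
theorem deriv_add_bodyEnergy_div (hS : IsSmoothState T Ω M S) (hM : M.Admissible)
    (hL : SmoothUpTo 1 T Ω L.hext) (hΩ : IsOpen Ω)
    (hB : BulkEquations Ω M L S t) (ht : t ∈ Ioo 0 T) (hx : x ∈ Ω) :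
    deriv (fun s => S.bodyEnergy M s x) t +
        ∑ k, pd k (fun y => S.bodyEnergy M t y * S.v t y k) x =
      ∑ i, S.v t x i * ∑ k, pd k (fun y => S.stress M L t y i k) x -
        M.μ₀ * ∑ j, S.field L t x j * ∑ i, gradV (S.m t) x j i * S.v t x i +
        S.ρ t x * ⟪L.g t x, S.v t x⟫ +
      (ddot (M.φF (S.F t x) (S.m t x) * (S.F t x)ᵀ) (gradV (S.v t) x) +
        ⟪gradient (fun a => M.φ (S.F t x) a) (S.m t x), S.convm t x⟫) / (S.F t x).det +
      (‖gradV (S.m t) x‖ ^ 2 / (2 * (S.F t x).det) *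
          ddot (dMat M.κ (S.F t x) * (S.F t x)ᵀ) (gradV (S.v t) x) +
        S.κact M t x * ∑ i, ∑ k, gradV (S.m t) x i k * pd k (fun y => S.convm t y i) x +
        ddot (S.stressK M t x) (gradV (S.v t) x)) +
      (M.ξ (S.F t x) (S.θ t x) (S.strainRate t x) (hessV (S.v t) x) (S.corotm t x) +
        ddot (M.ζF (S.F t x) (S.m t x) (S.θ t x) * (S.F t x)ᵀ) (gradV (S.v t) x) /
          (S.F t x).det +
        ⟪M.ζm (S.F t x) (S.m t x) (S.θ t x), S.convm t x⟫ / (S.F t x).det -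
        ∑ k, pd k (fun y => S.heatFlux M t y k) x) := by
  have hx' := subset_closure hx
  have hK := (hS.contDiffAt_kinetic ht hx').differentiableAt one_ne_zero
  have hφ := (hS.contDiffAt_stored hM ht hx').differentiableAt one_ne_zero
  have hX := (hS.contDiffAt_exchange hM ht hx').differentiableAt one_ne_zero
  have hw := (hS.contDiffAt_w hM ht hx').differentiableAt one_ne_zero
  have h1 := hS.deriv_add_div ht hx'
    ((hS.contDiffAt_bodyEnergy hM ht hx').differentiableAt one_ne_zero)
  have h2 : S.matD (fun s y => S.bodyEnergy M s y) t x =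
      S.matD (fun s y => S.ρ s y / 2 * ‖S.v s y‖ ^ 2) t x +
      S.matD (fun s y => M.φ (S.F s y) (S.m s y) / (S.F s y).det) t x +
      S.matD (fun s y => M.κ (S.F s y) * ‖gradV (S.m s) y‖ ^ 2 / (2 * (S.F s y).det)) t x +
      S.matD (fun s y => S.w M s y) t x := by
    rw [← matD_add hK hφ, ← matD_add (hK.fun_add hφ) hX,
      ← matD_add ((hK.fun_add hφ).fun_add hX) hw]
    rfl
  have h3 := hS.deriv_add_div ht hx' hw
  have h4 := hB.heat x hx
  rw [hM.ddot_ζF_strainRate hS ht hx'] at h4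
  have h5 : divV (fun y => S.heatFlux M t y + S.w M t y • S.v t y) x =
      ∑ k, pd k (fun y => S.heatFlux M t y k) x + ∑ k, pd k (fun y => S.w M t y * S.v t y k) x := by
    rw [← Finset.sum_add_distrib]
    exact Finset.sum_congr rfl fun k _ => pd_add
      ((contDiffAt_space_of_joint (f := fun s y => S.heatFlux M s y k)
        (hS.contDiffAt_heatFlux hM ht hx' k)).differentiableAt one_ne_zero)
      (((contDiffAt_space_of_joint (f := fun s y => S.w M s y)
        (hS.contDiffAt_w hM ht hx')).differentiableAt one_ne_zero).fun_mul
          (hS.differentiableAt_v ht hx' k)) k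
  have h6 := hS.matD_kinetic hM hL hB ht hx
  have h7 := hS.matD_div_det hB ht hx ((hS.contDiffAt_φ hM ht hx').differentiableAt two_ne_zero)
  rw [hS.matD_φ hM hB ht hx] at h7
  have h8 := hS.matD_exchange hM hΩ hB ht hx
  rw [h5] at h4
  have h9 : S.bodyEnergy M t x * (gradV (S.v t) x).trace =
      S.ρ t x / 2 * ‖S.v t x‖ ^ 2 * (gradV (S.v t) x).trace +
      M.φ (S.F t x) (S.m t x) / (S.F t x).det * (gradV (S.v t) x).trace +
      M.κ (S.F t x) * ‖gradV (S.m t) x‖ ^ 2 / (2 * (S.F t x).det) * (gradV (S.v t) x).trace +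
      S.w M t x * (gradV (S.v t) x).trace := by
    rw [State.bodyEnergy]; ring
  rw [h2, h9] at h1
  linarith

/-- The local form of the energy balance. -/
theorem local_balance (hS : IsSmoothState T Ω M S) (hM : M.Admissible)
    (hL : SmoothUpTo 1 T Ω L.hext) (hd : d = 2 ∨ d = 3) (hΩ : IsOpen Ω)
    (hB : BulkEquations Ω M L S t) (ht : t ∈ Ioo 0 T) (hx : x ∈ Ω) :
    deriv (fun s => S.bodyEnergy M s x) t - M.μ₀ * ⟪S.field L t x, S.dtm t x⟫ -
        S.ρ t x * ⟪L.g t x, S.v t x⟫ = ∑ k, pd k (S.powerFlux M L t k) x := by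
  have hx' := subset_closure hx
  have hv := fun i => hS.differentiableAt_v ht hx' i
  have h1 := hS.deriv_add_bodyEnergy_div hM hL hΩ hB ht hx
  have hBE : ∀ k, DifferentiableAt ℝ (fun y => S.bodyEnergy M t y * S.v t y k) x := fun k =>
    ((contDiffAt_space_of_joint (f := fun s y => S.bodyEnergy M s y)
      (hS.contDiffAt_bodyEnergy hM ht hx')).differentiableAt one_ne_zero).fun_mul (hv k)
  have hj : ∀ k, DifferentiableAt ℝ (fun y => S.heatFlux M t y k) x := fun k =>
    (contDiffAt_space_of_joint (f := fun s y => S.heatFlux M s y k)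
      (hS.contDiffAt_heatFlux hM ht hx' k)).differentiableAt one_ne_zero
  have hA : ∀ k, DifferentiableAt ℝ (fun y => ∑ i, S.stress M L t y i k * S.v t y i) x :=
    fun k => DifferentiableAt.fun_sum fun i _ =>
      (hS.differentiableAt_stress hM hL ht hx' i k).fun_mul (hv i)
  have hH : ∀ k, DifferentiableAt ℝ
      (fun y => ∑ i, ∑ j, S.H t y i j k * gradV (S.v t) y i j) x := fun k =>
    DifferentiableAt.fun_sum fun i _ => DifferentiableAt.fun_sum fun j _ =>
      ((hS.contDiffAt_H ht hx' i j k).differentiableAt two_ne_zero).fun_mul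
        ((contDiffAt_space_of_joint (f := fun s y => gradV (S.v s) y i j)
          (hS.contDiffAt_gradV_v ht hx' i j)).differentiableAt (by simp))
  have hX : ∀ k, DifferentiableAt ℝ
      (fun y => ∑ i, S.κact M t y * gradV (S.m t) y i k * S.convm t y i) x := fun k =>
    DifferentiableAt.fun_sum fun i _ =>
      (((contDiffAt_space_of_joint (f := fun s y => S.κact M s y)
        (hS.contDiffAt_κact hM ht hx')).differentiableAt two_ne_zero).fun_mul
        ((contDiffAt_space_of_joint (f := fun s y => gradV (S.m s) y i k)
          (hS.contDiffAt_gradV_m ht hx' i k)).differentiableAt (by simp))).fun_mul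
        ((hS.contDiffAt_convm ht hx' i).differentiableAt one_ne_zero)
  have h2 : ∑ k, pd k (S.powerFlux M L t k) x =
      ∑ k, pd k (fun y => ∑ i, S.stress M L t y i k * S.v t y i) x +
      ∑ k, pd k (fun y => ∑ i, ∑ j, S.H t y i j k * gradV (S.v t) y i j) x +
      ∑ k, pd k (fun y => ∑ i, S.κact M t y * gradV (S.m t) y i k * S.convm t y i) x -
      ∑ k, pd k (fun y => S.heatFlux M t y k) x -
      ∑ k, pd k (fun y => S.bodyEnergy M t y * S.v t y k) x := by
    simp only [← Finset.sum_add_distrib, ← Finset.sum_sub_distrib]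
    refine Finset.sum_congr rfl fun k _ => ?_
    rw [← pd_add (hA k) (hH k), ← pd_add ((hA k).fun_add (hH k)) (hX k),
      ← pd_sub (((hA k).fun_add (hH k)).fun_add (hX k)) (hj k),
      ← pd_sub ((((hA k).fun_add (hH k)).fun_add (hX k)).fun_sub (hj k)) (hBE k)]
    rfl
  rw [hS.sum_pd_stress_power hM hL ht hx', hS.sum_pd_hyper_power ht hx',
    hS.sum_pd_exchange_power hM ht hx', hS.ddot_stress hM ht hx', hS.sum_H_mul_hessV hM ht hx',
    ddot_stressT] at h2
  have h3 := hB.inner_drive_corotm hd hx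
  have h4 : ⟪S.drive M L t x, S.corotm t x⟫ = ⟪S.drive M L t x, S.convm t x⟫ -
      ⟪S.drive M L t x, mulV (skwPart (gradV (S.v t) x)) (S.m t x)⟫ := by
    rw [State.corotm, inner_sub_right]
  have h5 : ⟪S.drive M L t x, S.convm t x⟫ =
      (⟪gradient (fun a => M.φ (S.F t x) a) (S.m t x), S.convm t x⟫ +
        ⟪M.ζm (S.F t x) (S.m t x) (S.θ t x), S.convm t x⟫) / (S.F t x).det -
      M.μ₀ * ⟪S.field L t x, S.convm t x⟫ -
      ⟪divM (fun y => S.κact M t y • gradV (S.m t) y) x, S.convm t x⟫ := by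
    rw [State.drive, inner_sub_left, inner_sub_left, real_inner_smul_left, real_inner_smul_left,
      Material.ψm, inner_add_left]
    ring
  -- The convective part of `h · ṁ` is compensated by the power of the magnetic force; the partial
  -- time derivative remains for the Zeeman energy.
  have h6 : ⟪S.field L t x, S.convm t x⟫ = ⟪S.field L t x, S.dtm t x⟫ +
      ∑ j, S.field L t x j * ∑ i, gradV (S.m t) x j i * S.v t x i := by
    rw [State.convm, inner_add_right]
    congr 1
    simp only [PiLp.inner_apply, RCLike.inner_apply, conj_trivial]
    exact Finset.sum_congr rfl fun j _ => mul_comm _ _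
  rw [h4, h5, h6] at h3
  rw [h2]
  rw [Material.ξ] at h1
  -- Conservative stress powers match the energy rates, `ν₁` and `ν₂` dissipation matches the
  -- mechanical part of `ξ`, and the tested flow rule `h3` accounts for the magnetic part.
  linear_combination h1 + h3

end IsSmoothState

end Balance

/-! ### The flux through the boundary -/

section Boundary

variable {d : ℕ} {T : ℝ} {Ω : Set (Vec d)} {Φ : Vec d → ℝ} {M : Material d} {L : Loads d}
  {S : State d} {t : ℝ} {x : Vec d}

theorem inner_normal_self (hΩ : IsSmoothDomain Ω Φ) (hx : x ∈ frontier Ω) :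
    ⟪normal Φ x, normal Φ x⟫ = 1 := by
  rw [real_inner_self_eq_norm_sq, norm_normal (hΩ.gradient_ne_zero hx), one_pow]

theorem inner_normal_tang (hΩ : IsSmoothDomain Ω Φ) (hx : x ∈ frontier Ω) (a : Vec d) :
    ⟪normal Φ x, tang (normal Φ x) a⟫ = 0 := by
  rw [tang, inner_sub_right, real_inner_smul_right, inner_normal_self hΩ hx, real_inner_comm]
  ring

theorem fderiv_tang_single (f : Vec d → ℝ) (x n : Vec d) (j : Fin d) :
    fderiv ℝ f x (tang n (EuclideanSpace.single j 1)) = pd j f x - n j * fderiv ℝ f x n := by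
  have h : ⟪EuclideanSpace.single j (1 : ℝ), n⟫ = n j := by
    rw [EuclideanSpace.inner_single_left]; simp
  rw [tang, map_sub, map_smul, h]
  rfl

/-- The hypertraction contracted with the velocity. -/
def State.hyperPower (S : State d) (M : Material d) (Φ : Vec d → ℝ) (t : ℝ) (j : Fin d)
    (y : Vec d) : ℝ :=
  ∑ i, S.hyperNormal M t y (normal Φ y) i j * S.v t y i

/-- The skew hyperstress applied to `n` is linear in `(n·∇)m`, which vanishes on the boundary. -/
theorem BoundaryConditions.hyperS_normal (hBC : BoundaryConditions Ω Φ M L S t)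
    (hx : x ∈ frontier Ω) (i j : Fin d) : ∑ k, S.hyperS M t x i j k * normal Φ x k = 0 := by
  have h : ∀ i, ∑ k, gradV (S.m t) x i k * normal Φ x k = 0 := fun i =>
    congrArg (fun a : Vec d => a i) (hBC.magnetic x hx)
  have e : ∀ k, S.hyperS M t x i j k * normal Φ x k = S.κact M t x / 2 * S.m t x j *
      (gradV (S.m t) x i k * normal Φ x k) - S.κact M t x / 2 * S.m t x i *
      (gradV (S.m t) x j k * normal Φ x k) := fun k => by
    simp only [State.hyperS]; ring
  simp only [e, Finset.sum_sub_distrib, ← Finset.mul_sum, h]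
  ring

theorem BoundaryConditions.hyperNormal_apply (hBC : BoundaryConditions Ω Φ M L S t)
    (hx : x ∈ frontier Ω) (i j : Fin d) :
    S.hyperNormal M t x (normal Φ x) i j = ∑ k, S.H t x i j k * normal Φ x k := by
  have h := hBC.hyperS_normal hx i j
  simp only [State.hyperNormal, Matrix.of_apply, State.hyper, Pi.add_apply, add_mul,
    Finset.sum_add_distrib, h, add_zero]

/-- `𝓗` is a scalar multiple of `∇²v`, so the condition `∇²v : (n ⊗ n) = 0` passes to it.
Consequently the hypertraction sees only tangential derivatives of `v`. -/
theorem BoundaryConditions.hyperNormal_normal (hBC : BoundaryConditions Ω Φ M L S t)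
    (hS : IsSmoothState T Ω M S) (ht : t ∈ Ioo 0 T) (hx : x ∈ frontier Ω) (i : Fin d) :
    ∑ j, S.hyperNormal M t x (normal Φ x) i j * normal Φ x j = 0 := by
  have h := hBC.hyper x hx i
  simp only [hBC.hyperNormal_apply hx, hS.H_eq t ht x (frontier_subset_closure hx),
    Pi.smul_apply, smul_eq_mul]
  set c := M.ν₂ * tnorm (hessV (S.v t) x) ^ (M.p - 2)
  calc _ = c * ∑ j, ∑ k, hessV (S.v t) x i j k * normal Φ x j * normal Φ x k := by
        simp only [Finset.mul_sum, Finset.sum_mul]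
        exact Finset.sum_congr rfl fun j _ => Finset.sum_congr rfl fun k _ => by ring
    _ = 0 := by rw [h, mul_zero]

theorem contDiffAt_hyperNormal (hΩ : IsSmoothDomain Ω Φ) (hS : IsSmoothState T Ω M S)
    (hM : M.Admissible) (ht : t ∈ Ioo 0 T) (hx : x ∈ frontier Ω) (i j : Fin d) :
    ContDiffAt ℝ 2 (fun y => S.hyperNormal M t y (normal Φ y) i j) x := by
  have h : ContDiffAt ℝ 2 (fun y => ∑ k, S.hyper M t y i j k * normal Φ y k) x :=
    ContDiffAt.sum fun k _ =>
      (hS.contDiffAt_hyper hM ht (frontier_subset_closure hx) i j k).mul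
        ((hΩ.contDiffAt_normal_apply hx k).of_le (WithTop.coe_le_coe.2 le_top))
  exact h

theorem contDiffAt_hyperPower (hΩ : IsSmoothDomain Ω Φ) (hS : IsSmoothState T Ω M S)
    (hM : M.Admissible) (ht : t ∈ Ioo 0 T) (hx : x ∈ frontier Ω) (j : Fin d) :
    ContDiffAt ℝ 2 (S.hyperPower M Φ t j) x :=
  ContDiffAt.sum fun i _ => (contDiffAt_hyperNormal hΩ hS hM ht hx i j).mul
    ((contDiffAt_space_of_joint (f := fun s y => S.v s y i)
      (hS.contDiffAt_v ht (frontier_subset_closure hx) i)).of_le (WithTop.coe_le_coe.2 le_top))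

/-- Tangency of the contracted field is what the surface divergence theorem on a closed surface
requires; otherwise a curvature term would appear. -/
theorem sum_hyperPower_normal (hBC : BoundaryConditions Ω Φ M L S t)
    (hS : IsSmoothState T Ω M S) (ht : t ∈ Ioo 0 T) (hx : x ∈ frontier Ω) :
    ∑ j, S.hyperPower M Φ t j x * normal Φ x j = 0 := by
  have h : ∑ j, S.hyperPower M Φ t j x * normal Φ x j =
      ∑ i, S.v t x i * ∑ j, S.hyperNormal M t x (normal Φ x) i j * normal Φ x j := by
    simp only [State.hyperPower, Finset.sum_mul, Finset.mul_sum]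
    rw [Finset.sum_comm]
    exact Finset.sum_congr rfl fun i _ => Finset.sum_congr rfl fun j _ => by ring
  rw [h]
  exact Finset.sum_eq_zero fun i _ => by rw [hBC.hyperNormal_normal hS ht hx, mul_zero]

/-- The product rule for the surface divergence. -/
theorem sum_fderiv_hyperPower (hΩ : IsSmoothDomain Ω Φ) (hBC : BoundaryConditions Ω Φ M L S t)
    (hS : IsSmoothState T Ω M S) (hM : M.Admissible) (ht : t ∈ Ioo 0 T) (hx : x ∈ frontier Ω) :
    ∑ j, fderiv ℝ (S.hyperPower M Φ t j) x (tang (normal Φ x) (EuclideanSpace.single j 1)) =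
      ⟪surfDiv (frontier Ω) (normal Φ) (fun y => S.hyperNormal M t y (normal Φ y)) x, S.v t x⟫ +
      ∑ i, ∑ j, S.hyperNormal M t x (normal Φ x) i j * gradV (S.v t) x i j := by
  have hB : ∀ i j, DifferentiableAt ℝ (fun y => S.hyperNormal M t y (normal Φ y) i j) x :=
    fun i j => (contDiffAt_hyperNormal hΩ hS hM ht hx i j).differentiableAt two_ne_zero
  have hv : ∀ i, DifferentiableAt ℝ (fun y => S.v t y i) x := fun i =>
    hS.differentiableAt_v ht (frontier_subset_closure hx) i
  have e1 : ∀ j w, fderiv ℝ (S.hyperPower M Φ t j) x w =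
      ∑ i, (fderiv ℝ (fun y => S.hyperNormal M t y (normal Φ y) i j) x w * S.v t x i +
        S.hyperNormal M t x (normal Φ x) i j * fderiv ℝ (fun y => S.v t y i) x w) := fun j w => by
    have h : HasFDerivAt (S.hyperPower M Φ t j) _ x :=
      HasFDerivAt.fun_sum (u := Finset.univ) fun i _ =>
        (hB i j).hasFDerivAt.mul (hv i).hasFDerivAt
    rw [h.fderiv]
    simp only [sum_apply, add_apply, smul_apply, smul_eq_mul]
    exact Finset.sum_congr rfl fun i _ => by ring
  have e2 : ⟪surfDiv (frontier Ω) (normal Φ) (fun y => S.hyperNormal M t y (normal Φ y)) x,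
      S.v t x⟫ = ∑ i, ∑ j, fderiv ℝ (fun y => S.hyperNormal M t y (normal Φ y) i j) x
        (tang (normal Φ x) (EuclideanSpace.single j 1)) * S.v t x i := by
    simp only [surfDiv, PiLp.inner_apply, RCLike.inner_apply, conj_trivial]
    refine Finset.sum_congr rfl fun i _ => ?_
    rw [mul_comm, Finset.sum_mul]
    exact Finset.sum_congr rfl fun j _ => by
      rw [hΩ.fderivWithin_frontier hx (hB i j) (inner_normal_tang hΩ hx _)]
  -- The normal derivative of `v` enters multiplied by the doubly normal component of the
  -- hyperstress, which is zero, so `∇v` may be replaced by the surface gradient.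
  have e3 : ∑ i, ∑ j, S.hyperNormal M t x (normal Φ x) i j * gradV (S.v t) x i j =
      ∑ i, ∑ j, S.hyperNormal M t x (normal Φ x) i j *
        fderiv ℝ (fun y => S.v t y i) x
          (tang (normal Φ x) (EuclideanSpace.single j 1)) := by
    refine Finset.sum_congr rfl fun i _ => ?_
    have h := hBC.hyperNormal_normal hS ht hx i
    have h2 : ∑ j, S.hyperNormal M t x (normal Φ x) i j *
        fderiv ℝ (fun y => S.v t y i) x (tang (normal Φ x) (EuclideanSpace.single j 1)) =
        ∑ j, S.hyperNormal M t x (normal Φ x) i j * gradV (S.v t) x i j -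
        (∑ j, S.hyperNormal M t x (normal Φ x) i j * normal Φ x j) *
          fderiv ℝ (fun y => S.v t y i) x (normal Φ x) := by
      rw [Finset.sum_mul, ← Finset.sum_sub_distrib]
      refine Finset.sum_congr rfl fun j _ => ?_
      rw [fderiv_tang_single]
      simp only [gradV, Matrix.of_apply]
      ring
    rw [h2, h, zero_mul, sub_zero]
  rw [e2, e3, ← Finset.sum_add_distrib]
  simp only [e1, ← Finset.sum_add_distrib]
  exact Finset.sum_comm

/-- The power supplied through the boundary. -/
theorem sum_powerFlux_normal (hΩ : IsSmoothDomain Ω Φ) (hBC : BoundaryConditions Ω Φ M L S t)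
    (hS : IsSmoothState T Ω M S) (hM : M.Admissible) (ht : t ∈ Ioo 0 T) (hx : x ∈ frontier Ω) :
    ∑ k, S.powerFlux M L t k x * normal Φ x k =
      ⟪L.k t x, S.v t x⟫ + L.h t x (S.θ t x) - M.νb / 2 * ‖S.v t x‖ ^ M.p +
      ∑ j, fderiv ℝ (S.hyperPower M Φ t j) x
        (tang (normal Φ x) (EuclideanSpace.single j 1)) := by
  rw [sum_fderiv_hyperPower hΩ hBC hS hM ht hx]
  have hvn := hBC.impermeable x hx
  have hm : ∀ i, ∑ k, gradV (S.m t) x i k * normal Φ x k = 0 := fun i =>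
    congrArg (fun a : Vec d => a i) (hBC.magnetic x hx)
  have hheat := hBC.heat x hx
  have htr := congrArg (fun a => ⟪a, S.v t x⟫) (hBC.traction x hx)
  -- Since `v` is tangential, testing with it removes the tangential projection from the traction
  -- condition.
  have hnv : ⟪normal Φ x, S.v t x⟫ = 0 := by rw [real_inner_comm]; exact hvn
  simp only [inner_add_left, real_inner_smul_left, tang, inner_sub_left, hnv, mul_zero,
    sub_zero, real_inner_self_eq_norm_sq] at htr
  rw [mul_assoc, rpow_sub_two_mul_sq hM.one_le_p (norm_nonneg _)] at htr
  have e1 : ∑ k, (∑ i, S.stress M L t x i k * S.v t x i) * normal Φ x k =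
      ⟪mulV (S.stress M L t x) (normal Φ x), S.v t x⟫ := by
    simp only [mulV, PiLp.inner_apply, RCLike.inner_apply, conj_trivial, Finset.sum_mul,
      Finset.mul_sum]
    rw [Finset.sum_comm]
    exact Finset.sum_congr rfl fun i _ => Finset.sum_congr rfl fun k _ => by ring
  have e2 : ∑ k, (∑ i, ∑ j, S.H t x i j k * gradV (S.v t) x i j) * normal Φ x k =
      ∑ i, ∑ j, S.hyperNormal M t x (normal Φ x) i j * gradV (S.v t) x i j := by
    simp only [hBC.hyperNormal_apply hx, Finset.sum_mul]
    rw [Finset.sum_comm]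
    refine Finset.sum_congr rfl fun i _ => ?_
    rw [Finset.sum_comm]
    exact Finset.sum_congr rfl fun j _ => Finset.sum_congr rfl fun k _ => by ring
  have e3 : ∑ k, (∑ i, S.κact M t x * gradV (S.m t) x i k * S.convm t x i) * normal Φ x k = 0 := by
    have h : ∑ k, (∑ i, S.κact M t x * gradV (S.m t) x i k * S.convm t x i) * normal Φ x k =
        ∑ i, S.κact M t x * S.convm t x i * ∑ k, gradV (S.m t) x i k * normal Φ x k := by
      simp only [Finset.sum_mul, Finset.mul_sum]
      rw [Finset.sum_comm]
      exact Finset.sum_congr rfl fun i _ => Finset.sum_congr rfl fun k _ => by ring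
    rw [h]
    exact Finset.sum_eq_zero fun i _ => by rw [hm, mul_zero]
  have e4 : ∑ k, S.heatFlux M t x k * normal Φ x k = ⟪S.heatFlux M t x, normal Φ x⟫ := by
    simp only [PiLp.inner_apply, RCLike.inner_apply, conj_trivial]
    exact Finset.sum_congr rfl fun k _ => mul_comm _ _
  have e5 : ∑ k, S.bodyEnergy M t x * S.v t x k * normal Φ x k =
      S.bodyEnergy M t x * ⟪S.v t x, normal Φ x⟫ := by
    simp only [PiLp.inner_apply, RCLike.inner_apply, conj_trivial, Finset.mul_sum]
    exact Finset.sum_congr rfl fun k _ => by ring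
  have e6 : ∑ k, S.powerFlux M L t k x * normal Φ x k =
      ∑ k, (∑ i, S.stress M L t x i k * S.v t x i) * normal Φ x k +
      ∑ k, (∑ i, ∑ j, S.H t x i j k * gradV (S.v t) x i j) * normal Φ x k +
      ∑ k, (∑ i, S.κact M t x * gradV (S.m t) x i k * S.convm t x i) * normal Φ x k -
      ∑ k, S.heatFlux M t x k * normal Φ x k -
      ∑ k, S.bodyEnergy M t x * S.v t x k * normal Φ x k := by
    simp only [← Finset.sum_add_distrib, ← Finset.sum_sub_distrib]
    exact Finset.sum_congr rfl fun k _ => by rw [State.powerFlux]; ring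
  -- Traction contributes `-ν_♭|v|^p` and the boundary heat flux `+(ν_♭/2)|v|^p`, hence the one half
  -- that remains.
  rw [e6, e1, e2, e3, e4, e5, hvn]
  linarith

theorem continuousOn_speed_rpow (hS : IsSmoothState T Ω M S) (hM : M.Admissible)
    (ht : t ∈ Ioo 0 T) : ContinuousOn (fun x => M.νb / 2 * ‖S.v t x‖ ^ M.p) (frontier Ω) :=
  continuousOn_const.mul (ContinuousOn.rpow_const (fun _ hx =>
    ((contDiffAt_space_of_joint (hS.v_smooth.contDiffAt ht
      (frontier_subset_closure hx))).continuousAt.norm).continuousWithinAt)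
    fun _ _ => Or.inr (zero_le_one.trans hM.one_le_p))

theorem continuousOn_sum_fderiv_hyperPower (hΩ : IsSmoothDomain Ω Φ)
    (hS : IsSmoothState T Ω M S) (hM : M.Admissible) (ht : t ∈ Ioo 0 T) :
    ContinuousOn (fun x => ∑ j, fderiv ℝ (S.hyperPower M Φ t j) x
      (tang (normal Φ x) (EuclideanSpace.single j 1))) (frontier Ω) := by
  refine continuousOn_finsetSum _ fun j _ x hx => ContinuousAt.continuousWithinAt ?_
  have hn : ContinuousAt (normal Φ) x :=
    (contDiffAt_normal hΩ.smooth (hΩ.gradient_ne_zero hx)).continuousAt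
  have h1 : ContinuousAt (fderiv ℝ (S.hyperPower M Φ t j)) x :=
    ((contDiffAt_hyperPower hΩ hS hM ht hx j).fderiv_right (m := 1) (by norm_num)).continuousAt
  have h2 : ContinuousAt (fun y => ⟪EuclideanSpace.single j (1 : ℝ), normal Φ y⟫) x :=
    continuousAt_const.inner hn
  exact h1.clm_apply (continuousAt_const.sub (h2.fun_smul hn))

/-- No regularity of `k` or of the heat supply is assumed; on a smooth solution the boundary
conditions express their combined power by continuous quantities. -/
theorem continuousOn_boundary_supply (hΩ : IsSmoothDomain Ω Φ)
    (hBC : BoundaryConditions Ω Φ M L S t) (hS : IsSmoothState T Ω M S) (hM : M.Admissible)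
    (hL : SmoothUpTo 1 T Ω L.hext) (ht : t ∈ Ioo 0 T) :
    ContinuousOn (fun x => ⟪L.k t x, S.v t x⟫ + L.h t x (S.θ t x)) (frontier Ω) := by
  have h1 : ContinuousOn (fun x => ∑ k, S.powerFlux M L t k x * normal Φ x k) (frontier Ω) :=
    continuousOn_finsetSum _ fun k _ x hx => ContinuousAt.continuousWithinAt
      ((hS.contDiffAt_powerFlux hM hL ht (frontier_subset_closure hx) k).continuousAt.mul
        (hΩ.contDiffAt_normal_apply hx k).continuousAt)
  refine ((h1.add (continuousOn_speed_rpow hS hM ht)).sub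
    (continuousOn_sum_fderiv_hyperPower hΩ hS hM ht)).congr fun x hx => ?_
  simp only [Pi.add_apply, Pi.sub_apply]
  rw [sum_powerFlux_normal hΩ hBC hS hM ht hx]
  ring

/-- The integrated power of the flux. -/
theorem integral_sum_pd_powerFlux (hΩ : IsSmoothDomain Ω Φ)
    (hBC : BoundaryConditions Ω Φ M L S t) (hS : IsSmoothState T Ω M S) (hM : M.Admissible)
    (hL : SmoothUpTo 1 T Ω L.hext) (ht : t ∈ Ioo 0 T) :
    ∫ x in Ω, ∑ k, pd k (S.powerFlux M L t k) x =
      (∫ x, (⟪L.k t x, S.v t x⟫ + L.h t x (S.θ t x)) ∂(surf Ω)) -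
        ∫ x, M.νb / 2 * ‖S.v t x‖ ^ M.p ∂(surf Ω) := by
  have hq : ∀ k, ∀ x ∈ closure Ω, ContDiffAt ℝ 1 (S.powerFlux M L t k) x := fun k x hx =>
    hS.contDiffAt_powerFlux hM hL ht hx k
  have hintg : ∀ k, IntegrableOn (fun x => pd k (S.powerFlux M L t k) x) Ω := fun k => by
    have hc : ContinuousOn (fun x => pd k (S.powerFlux M L t k) x) (closure Ω) := fun x hx =>
      (contDiffAt_pd (m := 0) (hq k x hx) (by simp) k).continuousAt.continuousWithinAt
    exact (hc.integrableOn_compact hΩ.isCompact_closure).mono_set subset_closure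
  have hints : ∀ k, Integrable (fun x => S.powerFlux M L t k x * normal Φ x k) (surf Ω) := fun k =>
    hΩ.integrable_surf fun x hx => ((hq k x (frontier_subset_closure hx)).continuousAt.mul
      (hΩ.contDiffAt_normal_apply hx k).continuousAt).continuousWithinAt
  rw [integral_finsetSum _ fun k _ => hintg k]
  simp only [hΩ.integral_pd (hq _)]
  rw [← integral_finsetSum _ fun k _ => hints k]
  have h0 := hΩ.integral_surf_div_eq_zero (a := S.hyperPower M Φ t)
    (fun j x hx => contDiffAt_hyperPower hΩ hS hM ht hx j)
    (fun x hx => sum_hyperPower_normal hBC hS ht hx)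
  have hk := hΩ.integrable_surf (continuousOn_boundary_supply hΩ hBC hS hM hL ht)
  have hν := hΩ.integrable_surf (continuousOn_speed_rpow (Ω := Ω) hS hM ht)
  have hD := hΩ.integrable_surf (continuousOn_sum_fderiv_hyperPower hΩ hS hM ht)
  -- The zero added is the integral of the surface divergence, so that the integrands can be
  -- compared pointwise.
  rw [← add_zero ((∫ x, (⟪L.k t x, S.v t x⟫ + L.h t x (S.θ t x)) ∂(surf Ω)) - _), ← h0,
    ← integral_sub hk hν]
  refine Eq.trans ?_ (integral_add (hk.sub hν) hD)
  refine setIntegral_congr_fun isClosed_frontier.measurableSet fun x hx => ?_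
  exact sum_powerFlux_normal hΩ hBC hS hM ht hx

end Boundary

/-! ### The total energy -/

section TotalEnergy

variable {d : ℕ} {T : ℝ} {Ω : Set (Vec d)} {Φ : Vec d → ℝ} {M : Material d} {L : Loads d}
  {S : State d} {t : ℝ} {x : Vec d}

theorem integrableOn_deriv (hc : IsCompact (closure Ω)) {f : ℝ → Vec d → ℝ}
    (h : ∀ x ∈ closure Ω, ContDiffAt ℝ 1 (joint f) (t, x)) :
    IntegrableOn (fun x => deriv (fun s => f s x) t) Ω :=
  integrableOn_of_contDiffAt_joint (n := 0) (f := fun s y => deriv (fun r => f r y) s) hc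
    fun x hx => contDiffAt_joint_deriv (h x hx) (by simp)

theorem contDiffAt_joint_inner {n : WithTop ℕ∞} {a b : ℝ → Vec d → Vec d}
    (ha : ContDiffAt ℝ n (joint a) (t, x)) (hb : ContDiffAt ℝ n (joint b) (t, x)) :
    ContDiffAt ℝ n (joint fun s y => ⟪a s y, b s y⟫) (t, x) := ha.inner ℝ hb

theorem IsSmoothState.contDiffAt_joint_gradient_uΩ (hS : IsSmoothState T Ω M S)
    (ht : t ∈ Ioo 0 T) (hx : x ∈ closure Ω) :
    ContDiffAt ℝ 1 (joint fun s y => gradient (S.uΩ s) y) (t, x) :=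
  (contDiffAt_piLp 2).2 fun i =>
    (hS.contDiffAt_gradient_uΩ ht hx i).of_le (WithTop.coe_le_coe.2 le_top)

theorem IsSmoothState.contDiffAt_joint_m (hS : IsSmoothState T Ω M S)
    (ht : t ∈ Ioo 0 T) (hx : x ∈ closure Ω) : ContDiffAt ℝ 1 (joint S.m) (t, x) :=
  (hS.m_smooth.contDiffAt ht hx).of_le (WithTop.coe_le_coe.2 le_top)

theorem hasDerivAt_time {X : Type*} [NormedAddCommGroup X] [NormedSpace ℝ X]
    {a : ℝ → Vec d → X} (ha : ContDiffAt ℝ 1 (joint a) (t, x)) :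
    HasDerivAt (fun s => a s x) (deriv (fun s => a s x) t) t :=
  ((contDiffAt_time_of_joint ha).differentiableAt one_ne_zero).hasDerivAt

theorem contDiffAt_frozen {X : Type*} [NormedAddCommGroup X] [NormedSpace ℝ X] {a : Vec d → X}
    {n : WithTop ℕ∞} (ha : ContDiffAt ℝ n a x) (s : ℝ) :
    ContDiffAt ℝ n (joint fun _ y => a y) (s, x) :=
  ha.comp (s, x) contDiffAt_snd

namespace IsSmoothState

theorem contDiffAt_frozen_m_inner (hS : IsSmoothState T Ω M S) (ht : t ∈ Ioo 0 T) {s : ℝ}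
    (hs : s ∈ Ioo 0 T) (hx : x ∈ closure Ω) :
    ContDiffAt ℝ 1 (joint fun r y => ⟪S.m t y, gradient (S.uΩ r) y⟫) (s, x) :=
  contDiffAt_joint_inner
    (contDiffAt_frozen (contDiffAt_space_of_joint (hS.contDiffAt_joint_m ht hx)) s)
    (hS.contDiffAt_joint_gradient_uΩ hs hx)

theorem contDiffAt_m_inner_frozen (hS : IsSmoothState T Ω M S) (ht : t ∈ Ioo 0 T) {s : ℝ}
    (hs : s ∈ Ioo 0 T) (hx : x ∈ closure Ω) :
    ContDiffAt ℝ 1 (joint fun r y => ⟪S.m r y, gradient (S.uΩ t) y⟫) (s, x) :=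
  contDiffAt_joint_inner (hS.contDiffAt_joint_m hs hx)
    (contDiffAt_frozen (contDiffAt_space_of_joint (f := fun s y => gradient (S.uΩ s) y)
      (hS.contDiffAt_joint_gradient_uΩ ht hx)) s)

theorem deriv_frozen_m_inner (hS : IsSmoothState T Ω M S) (ht : t ∈ Ioo 0 T)
    (hx : x ∈ closure Ω) :
    deriv (fun s => ⟪S.m t x, gradient (S.uΩ s) x⟫) t =
      ⟪S.m t x, deriv (fun s => gradient (S.uΩ s) x) t⟫ := by
  have h := (hasDerivAt_const t (S.m t x)).inner ℝ
    (hasDerivAt_time (a := fun s y => gradient (S.uΩ s) y) (hS.contDiffAt_joint_gradient_uΩ ht hx))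
  rw [h.deriv, inner_zero_left, add_zero]

theorem deriv_m_inner_frozen (hS : IsSmoothState T Ω M S) (ht : t ∈ Ioo 0 T)
    (hx : x ∈ closure Ω) :
    deriv (fun s => ⟪S.m s x, gradient (S.uΩ t) x⟫) t = ⟪S.dtm t x, gradient (S.uΩ t) x⟫ := by
  have h := (hasDerivAt_time (hS.contDiffAt_joint_m ht hx)).inner ℝ
    (hasDerivAt_const t (gradient (S.uΩ t) x))
  rw [h.deriv, inner_zero_right, zero_add]
  rfl

theorem integrableOn_m_deriv_gradient_u (hS : IsSmoothState T Ω M S) (hΩ : IsSmoothDomain Ω Φ)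
    (ht : t ∈ Ioo 0 T) :
    IntegrableOn (fun x => ⟪S.m t x, deriv (fun s => gradient (S.uΩ s) x) t⟫) Ω :=
  (integrableOn_deriv (f := fun s x => ⟪S.m t x, gradient (S.uΩ s) x⟫) hΩ.isCompact_closure
    fun _ hx => hS.contDiffAt_frozen_m_inner ht ht hx).congr_fun
      (fun _ hx => hS.deriv_frozen_m_inner ht (subset_closure hx)) hΩ.isOpen.measurableSet

theorem integrableOn_dtm_gradient_u (hS : IsSmoothState T Ω M S) (hΩ : IsSmoothDomain Ω Φ)
    (ht : t ∈ Ioo 0 T) : IntegrableOn (fun x => ⟪S.dtm t x, gradient (S.uΩ t) x⟫) Ω :=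
  (integrableOn_deriv (f := fun s x => ⟪S.m s x, gradient (S.uΩ t) x⟫) hΩ.isCompact_closure
    fun _ hx => hS.contDiffAt_m_inner_frozen ht ht hx).congr_fun
      (fun _ hx => hS.deriv_m_inner_frozen ht (subset_closure hx)) hΩ.isOpen.measurableSet

end IsSmoothState

/-- The reciprocity relation for the demagnetizing field, differentiated in time. -/
theorem integral_m_deriv_gradient_u (hΩ : IsSmoothDomain Ω Φ)
    (hS : IsSmoothSolution T Ω Φ M L S) (ht : t ∈ Ioo 0 T) :
    ∫ x in Ω, ⟪S.m t x, deriv (fun s => gradient (S.uΩ s) x) t⟫ =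
      ∫ x in Ω, ⟪S.dtm t x, gradient (S.uΩ t) x⟫ := by
  have hsm := hS.smooth
  have hmeas := hΩ.isOpen.measurableSet
  have h1 := hasDerivAt_setIntegral (f := fun s y => ⟪S.m t y, gradient (S.uΩ s) y⟫) hmeas
    hΩ.isCompact_closure (fun s hs x hx => hsm.contDiffAt_frozen_m_inner ht hs hx) ht
  have h2 := hasDerivAt_setIntegral (f := fun s y => ⟪S.m s y, gradient (S.uΩ t) y⟫) hmeas
    hΩ.isCompact_closure (fun s hs x hx => hsm.contDiffAt_m_inner_frozen ht hs hx) ht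
  -- Reciprocity holds with one time frozen at `t` and the other variable. Its two sides, as
  -- functions of the free time, have equal derivatives at `t`.
  have h3 := h1.unique (h2.congr_of_eventuallyEq (by
    filter_upwards [Ioo_mem_nhds ht.1 ht.2] with s hs
    exact integral_m_gradient_u_comm hΩ hS hs ht))
  rw [← setIntegral_congr_fun hmeas fun x hx => hsm.deriv_frozen_m_inner ht (subset_closure hx),
    ← setIntegral_congr_fun hmeas fun x hx => hsm.deriv_m_inner_frozen ht (subset_closure hx), h3]

/-- The local energy density, in which half of the demagnetizing energy is kept in the body. -/
def State.localEnergy (S : State d) (M : Material d) (L : Loads d) (t : ℝ) (x : Vec d) : ℝ :=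
  S.energyDensity M L t x + M.μ₀ / 2 * ⟪S.m t x, gradient (S.uΩ t) x⟫

theorem IsSmoothState.contDiffAt_localEnergy (hS : IsSmoothState T Ω M S) (hM : M.Admissible)
    (hL : SmoothUpTo 1 T Ω L.hext) (ht : t ∈ Ioo 0 T) (hx : x ∈ closure Ω) :
    ContDiffAt ℝ 1 (joint fun s y => S.localEnergy M L s y) (t, x) :=
  (hS.contDiffAt_energyDensity hM hL ht hx).add (contDiffAt_const.mul
    (contDiffAt_joint_inner (hS.contDiffAt_joint_m ht hx)
      (hS.contDiffAt_joint_gradient_uΩ ht hx)))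

/-- All energies become integrals over the fixed bounded set `Ω`, so the whole-space integral, about
whose time dependence outside `Ω` nothing is assumed, need not be differentiated. -/
theorem totalEnergy_eq (hΩ : IsSmoothDomain Ω Φ) (hM : M.Admissible)
    (hL : SmoothUpTo 1 T Ω L.hext) (hS : IsSmoothSolution T Ω Φ M L S) (ht : t ∈ Ioo 0 T) :
    S.totalEnergy M L Ω t = ∫ x in Ω, S.localEnergy M L t x := by
  have hsm := hS.smooth
  rw [State.totalEnergy, integral_demagnetizing hΩ hS ht, ← integral_const_mul]
  refine (integral_add ?_ ?_).symm
  · exact integrableOn_of_contDiffAt_joint (f := fun s y => S.energyDensity M L s y)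
      hΩ.isCompact_closure fun x hx => hsm.contDiffAt_energyDensity hM hL ht hx
  · exact (integrableOn_of_contDiffAt_joint (n := 1)
      (f := fun s y => ⟪S.m s y, gradient (S.uΩ s) y⟫)
      hΩ.isCompact_closure fun x hx => contDiffAt_joint_inner (hsm.contDiffAt_joint_m ht hx)
        (hsm.contDiffAt_joint_gradient_uΩ ht hx)).const_mul _

theorem hasDerivAt_totalEnergy (hΩ : IsSmoothDomain Ω Φ) (hM : M.Admissible)
    (hL : SmoothUpTo 1 T Ω L.hext) (hS : IsSmoothSolution T Ω Φ M L S) (ht : t ∈ Ioo 0 T) :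
    HasDerivAt (fun s => S.totalEnergy M L Ω s)
      (∫ x in Ω, deriv (fun s => S.localEnergy M L s x) t) t := by
  refine (hasDerivAt_setIntegral (f := fun s y => S.localEnergy M L s y)
    hΩ.isOpen.measurableSet hΩ.isCompact_closure
    (fun s hs x hx => hS.smooth.contDiffAt_localEnergy hM hL hs hx) ht).congr_of_eventuallyEq ?_
  filter_upwards [Ioo_mem_nhds ht.1 ht.2] with s hs
  exact totalEnergy_eq hΩ hM hL hS hs

/-- The rate of the local energy density. -/
theorem deriv_localEnergy (hd : d = 2 ∨ d = 3) (hΩ : IsOpen Ω) (hM : M.Admissible)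
    (hL : SmoothUpTo 1 T Ω L.hext) (hS : IsSmoothSolution T Ω Φ M L S) (ht : t ∈ Ioo 0 T)
    (hx : x ∈ Ω) :
    deriv (fun s => S.localEnergy M L s x) t =
      ∑ k, pd k (S.powerFlux M L t k) x +
      (S.ρ t x * ⟪L.g t x, S.v t x⟫ - M.μ₀ * ⟪deriv (fun s => L.hext s x) t, S.m t x⟫) +
      M.μ₀ / 2 * (⟪S.dtm t x, gradient (S.uΩ t) x⟫ -
        ⟪S.m t x, deriv (fun s => gradient (S.uΩ s) x) t⟫) := by
  have hsm := hS.smooth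
  have hx' := subset_closure hx
  have hB := hasDerivAt_time (hsm.contDiffAt_bodyEnergy hM ht hx')
  have hm := hasDerivAt_time (hsm.contDiffAt_joint_m ht hx')
  have hu := hasDerivAt_time (a := fun s y => gradient (S.uΩ s) y)
    (hsm.contDiffAt_joint_gradient_uΩ ht hx')
  have hh := hasDerivAt_time (hL.contDiffAt ht hx')
  have hf : HasDerivAt (fun s => S.field L s x) _ t := hh.add hu
  have h := (hB.sub ((hf.inner ℝ hm).const_mul M.μ₀)).add ((hm.inner ℝ hu).const_mul (M.μ₀ / 2))
  have e : (fun s => S.localEnergy M L s x) = fun s => S.bodyEnergy M s x -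
      M.μ₀ * ⟪S.field L s x, S.m s x⟫ + M.μ₀ / 2 * ⟪S.m s x, gradient (S.uΩ s) x⟫ := by
    funext s
    simp only [State.localEnergy, State.energyDensity, State.bodyEnergy, State.w]
    ring
  rw [e]
  refine h.deriv.trans ?_
  rw [← hsm.local_balance hM hL hd hΩ (hS.bulk t ht) ht hx]
  have e1 : deriv (fun s => S.m s x) t = S.dtm t x := rfl
  rw [e1, inner_add_left, real_inner_comm (S.m t x) (deriv (fun s => gradient (S.uΩ s) x) t)]
  ring

end TotalEnergy

end ThermoMagnet

end

/-! ### The global balance -/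

open ThermoMagnet

theorem mainTheorem3 {d : ℕ} (hd : d = 2 ∨ d = 3) (T : ℝ)
    (Ω : Set (ThermoMagnet.Vec d)) (Φ : ThermoMagnet.Vec d → ℝ)
    (hΩ : ThermoMagnet.IsSmoothDomain Ω Φ)
    (M : ThermoMagnet.Material d) (hM : M.Admissible)
    (L : ThermoMagnet.Loads d) (hL : ThermoMagnet.SmoothUpTo 1 T Ω L.hext)
    (S : ThermoMagnet.State d) (hS : ThermoMagnet.IsSmoothSolution T Ω Φ M L S)
    (t : ℝ) (ht : t ∈ Set.Ioo 0 T) :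
    -- all integrals make sense
    MeasureTheory.IntegrableOn (fun x => S.energyDensity M L t x) Ω ∧
    MeasureTheory.Integrable (fun x => M.μ₀ / 2 * ‖gradient (S.u t) x‖ ^ 2) ∧
    MeasureTheory.IntegrableOn
      (fun x => S.ρ t x * inner ℝ (L.g t x) (S.v t x)
        - M.μ₀ * inner ℝ (deriv (fun s => L.hext s x) t) (S.m t x)) Ω ∧
    MeasureTheory.Integrable (fun x => M.νb / 2 * ‖S.v t x‖ ^ M.p) (ThermoMagnet.surf Ω) ∧
    MeasureTheory.Integrable
      (fun x => inner ℝ (L.k t x) (S.v t x) + L.h t x (S.θ t x)) (ThermoMagnet.surf Ω) ∧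
    -- the total energy is differentiable in time, and the balance holds
    DifferentiableAt ℝ (fun s => S.totalEnergy M L Ω s) t ∧
    deriv (fun s => S.totalEnergy M L Ω s) t
        + ∫ x, M.νb / 2 * ‖S.v t x‖ ^ M.p ∂(ThermoMagnet.surf Ω) =
      (∫ x in Ω, (S.ρ t x * inner ℝ (L.g t x) (S.v t x)
        - M.μ₀ * inner ℝ (deriv (fun s => L.hext s x) t) (S.m t x)))
      + ∫ x, (inner ℝ (L.k t x) (S.v t x) + L.h t x (S.θ t x)) ∂(ThermoMagnet.surf Ω) := by
  have hsm := hS.smooth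
  have hBC := hS.boundary t ht
  have hmeas := hΩ.isOpen.measurableSet
  have hc := hΩ.isCompact_closure
  have hlocal : IntegrableOn (fun x => deriv (fun s => S.localEnergy M L s x) t) Ω :=
    integrableOn_deriv hc fun x hx => hsm.contDiffAt_localEnergy hM hL ht hx
  have hflux : IntegrableOn (fun x => ∑ k, pd k (S.powerFlux M L t k) x) Ω := by
    refine integrable_finsetSum _ fun k _ => ?_
    have h : ContinuousOn (fun x => pd k (S.powerFlux M L t k) x) (closure Ω) := fun x hx =>
      (contDiffAt_pd (m := 0) (hsm.contDiffAt_powerFlux hM hL ht hx k) (by simp)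
        k).continuousAt.continuousWithinAt
    exact (h.integrableOn_compact hc).mono_set subset_closure
  have hm' : IntegrableOn (fun x => inner ℝ (S.dtm t x) (gradient (S.uΩ t) x)) Ω :=
    hsm.integrableOn_dtm_gradient_u hΩ ht
  have hu' : IntegrableOn
      (fun x => inner ℝ (S.m t x) (deriv (fun s => gradient (S.uΩ s) x) t)) Ω :=
    hsm.integrableOn_m_deriv_gradient_u hΩ ht
  have hdiff : IntegrableOn (fun x => M.μ₀ / 2 * (inner ℝ (S.dtm t x) (gradient (S.uΩ t) x) -
      inner ℝ (S.m t x) (deriv (fun s => gradient (S.uΩ s) x) t))) Ω :=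
    (hm'.sub hu').const_mul _
  -- Gravity carries no regularity assumption. On `Ω` the local balance expresses the load power
  -- through integrable functions.
  have hload : IntegrableOn (fun x => S.ρ t x * inner ℝ (L.g t x) (S.v t x)
      - M.μ₀ * inner ℝ (deriv (fun s => L.hext s x) t) (S.m t x)) Ω := by
    refine ((hlocal.sub hflux).sub hdiff).congr_fun (fun x hx => ?_) hmeas
    simp only [Pi.sub_apply]
    rw [deriv_localEnergy hd hΩ.isOpen hM hL hS ht hx]
    ring
  have hE := hasDerivAt_totalEnergy hΩ hM hL hS ht
  refine ⟨?_, integrable_demagnetizing hS ht, hload,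
    hΩ.integrable_surf (continuousOn_speed_rpow hsm hM ht),
    hΩ.integrable_surf (continuousOn_boundary_supply hΩ hBC hsm hM hL ht),
    hE.differentiableAt, ?_⟩
  · exact integrableOn_of_contDiffAt_joint (f := fun s y => S.energyDensity M L s y) hc
      fun x hx => hsm.contDiffAt_energyDensity hM hL ht hx
  · have h1 : ∫ x in Ω, deriv (fun s => S.localEnergy M L s x) t =
        (∫ x in Ω, ∑ k, pd k (S.powerFlux M L t k) x) +
        (∫ x in Ω, (S.ρ t x * inner ℝ (L.g t x) (S.v t x)
          - M.μ₀ * inner ℝ (deriv (fun s => L.hext s x) t) (S.m t x))) +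
        ∫ x in Ω, M.μ₀ / 2 * (inner ℝ (S.dtm t x) (gradient (S.uΩ t) x) -
          inner ℝ (S.m t x) (deriv (fun s => gradient (S.uΩ s) x) t)) := by
      rw [← integral_add hflux hload]
      refine Eq.trans ?_ (integral_add (hflux.add hload) hdiff)
      exact setIntegral_congr_fun hmeas fun x hx =>
        deriv_localEnergy hd hΩ.isOpen hM hL hS ht hx
    -- This term need not vanish pointwise; its integral vanishes by the differentiated reciprocity,
    -- the only nonlocal step of the balance.
    have h2 : ∫ x in Ω, M.μ₀ / 2 * (inner ℝ (S.dtm t x) (gradient (S.uΩ t) x) -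
        inner ℝ (S.m t x) (deriv (fun s => gradient (S.uΩ s) x) t)) = 0 := by
      rw [integral_const_mul, integral_sub hm' hu', integral_m_deriv_gradient_u hΩ hS ht, sub_self,
        mul_zero]
    rw [hE.deriv, h1, h2, integral_sum_pd_powerFlux hΩ hBC hsm hM hL ht]
    ring
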